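/- Let $\mathbb F$ be an algebraically closed field of characteristic $p\ge 3$, let $n\ge 0$, put $\mathbb I=\{0,1,\dots,\frac{p-1}{2}\}$ and $q(i)=i(i+1)\in\mathbb F$. **Algebra and modules.** The affine Hecke–Clifford algebra $\mathfrak H_n$ is the superalgebra over $\mathbb F$ with even generators $s_1,\dots,s_{n-1},x_1,\dots,x_n$, odd generators $c_1,\dots,c_n$ and relations: $s_i^2=1$, $s_is_j=s_js_i$ ($|i-j|>1$), $s_is_{i+1}s_i=s_{i+1}s_is_{i+1}$; $x_ix_j=x_jx_i$; $c_i^2=1$, $c_ic_j=-c_jc_i$ ($i\ne j$); $s_ix_i=x_{i+1}s_i-(1+c_ic_{i+1})$, $s_ix_j=x_js_i$ ($j\ne i,i+1$); $s_ic_i=c_{i+1}s_i$, $s_ic_{i+1}=c_is_i$, $s_ic_j=c_js_i$ ($j\neq i,i+1$); $x_ic_i=-c_ix_i$, $x_ic_j=c_jx_i$ ($i\ne j$). Modules are $\mathbb Z/2$-graded; a homomorphism is a sum of homogeneous linear maps $f$ with $f(av)=(-1)^{\bar f\bar a}af(v)$; irreducible means nonzero without proper nonzero graded submodules. An irreducible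 module is of type $\mathtt M$ (resp. $\mathtt Q$) if its endomorphism algebra has dimension $1$ (resp. $2$). A module is completely splittable if $x_1,\dots,x_n$ act semisimply, and lies in $\operatorname{Rep}_{\mathbb I}\mathfrak H_n$ if it is finite-dimensional and all eigenvalues of the $x_k^2$ are of the form $q(i)$, $i\in\mathbb I$. **The modules $D^{\underline i}$.** Fix square roots in $\mathbb F$. For $i\in\mathbb I$ let $L(i)=\mathbb Fv_0\oplus\mathbb Fv_1$ ($v_0$ even, $v_1$ odd) with $xv_0=\sqrt{q(i)}v_0$, $xv_1=-\sqrt{q(i)}v_1$, $cv_0=v_1$, $cv_1=v_0$. For $\underline i\in\mathbb I^n$ let $L(\underline i)$ be an irreducible component of the super tensor product $L(i_1)\boxtimes\cdots\boxtimes L(i_n)$ as a module over the superalgebra generated by all $x_k,c_k$. For $\tau\in S_n$ write $\tau\cdot\underline i=(i_{\tau^{-1}(1)},\dots,i_{\tau^{-1}(n)})$, and let $L(\underline i)^\tau=\{z^\tau\mid z\in L(\underline i)\}$ with $x_{k}z^\tau=(x_{\tau^{-1}(k)}z)^\tau$, $c_{k}z^\tau=(c_{\tau^{-1}(k)}z)^\tau$.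 The transposition $s_k$ is admissible for $\underline i$ if $i_k\neq i_{k+1}\pm1$. Let $P_{\underline i}\subseteq S_n$ be the set of products $s_{k_t}\cdots s_{k_1}$ ($t\ge 0$) in which each $s_{k_l}$ is admissible for $s_{k_{l-1}}\cdots s_{k_1}\cdot\underline i$. Let $D^{\underline i}=\bigoplus_{\tau\in P_{\underline i}}L(\underline i)^\tau$, where $s_k$ acts by $s_kz^\tau=\Xi_kz^\tau+\Omega_kz^{s_k\tau}$ if $s_k$ is admissible for $\tau\cdot\underline i$, and $s_kz^\tau=\Xi_kz^\tau$ otherwise. Here $$\Xi_k=-\Big(\frac{x_k+x_{k+1}}{x_k^2-x_{k+1}^2}+c_kc_{k+1}\frac{x_k-x_{k+1}}{x_k^2-x_{k+1}^2}\Big),\qquad \Omega_k=\sqrt{1-\frac{2(x_k^2+x_{k+1}^2)}{(x_k^2-x_{k+1}^2)^2}},$$ and $x_k^2$ acts on $L(\underline i)^\tau$ as the scalar $q(j_k)$, $\underline j=\tau\cdot\underline i$. **Diagrams.** A strict partition is identified with its shifted Young diagram ($k$th row shifted right by $k-1$). A placed skew shifted Young diagram $(c,\lambda/\mu)$ consists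 of strict partitions $\mu\subseteq\lambda$ and a function $c$ from the boxes of $\lambda/\mu$ to $\mathbb Z_{\ge0}$ such that: $c(A)=c(B)$ iff $A,B$ lie on the same diagonal; $c(A)=c(B)+1$ iff $A$ lies on the diagonal adjacent to that of $B$ on its northeast side; and $c(A)=0$ whenever the boxes to the right of $A$ and diagonally below-right of $A$ belong to $\lambda/\mu$ but the box below $A$ does not. Two placed diagrams are regarded as the same if they differ by content-preserving translations of connected components, i.e. there is a content-preserving bijection of boxes respecting horizontal and vertical neighbours. Standard tableaux are bijective labelings of the boxes by $1,2,\dots$ that increase along rows and down columns. Let $\mathcal{PS}_u(m)$ be the set of placed diagrams with $m$ boxes and all contents $\le u$, and $\mathcal{PS}^*_u(m)$ the subset of those with a unique box $A$ of content $u$. For $(c,\lambda/\mu)\in\mathcal{PS}^*_u(n-p+2u+1)$ with $1\le u\le\frac{p-3}2$, let $\overline{\lambda/\mu}$ be obtained by adding $p-2u-1$ boxes to the right of $A$ in its row, with contents $u+1,\dots,\frac{p-3}2,\frac{p-1}2,\frac{p-3}2,\dots,u+1,u$. A standard tableau of shape $\overline{\lambda/\mu}$ is $p$-standard if the box below $A$,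 if it exists, has a larger label than the last box in the row of $A$. Let $\mathcal X=\mathcal{PS}_{\frac{p-1}{2}}(n)\cup\bigcup_{1\le u\le\frac{p-3}2}\mathcal{PS}^*_u(n-p+2u+1)$. A vector $\underline i$ affords $(c,\lambda/\mu)\in\mathcal X$ if it is the sequence of contents of the boxes labelled $1,\dots,n$ in a standard tableau of shape $\lambda/\mu$ (first case), respectively in a $p$-standard tableau of shape $\overline{\lambda/\mu}$ (second case). Put $D_p(c,\lambda/\mu)=D^{\underline i}$ for any $\underline i$ affording $(c,\lambda/\mu)$. Let $\gamma_0$ be the number of boxes of content $0$ in $(c,\lambda/\mu)$, $f^{\lambda/\mu}$ the number of standard tableaux of shape $\lambda/\mu$, and $f_p^{\lambda/\mu}$ the number of $p$-standard tableaux of shape $\overline{\lambda/\mu}$. **Theorem.** Every $(c,\lambda/\mu)\in\mathcal X$ is afforded by some vector, and for each such vector and each choice of $L(\underline i)$ the formulas above make $D^{\underline i}$ an $\mathfrak H_n$-module, which up to isomorphism depends only on $(c,\lambda/\mu)$. Moreover: 1. $D_p(c,\lambda/\mu)$ is of type $\mathtt M$ if $\gamma_0$ is even and of type $\mathtt Q$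 if $\gamma_0$ is odd. If $(c,\lambda/\mu)\in\mathcal{PS}_{\frac{p-1}2}(n)$, then $\dim D_p(c,\lambda/\mu)=2^{n-\lfloor\gamma_0/2\rfloor}f^{\lambda/\mu}$. If $(c,\lambda/\mu)\in\mathcal{PS}^*_u(n-p+2u+1)$ for some $1\le u\le\frac{p-3}2$, then $\dim D_p(c,\lambda/\mu)=2^{n-\lfloor\gamma_0/2\rfloor}f_p^{\lambda/\mu}$. 2. The modules $D_p(c,\lambda/\mu)$, $(c,\lambda/\mu)\in\mathcal X$, are irreducible, completely splittable, lie in $\operatorname{Rep}_{\mathbb I}\mathfrak H_n$, and are pairwise non-isomorphic: $D_p(c,\lambda/\mu)\cong D_p(c',\lambda'/\mu')$ if and only if the two placed diagrams are the same. -/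

import Mathlib

noncomputable section

namespace HeckeClifford

/-! ## Supermodules over a superalgebra

A superalgebra is an `F`-algebra `A` with its homogeneous parts `gr 0` (even) and `gr 1` (odd). -/

/-- A submodule is graded when it contains the homogeneous components of its elements. -/
def IsGradedSub {F V : Type*} [Field F] [AddCommGroup V] [Module F V]
    (part : ZMod 2 → Submodule F V) (N : Submodule F V) : Prop :=
  ∀ v ∈ N, ∃ v₀ ∈ N ⊓ part 0, ∃ v₁ ∈ N ⊓ part 1, v = v₀ + v₁

/-- A (left, `ℤ/2`-graded) module structure over the superalgebra `(A, gr)` on the space `V`. -/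
structure SuperModule {F A : Type*} [Field F] [Ring A] [Algebra F A]
    (gr : ZMod 2 → Submodule F A) (V : Type*) [AddCommGroup V] [Module F V] where
  act : A →ₐ[F] Module.End F V
  part : ZMod 2 → Submodule F V
  isInternal : DirectSum.IsInternal part
  act_mem : ∀ (j k : ZMod 2) (a : A) (v : V), a ∈ gr j → v ∈ part k → act a v ∈ part (j + k)

namespace SuperModule

section

variable {F A : Type*} [Field F] [Ring A] [Algebra F A] {gr : ZMod 2 → Submodule F A}
  {V W : Type*} [AddCommGroup V] [Module F V] [AddCommGroup W] [Module F W]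

/-- Irreducible: nonzero, without proper nonzero graded submodules. -/
def Irreducible (M : SuperModule gr V) : Prop :=
  Nontrivial V ∧ ∀ N : Submodule F V, (∀ (a : A), ∀ v ∈ N, M.act a v ∈ N) →
    IsGradedSub M.part N → N = ⊥ ∨ N = ⊤

/-- Homomorphisms of parity `j`: `f (a v) = (-1) ^ (j * |a|) a (f v)` for homogeneous `a`. -/
def homOfParity (M : SuperModule gr V) (N : SuperModule gr W) (j : ZMod 2) :
    Submodule F (V →ₗ[F] W) where
  carrier := {f | (∀ (k : ZMod 2), ∀ v ∈ M.part k, f v ∈ N.part (k + j)) ∧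
    ∀ (l : ZMod 2), ∀ a ∈ gr l, ∀ v : V,
      f (M.act a v) = (-1 : F) ^ (j.val * l.val) • N.act a (f v)}
  add_mem' := by
    rintro f g ⟨hf, hf'⟩ ⟨hg, hg'⟩
    refine ⟨fun k v hv => (N.part _).add_mem (hf k v hv) (hg k v hv), fun l a ha v => ?_⟩
    simp only [LinearMap.add_apply, hf' l a ha v, hg' l a ha v, map_add, smul_add]
  zero_mem' := ⟨fun k v _ => (N.part _).zero_mem, fun l a _ v => by simp⟩
  smul_mem' := by
    rintro r f ⟨hf, hf'⟩
    refine ⟨fun k v hv => (N.part _).smul_mem r (hf k v hv), fun l a ha v => ?_⟩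
    simp only [LinearMap.smul_apply, hf' l a ha v, map_smul]
    rw [smul_comm]

/-- All homomorphisms: sums of an even and an odd one. -/
def hom (M : SuperModule gr V) (N : SuperModule gr W) : Submodule F (V →ₗ[F] W) :=
  homOfParity M N 0 ⊔ homOfParity M N 1

/-- Isomorphism of supermodules; it need not be even. -/
def Isomorphic (M : SuperModule gr V) (N : SuperModule gr W) : Prop :=
  ∃ f ∈ hom M N, Function.Bijective f

/-- Type `M`: irreducible with one-dimensional endomorphism algebra. -/
def IsTypeM (M : SuperModule gr V) : Prop :=
  M.Irreducible ∧ Module.finrank F (hom M M) = 1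

/-- Type `Q`: irreducible with two-dimensional endomorphism algebra. -/
def IsTypeQ (M : SuperModule gr V) : Prop :=
  M.Irreducible ∧ Module.finrank F (hom M M) = 2

end

end SuperModule

/-! ## The affine Hecke-Clifford algebra -/

/-- Generators (indices start at `0`). -/
inductive Gen (n : ℕ) : Type
  | s (k : Fin (n - 1))
  | x (k : Fin n)
  | c (k : Fin n)

/-- The parity of a generator. -/
def Gen.parity {n : ℕ} : Gen n → ZMod 2
  | .s _ => 0
  | .x _ => 0
  | .c _ => 1

/-- The position `k` on which the simple transposition `s_k` acts. -/
def lo {n : ℕ} (k : Fin (n - 1)) : Fin n := ⟨k.val, by omega⟩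

/-- The position `k + 1` on which the simple transposition `s_k` acts. -/
def hi {n : ℕ} (k : Fin (n - 1)) : Fin n := ⟨k.val + 1, by omega⟩

section Algebra

variable (F : Type*) [Field F] (n : ℕ)

/-- The generators of the free algebra. -/
def freeS {n : ℕ} (k : Fin (n - 1)) : FreeAlgebra F (Gen n) := FreeAlgebra.ι F (Gen.s k)
def freeX {n : ℕ} (k : Fin n) : FreeAlgebra F (Gen n) := FreeAlgebra.ι F (Gen.x k)
def freeC {n : ℕ} (k : Fin n) : FreeAlgebra F (Gen n) := FreeAlgebra.ι F (Gen.c k)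

/-- The defining relations of the affine Hecke-Clifford algebra. -/
inductive Rel : FreeAlgebra F (Gen n) → FreeAlgebra F (Gen n) → Prop
  | s_sq (k) : Rel (freeS F k * freeS F k) 1
  | s_comm (j k : Fin (n - 1)) (h : j.val + 1 < k.val) :
      Rel (freeS F j * freeS F k) (freeS F k * freeS F j)
  | s_braid (j k : Fin (n - 1)) (h : j.val + 1 = k.val) :
      Rel (freeS F j * freeS F k * freeS F j) (freeS F k * freeS F j * freeS F k)
  | x_comm (j k) : Rel (freeX F j * freeX F k) (freeX F k * freeX F j)
  | c_sq (k) : Rel (freeC F k * freeC F k) 1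
  | c_anti (j k) (h : j ≠ k) : Rel (freeC F j * freeC F k) (-(freeC F k * freeC F j))
  | s_x (k) : Rel (freeS F k * freeX F (lo k))
      (freeX F (hi k) * freeS F k - (1 + freeC F (lo k) * freeC F (hi k)))
  | s_x_far (k j) (h : j ≠ lo k) (h' : j ≠ hi k) :
      Rel (freeS F k * freeX F j) (freeX F j * freeS F k)
  | s_c_lo (k) : Rel (freeS F k * freeC F (lo k)) (freeC F (hi k) * freeS F k)
  | s_c_hi (k) : Rel (freeS F k * freeC F (hi k)) (freeC F (lo k) * freeS F k)
  | s_c_far (k j) (h : j ≠ lo k) (h' : j ≠ hi k) :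
      Rel (freeS F k * freeC F j) (freeC F j * freeS F k)
  | x_c (k) : Rel (freeX F k * freeC F k) (-(freeC F k * freeX F k))
  | x_c_far (j k) (h : j ≠ k) : Rel (freeX F j * freeC F k) (freeC F k * freeX F j)

/-- The affine Hecke-Clifford algebra. -/
abbrev HC : Type _ := RingQuot (Rel F n)

variable {n}

/-- The image of a generator in the algebra. -/
def HC.gen (g : Gen n) : HC F n := RingQuot.mkAlgHom F (Rel F n) (FreeAlgebra.ι F g)

/-- The homogeneous parts: spanned by the words in the generators of the given parity. -/
def HC.gr (j : ZMod 2) : Submodule F (HC F n) :=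
  Submodule.span F {w | ∃ l : List (Gen n),
    (l.map Gen.parity).sum = j ∧ w = (l.map (HC.gen F)).prod}

end Algebra

section Modules

variable {F : Type*} [Field F] {n : ℕ}

/-- `q(i) = i (i + 1)`. -/
def q (F : Type*) [Field F] (i : ℕ) : F := (i : F) * ((i : F) + 1)

/-- Completely splittable: `x_1, …, x_n` act semisimply. -/
def CompletelySplittable {V : Type*} [AddCommGroup V] [Module F V]
    (M : SuperModule (HC.gr F (n := n)) V) : Prop :=
  ∀ k : Fin n, (M.act (HC.gen F (Gen.x k))).IsSemisimple

/-- Integral modules in characteristic `p ≥ 3`: finite-dimensional, and all eigenvalues of the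
`x_k ^ 2` are of the form `q(i)` with `i ∈ {0, …, (p - 1) / 2}`. -/
def IsIntegral (p : ℕ) {V : Type*} [AddCommGroup V] [Module F V]
    (M : SuperModule (HC.gr F (n := n)) V) : Prop :=
  FiniteDimensional F V ∧ ∀ (k : Fin n) (a : F),
    Module.End.HasEigenvalue (M.act (HC.gen F (Gen.x k)) ^ 2) a → ∃ i ≤ (p - 1) / 2, a = q F i

/-! ## The module `L(i)` over the subalgebra generated by the `x_k` and `c_k`

For an integer `i`, `L(i)` has basis `v_0` (even), `v_1` (odd), with
`x v_0 = √q(i) v_0`, `x v_1 = -√q(i) v_1`, `c v_0 = v_1`, `c v_1 = v_0`.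
For a vector `i`, the super tensor product `L(i_1) ⊠ ⋯ ⊠ L(i_n)` has basis
`e_ε = v_{ε_1} ⊗ ⋯ ⊗ v_{ε_n}`, and
`x_k e_ε = (-1) ^ ε_k √q(i_k) e_ε`, `c_k e_ε = (-1) ^ (ε_1 + ⋯ + ε_{k-1}) e_{ε + δ_k}`. -/

/-- The underlying space of `L(i_1) ⊠ ⋯ ⊠ L(i_n)`: coordinates in the basis `e_ε`. -/
abbrev TensorSpace (F : Type*) [Field F] (n : ℕ) : Type _ := (Fin n → ZMod 2) → F

/-- The span of the `e_ε` of parity `j`. -/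
def tensorPart (F : Type*) [Field F] (n : ℕ) (j : ZMod 2) : Submodule F (TensorSpace F n) where
  carrier := {f | ∀ ε, ∑ k, ε k ≠ j → f ε = 0}
  add_mem' := fun hf hg ε h => by simp [hf ε h, hg ε h]
  zero_mem' := fun _ _ => rfl
  smul_mem' := fun r f hf ε h => by simp [hf ε h]

/-- The action of `c_k`. -/
def tensorC (k : Fin n) : Module.End F (TensorSpace F n) where
  toFun f := fun ε =>
    (∏ j ∈ Finset.univ.filter (· < k), (-1) ^ (ε j).val) * f (Function.update ε k (ε k + 1))
  map_add' f g := by funext ε; simp [mul_add]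
  map_smul' r f := by funext ε; simp [mul_left_comm]

/-- A fixed choice of square roots. -/
def root [IsAlgClosed F] (a : F) : F :=
  (IsAlgClosed.exists_pow_nat_eq a (n := 2) two_pos).choose

/-- The action of `x_k`. -/
def tensorX [IsAlgClosed F] (i : Fin n → ℕ) (k : Fin n) : Module.End F (TensorSpace F n) where
  toFun f := fun ε => (-1) ^ (ε k).val * root (q F (i k)) * f ε
  map_add' f g := by funext ε; simp [mul_add]
  map_smul' r f := by funext ε; simp [mul_left_comm]

/-- Graded subspaces of `L(i_1) ⊠ ⋯ ⊠ L(i_n)` stable under all `x_k` and `c_k`. -/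
structure IsTensorSub [IsAlgClosed F] (i : Fin n → ℕ) (N : Submodule F (TensorSpace F n)) :
    Prop where
  x_mem : ∀ k, ∀ v ∈ N, tensorX i k v ∈ N
  c_mem : ∀ k, ∀ v ∈ N, tensorC k v ∈ N
  graded : IsGradedSub (tensorPart F n) N

/-- `L(i) = L(i_1) ⊛ ⋯ ⊛ L(i_n)`: an irreducible component of `L(i_1) ⊠ ⋯ ⊠ L(i_n)`. -/
structure Component (F : Type*) [Field F] [IsAlgClosed F] {n : ℕ} (i : Fin n → ℕ) where
  carrier : Submodule F (TensorSpace F n)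
  isSub : IsTensorSub i carrier
  ne_bot : carrier ≠ ⊥
  minimal : ∀ N ≤ carrier, IsTensorSub i N → N = ⊥ ∨ N = carrier

namespace Component

variable [IsAlgClosed F] {i : Fin n → ℕ} (L : Component F i)

/-- The underlying space of `L(i)`. -/
def Space : Type _ := L.carrier

instance : AddCommGroup L.Space := inferInstanceAs (AddCommGroup L.carrier)

instance : Module F L.Space := inferInstanceAs (Module F L.carrier)

/-- The inclusion of `L(i)` in `L(i_1) ⊠ ⋯ ⊠ L(i_n)`. -/
def incl : L.Space →ₗ[F] TensorSpace F n := L.carrier.subtype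

/-- `x_k` on `L(i)`. -/
def X (k : Fin n) : Module.End F L.Space := (tensorX i k).restrict (L.isSub.x_mem k)

/-- `c_k` on `L(i)`. -/
def C (k : Fin n) : Module.End F L.Space := (tensorC k).restrict (L.isSub.c_mem k)

end Component

/-! ## The module `D^i` -/

/-- `τ · i = (i_{τ⁻¹(1)}, …, i_{τ⁻¹(n)})`. -/
def permute (τ : Equiv.Perm (Fin n)) (i : Fin n → ℕ) : Fin n → ℕ := fun k => i (τ⁻¹ k)

/-- The simple transposition `s_k`. -/
def simple (k : Fin (n - 1)) : Equiv.Perm (Fin n) := Equiv.swap (lo k) (hi k)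

/-- `s_k` is admissible with respect to `i`: `i_k ≠ i_{k+1} ± 1`. -/
def Admissible (i : Fin n → ℕ) (k : Fin (n - 1)) : Prop :=
  i (lo k) ≠ i (hi k) + 1 ∧ i (hi k) ≠ i (lo k) + 1

/-- `P_i`: the products `s_{k_t} ⋯ s_{k_1}` in which every `s_{k_l}` is admissible with respect to
`s_{k_{l-1}} ⋯ s_{k_1} · i`. -/
inductive IsAdmissibleProduct (i : Fin n → ℕ) : Equiv.Perm (Fin n) → Prop
  | one : IsAdmissibleProduct i 1
  | step (τ : Equiv.Perm (Fin n)) (k : Fin (n - 1)) :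
      IsAdmissibleProduct i τ → Admissible (permute τ i) k →
        IsAdmissibleProduct i (simple k * τ)

abbrev P (i : Fin n → ℕ) : Type := {τ : Equiv.Perm (Fin n) // IsAdmissibleProduct i τ}

section D

variable [IsAlgClosed F] {i : Fin n → ℕ} (L : Component F i)

/-- The space `D^i = ⨁_{τ ∈ P_i} L(i)^τ`; the element `z ^ τ` is `Finsupp.single τ z`. -/
abbrev DSpace : Type _ := P i →₀ L.Space

/-- The grading of `D^i`, inherited from `L(i)`. -/
def DPart (j : ZMod 2) : Submodule F (DSpace L) where
  carrier := {f | ∀ τ, L.incl (f τ) ∈ tensorPart F n j}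
  add_mem' := fun hf hg τ => by simpa using (tensorPart F n j).add_mem (hf τ) (hg τ)
  zero_mem' := fun _ => by simp
  smul_mem' := fun r _ hf τ => by simpa using (tensorPart F n j).smul_mem r (hf τ)

/-- `x_k z ^ τ = (x_{τ⁻¹(k)} z) ^ τ`. -/
def DX (k : Fin n) : Module.End F (DSpace L) :=
  Finsupp.lsum F fun τ : P i => Finsupp.lsingle τ ∘ₗ L.X (τ.1⁻¹ k)

/-- `c_k z ^ τ = (c_{τ⁻¹(k)} z) ^ τ`. -/
def DC (k : Fin n) : Module.End F (DSpace L) :=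
  Finsupp.lsum F fun τ : P i => Finsupp.lsingle τ ∘ₗ L.C (τ.1⁻¹ k)

/-- The operator `Ξ_k` of `L(i)^τ`,
`- ((x_k + x_{k+1}) / (x_k ^ 2 - x_{k+1} ^ 2)
    + c_k c_{k+1} (x_k - x_{k+1}) / (x_k ^ 2 - x_{k+1} ^ 2))`,
where `x_k ^ 2 - x_{k+1} ^ 2` is the scalar `q(j_k) - q(j_{k+1})` for `j = τ · i`. -/
def Xi (τ : P i) (k : Fin (n - 1)) : DSpace L →ₗ[F] DSpace L :=
  -((q F (permute τ.1 i (lo k)) - q F (permute τ.1 i (hi k)))⁻¹ •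
    ((DX L (lo k) + DX L (hi k)) + DC L (lo k) * DC L (hi k) * (DX L (lo k) - DX L (hi k))))

/-- The scalar by which `Ω_k` acts on a space of weight `j`. -/
def omegaScalar (F : Type*) [Field F] [IsAlgClosed F] {n : ℕ} (j : Fin n → ℕ)
    (k : Fin (n - 1)) : F :=
  root (1 - 2 * (q F (j (lo k)) + q F (j (hi k))) / (q F (j (lo k)) - q F (j (hi k))) ^ 2)

open Classical in
/-- `s_k z ^ τ = Ξ_k z ^ τ + Ω_k z ^ (s_k τ)` if `s_k` is admissible with respect to `τ · i`, and
`s_k z ^ τ = Ξ_k z ^ τ` otherwise. -/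
def DS (k : Fin (n - 1)) : Module.End F (DSpace L) :=
  Finsupp.lsum F fun τ : P i =>
    Xi L τ k ∘ₗ Finsupp.lsingle τ +
      if h : Admissible (permute τ.1 i) k then
        omegaScalar F (permute (simple k * τ.1) i) k •
          Finsupp.lsingle (⟨simple k * τ.1, .step τ.1 k τ.2 h⟩ : P i)
      else 0

/-- `M` is the module structure of `D^i`: the given grading and the given action formulas. -/
structure IsDModule (M : SuperModule (HC.gr F (n := n)) (DSpace L)) : Prop where
  part_eq : M.part = DPart L
  act_x : ∀ k, M.act (HC.gen F (Gen.x k)) = DX L k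
  act_c : ∀ k, M.act (HC.gen F (Gen.c k)) = DC L k
  act_s : ∀ k, M.act (HC.gen F (Gen.s k)) = DS L k

end D

end Modules

/-! ## Placed skew shifted Young diagrams -/

/-- Strict partitions: the parts `lam 0 > lam 1 > ⋯`, followed by zeros. -/
def IsStrictPartition (lam : ℕ → ℕ) : Prop := ∀ k, lam (k + 1) ≠ 0 → lam (k + 1) < lam k

/-- The boxes `(row, column)` of the skew shifted Young diagram `lam / mu`: row `k` is shifted to
the right by `k` squares. -/
def skewBoxes (lam mu : ℕ → ℕ) : Set (ℕ × ℕ) :=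
  {b | b.1 + mu b.1 ≤ b.2 ∧ b.2 < b.1 + lam b.1}

/-- A placed skew shifted Young diagram. Box `A` lies on the diagonal next to that of `B`, to the
northeast, iff `col A - row A = col B - row B + 1`; subtractions are cleared. -/
structure PlacedDiagram where
  lam : ℕ → ℕ
  mu : ℕ → ℕ
  lam_strict : IsStrictPartition lam
  mu_strict : IsStrictPartition mu
  mu_le : ∀ k, mu k ≤ lam k
  content : skewBoxes lam mu → ℕ
  content_eq : ∀ A B, content A = content B ↔ A.1.2 + B.1.1 = B.1.2 + A.1.1
  content_succ : ∀ A B, content A = content B + 1 ↔ A.1.2 + B.1.1 = B.1.2 + A.1.1 + 1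
  content_zero : ∀ A, (A.1.1, A.1.2 + 1) ∈ skewBoxes lam mu →
    (A.1.1 + 1, A.1.2 + 1) ∈ skewBoxes lam mu → (A.1.1 + 1, A.1.2) ∉ skewBoxes lam mu →
    content A = 0

namespace PlacedDiagram

/-- The boxes of the diagram. -/
abbrev Box (D : PlacedDiagram) : Type := skewBoxes D.lam D.mu

variable (D : PlacedDiagram)

/-- `B` is the right neighbour of `A`. -/
def RightOf {D : PlacedDiagram} (A B : D.Box) : Prop := B.1 = (A.1.1, A.1.2 + 1)

/-- `B` is the box directly below `A`. -/
def BelowOf {D : PlacedDiagram} (A B : D.Box) : Prop := B.1 = (A.1.1 + 1, A.1.2)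

/-- Two data describe the same placed skew shifted Young diagram when they differ only by
translations of connected components: there is a content-preserving bijection of the boxes which
respects horizontal and vertical neighbours. -/
def Same (D E : PlacedDiagram) : Prop :=
  ∃ e : D.Box ≃ E.Box, (∀ A, E.content (e A) = D.content A) ∧
    (∀ A B, RightOf (e A) (e B) ↔ RightOf A B) ∧ (∀ A B, BelowOf (e A) (e B) ↔ BelowOf A B)

/-- `PS_u(m)`: `m` boxes, all contents at most `u`. -/
def InPS (u m : ℕ) : Prop := Nat.card D.Box = m ∧ ∀ A, D.content A ≤ u

/-- `PS*_u(m)`: moreover there is a unique box of content `u`. -/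
def InPSStar (u m : ℕ) : Prop := D.InPS u m ∧ ∃! A, D.content A = u

/-- The number `γ₀` of boxes of content zero. -/
def gammaZero : ℕ := Nat.card {A : D.Box // D.content A = 0}

/-- Standard tableaux with entries `0, …, n - 1`; `T k` is the box labelled `k`. -/
def IsStandard {n : ℕ} (T : Fin n ≃ D.Box) : Prop :=
  (∀ A B : D.Box, A.1.1 = B.1.1 → A.1.2 < B.1.2 → T.symm A < T.symm B) ∧
  (∀ A B : D.Box, A.1.2 = B.1.2 → A.1.1 < B.1.1 → T.symm A < T.symm B)

/-- The number `f` of standard tableaux, for a diagram with `n` boxes. -/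
def numStandard (n : ℕ) : ℕ := Nat.card {T : Fin n ≃ D.Box // D.IsStandard T}

/-- The boxes of the extended diagram: to the right of the box of content `u`, in its row,
`p - 2u - 1` further boxes are added (numbered from left to right). -/
abbrev ExtBox (p u : ℕ) : Type := D.Box ⊕ Fin (p - 2 * u - 1)

/-- `p`-standard tableaux of the extended shape: entries increase along rows and down columns, and
the entry of the box below the box of content `u`, if there is one, is greater than the last entry
of the row of the box of content `u`. -/
structure IsPStandard (p u : ℕ) {n : ℕ} (S : Fin n ≃ D.ExtBox p u) : Prop where
  row : ∀ A B : D.Box, A.1.1 = B.1.1 → A.1.2 < B.1.2 → S.symm (.inl A) < S.symm (.inl B)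
  col : ∀ A B : D.Box, A.1.2 = B.1.2 → A.1.1 < B.1.1 → S.symm (.inl A) < S.symm (.inl B)
  row_new : ∀ (A : D.Box) (e : Fin (p - 2 * u - 1)), D.content A = u →
    S.symm (.inl A) < S.symm (.inr e)
  new_new : ∀ e e' : Fin (p - 2 * u - 1), e < e' → S.symm (.inr e) < S.symm (.inr e')
  below : ∀ (A B : D.Box) (e : Fin (p - 2 * u - 1)), D.content A = u → BelowOf A B →
    e.val + 1 = p - 2 * u - 1 → S.symm (.inr e) < S.symm (.inl B)

/-- The number `f_p` of `p`-standard tableaux with `n` entries. -/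
def numPStandard (p u n : ℕ) : ℕ := Nat.card {S : Fin n ≃ D.ExtBox p u // D.IsPStandard p u S}

/-- Contents of the extended diagram; those of the added boxes are, from left to right,
`u + 1, …, (p - 3) / 2, (p - 1) / 2, (p - 3) / 2, …, u + 1, u`. -/
def extContent (p u : ℕ) : D.ExtBox p u → ℕ
  | .inl A => D.content A
  | .inr e => if u + (e.val + 1) ≤ (p - 1) / 2 then u + (e.val + 1) else p - 1 - u - (e.val + 1)

/-- First family of indices: `PS_{(p-1)/2}(n)`. -/
def First (p n : ℕ) : Prop := D.InPS ((p - 1) / 2) n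

/-- Second family of indices, for a given `u`: `1 ≤ u ≤ (p - 3) / 2` and the diagram belongs to
`PS*_u(m)` with `m = n - p + 2u + 1`. -/
def Second (p n u : ℕ) : Prop :=
  1 ≤ u ∧ u ≤ (p - 3) / 2 ∧ ∃ m, m + p = n + 2 * u + 1 ∧ D.InPSStar u m

/-- The index set of the modules `D_p`. -/
def IsIndex (p n : ℕ) : Prop := D.First p n ∨ ∃ u, D.Second p n u

/-- The vector `i` affords the diagram: it is the sequence of contents along a standard tableau
(first family) or a `p`-standard tableau of the extended shape (second family). -/
def Affords (p : ℕ) {n : ℕ} (i : Fin n → ℕ) : Prop :=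
  (D.First p n ∧ ∃ T : Fin n ≃ D.Box, D.IsStandard T ∧ ∀ k, i k = D.content (T k)) ∨
  (∃ u, D.Second p n u ∧ ∃ S : Fin n ≃ D.ExtBox p u, D.IsPStandard p u S ∧
    ∀ k, i k = D.extContent p u (S k))

end PlacedDiagram

/-- A construction of `D_p(c, λ/μ)` for the diagram `D`: it is `D^i` for some vector `i` affording
`D`, some irreducible component `L(i)`, and the module structure of `D^i`. -/
structure DpModule (F : Type*) [Field F] [IsAlgClosed F] (p n : ℕ) (D : PlacedDiagram) where
  weight : Fin n → ℕ
  affords : D.Affords p weight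
  comp : Component F weight
  mod : SuperModule (HC.gr F (n := n)) (DSpace comp)
  isD : IsDModule comp mod

end HeckeClifford

end

set_option linter.unusedSectionVars false
set_option linter.unusedSimpArgs false

noncomputable section

namespace HeckeClifford

/-! ## Identities between three Clifford pairs -/

section Triple

variable {F A : Type*} [Field F] [Ring A] [Algebra F A] {qa qb qc : F} {x y z c d e : A}

/-- Three pairs `(x, c)`, `(y, d)`, `(z, e)` of a polynomial and a Clifford generator, on a space
where the squares of the polynomial generators are scalars. -/
structure IsTriple {F A : Type*} [Field F] [Ring A] [Algebra F A] (qa qb qc : F)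
    (x y z c d e : A) : Prop where
  xx : x * x = qa • (1 : A)
  yy : y * y = qb • (1 : A)
  zz : z * z = qc • (1 : A)
  yx : y * x = x * y
  zx : z * x = x * z
  zy : z * y = y * z
  cc : c * c = 1
  dd : d * d = 1
  ee : e * e = 1
  dc : d * c = -(c * d)
  ec : e * c = -(c * e)
  ed : e * d = -(d * e)
  xc : x * c = -(c * x)
  yd : y * d = -(d * y)
  ze : z * e = -(e * z)
  xd : x * d = d * x
  xe : x * e = e * x
  yc : y * c = c * y
  ye : y * e = e * y
  zc : z * c = c * z
  zd : z * d = d * z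

/-- The numerator of the operators `Ξ`. -/
def mixer (x y c d : A) : A := (x + y) + c * d * (x - y)

/-- In right-associated words a relation `a * b = r` is usually followed by further letters. This
form lets `simp` use it there, so that the relations bring every word to a normal form. -/
theorem mul_mul_of_eq {R : Type*} [Semigroup R] {a b r : R} (h : a * b = r) (t : R) :
    a * (b * t) = r * t := by rw [← mul_assoc, h]

/-- Both identities are checked on normal forms. Denominators are cleared: division by the three
differences turns them into the Yang-Baxter identities `xiOp_yang_baxter`. -/
theorem IsTriple.yang_baxter (h : IsTriple qa qb qc x y z c d e) :
    ((qa - qc) • (mixer y z d e * mixer x y c d) =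
      (qb - qc) • (mixer x y c d * mixer x z c e) +
        (qa - qb) • (mixer x z c e * mixer y z d e)) ∧
    ((qa - qc) • (mixer x y c d * mixer y z d e) =
      (qb - qc) • (mixer x z c e * mixer x y c d) +
        (qa - qb) • (mixer y z d e * mixer x z c e)) := by
  obtain ⟨h1, h2, h3, h4, h5, h6, h7, h8, h9, h10, h11, h12, h13, h14, h15, h16, h17, h18, h19,
    h20, h21⟩ := h
  constructor <;>
  · simp only [mixer, mul_add, add_mul, mul_sub, sub_mul, mul_assoc, h1, h2, h3, h4, h5, h6, h7,
      h8, h9, h10, h11, h12, h13, h14, h15, h16, h17, h18, h19, h20, h21,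
      mul_mul_of_eq h1, mul_mul_of_eq h2, mul_mul_of_eq h3, mul_mul_of_eq h4, mul_mul_of_eq h5,
      mul_mul_of_eq h6, mul_mul_of_eq h7, mul_mul_of_eq h8, mul_mul_of_eq h9, mul_mul_of_eq h10,
      mul_mul_of_eq h11, mul_mul_of_eq h12, mul_mul_of_eq h13, mul_mul_of_eq h14,
      mul_mul_of_eq h15, mul_mul_of_eq h16, mul_mul_of_eq h17, mul_mul_of_eq h18,
      mul_mul_of_eq h19, mul_mul_of_eq h20, mul_mul_of_eq h21, neg_mul, mul_neg, neg_neg,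
      smul_mul_assoc, mul_smul_comm, one_mul, mul_one]
    module

/-- Two pairs `(x, c)`, `(y, d)` of a polynomial and a Clifford generator. -/
structure IsPair {F A : Type*} [Field F] [Ring A] [Algebra F A] (qa qb : F)
    (x y c d : A) : Prop where
  xx : x * x = qa • (1 : A)
  yy : y * y = qb • (1 : A)
  yx : y * x = x * y
  cc : c * c = 1
  dd : d * d = 1
  dc : d * c = -(c * d)
  xc : x * c = -(c * x)
  yd : y * d = -(d * y)
  xd : x * d = d * x
  yc : y * c = c * y

/-- These carry, up to the factor `-(qa - qb)⁻¹`, all relations of `Ξ` that involve two positions: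
its square, its antisymmetry, and its commutation with `x` and `c`. -/
theorem IsPair.mixer_relations (h : IsPair qa qb x y c d) :
    mixer x y c d * mixer x y c d = (2 * (qa + qb)) • (1 : A) ∧
    mixer y x d c = mixer x y c d ∧
    mixer x y c d * x = y * mixer x y c d + (qa - qb) • (1 + c * d) ∧
    mixer x y c d * c = d * mixer x y c d ∧ mixer x y c d * d = c * mixer x y c d := by
  obtain ⟨h1, h2, h4, h7, h8, h10, h13, h14, h16, h18⟩ := h
  refine ⟨?_, ?_, ?_, ?_, ?_⟩ <;>
  simp only [mixer, mul_add, add_mul, mul_sub, sub_mul, mul_assoc, h1, h2, h4, h7,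
      h8, h10, h13, h14, h16, h18,
      mul_mul_of_eq h1, mul_mul_of_eq h2, mul_mul_of_eq h4,
      mul_mul_of_eq h7, mul_mul_of_eq h8, mul_mul_of_eq h10,
      mul_mul_of_eq h13, mul_mul_of_eq h14,
      mul_mul_of_eq h16, mul_mul_of_eq h18, neg_mul, mul_neg, neg_neg,
      smul_mul_assoc, mul_smul_comm, one_mul, mul_one] <;>
  module

theorem mixer_mul_comm (hx : x * z = z * x) (hy : y * z = z * y)
    (hcd : c * d * z = z * (c * d)) : mixer x y c d * z = z * mixer x y c d := by
  simp only [mixer, mul_add, add_mul, mul_sub, sub_mul, mul_assoc, hx, hy]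
  simp only [← mul_assoc, ← hcd]

/-- The braid relation for `Ξ` when the outer weights agree and both `Ω` vanish. The sign is minus
because the denominators `qa - qb` and `qb - qa` of the two operators are opposite. -/
theorem IsTriple.mixer_braid (h : IsTriple qa qb qa x y z c d e)
    (h0 : x = 0 ∧ z = 0 ∧ qa = 0 ∨ qa + 3 * qb = 0) :
    mixer x y c d * mixer y z d e * mixer x y c d =
      -(mixer y z d e * mixer x y c d * mixer y z d e) := by
  obtain ⟨h1, h2, h3, h4, h5, h6, h7, h8, h9, h10, h11, h12, h13, h14, h15, h16, h17, h18, h19,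
    h20, h21⟩ := h
  suffices (mixer x y c d * mixer y z d e * mixer x y c d) +
      (mixer y z d e * mixer x y c d * mixer y z d e) = 0 by
    rw [eq_neg_iff_add_eq_zero, this]
  obtain ⟨h0, h0', -⟩ | h0 := h0
  · simp only [mixer, h0, h0', zero_add, add_zero, zero_sub, sub_zero]
    simp only [mul_add, add_mul, mul_assoc, h2, h7, h8, h9, h10, h11, h12, h14, h18, h19,
      mul_mul_of_eq h2, mul_mul_of_eq h7, mul_mul_of_eq h8, mul_mul_of_eq h9, mul_mul_of_eq h10,
      mul_mul_of_eq h11, mul_mul_of_eq h12, mul_mul_of_eq h14, mul_mul_of_eq h18,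
      mul_mul_of_eq h19, neg_mul, mul_neg, neg_neg, smul_mul_assoc, mul_smul_comm, one_mul,
      mul_one]
    module
  · simp only [mixer, mul_add, add_mul, mul_sub, sub_mul, mul_assoc, h1, h2, h3, h4, h5, h6, h7,
      h8, h9, h10, h11, h12, h13, h14, h15, h16, h17, h18, h19, h20, h21,
      mul_mul_of_eq h1, mul_mul_of_eq h2, mul_mul_of_eq h3, mul_mul_of_eq h4, mul_mul_of_eq h5,
      mul_mul_of_eq h6, mul_mul_of_eq h7, mul_mul_of_eq h8, mul_mul_of_eq h9, mul_mul_of_eq h10,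
      mul_mul_of_eq h11, mul_mul_of_eq h12, mul_mul_of_eq h13, mul_mul_of_eq h14,
      mul_mul_of_eq h15, mul_mul_of_eq h16, mul_mul_of_eq h17, mul_mul_of_eq h18,
      mul_mul_of_eq h19, mul_mul_of_eq h20, mul_mul_of_eq h21, neg_mul, mul_neg, neg_neg,
      smul_mul_assoc, mul_smul_comm, one_mul, mul_one, mul_zero, zero_mul]
    -- A coefficient of the normal form vanishes identically or is `±2 (qa + 3 qb)`.
    match_scalars <;> first | ring1 | linear_combination 2 * h0 | linear_combination (-2) * h0
end Triple

/-! ## Supermodules over superalgebras spanned by words in homogeneous generators -/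

theorem eq_zero_or_one (j : ZMod 2) : j = 0 ∨ j = 1 := by revert j; decide

section Super

variable {F A G V W U : Type*} [Field F] [Ring A] [Algebra F A]
  [AddCommGroup V] [Module F V] [AddCommGroup W] [Module F W] [AddCommGroup U] [Module F U]

/-- The span of the words of parity `j` in the generators. -/
def wordGr (F : Type*) [Field F] {A G : Type*} [Ring A] [Algebra F A] (gen : G → A)
    (par : G → ZMod 2) (j : ZMod 2) : Submodule F A :=
  Submodule.span F {w | ∃ l : List G, (l.map par).sum = j ∧ w = (l.map gen).prod}

variable {gen : G → A} {par : G → ZMod 2} {gr : ZMod 2 → Submodule F A}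

theorem gen_mem_gr (hgr : ∀ j, gr j = wordGr F gen par j) (g : G) : gen g ∈ gr (par g) := by
  rw [hgr]
  exact Submodule.subset_span ⟨[g], by simp, by simp⟩

/-- A graded action of an algebra is determined by the parities of the actions of generators. -/
def SuperModule.ofGen (hgr : ∀ j, gr j = wordGr F gen par j) (act : A →ₐ[F] Module.End F V)
    (part : ZMod 2 → Submodule F V) (hint : DirectSum.IsInternal part)
    (h : ∀ g k, ∀ v ∈ part k, act (gen g) v ∈ part (par g + k)) : SuperModule gr V where
  act := act
  part := part
  isInternal := hint
  act_mem := by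
    intro j k a v ha hv
    rw [hgr] at ha
    induction ha using Submodule.span_induction with
    | mem a ha =>
      obtain ⟨l, rfl, rfl⟩ := ha
      induction l with
      | nil => simpa using hv
      | cons g l ih =>
        simpa [add_assoc] using h g _ _ ih
    | zero => simp
    | add a b _ _ iha ihb => simpa using (part _).add_mem iha ihb
    | smul r a _ ih => simpa using (part _).smul_mem r ih

/-- Taking `val` is not additive on `ZMod 2`, but its parity is, and the sign depends on nothing
else. -/
theorem neg_one_pow_val_add (j k l : ZMod 2) :
    (-1 : F) ^ (j.val * (k + l).val) = (-1) ^ (j.val * k.val) * (-1) ^ (j.val * l.val) := by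
  have h : (1 + 1 : ZMod 2).val = 0 := by decide
  obtain rfl | rfl := eq_zero_or_one j <;> obtain rfl | rfl := eq_zero_or_one k <;>
    obtain rfl | rfl := eq_zero_or_one l <;> simp [ZMod.val_one, h]

theorem mem_homOfParity_of_gen (hgr : ∀ j, gr j = wordGr F gen par j) {M : SuperModule gr V}
    {N : SuperModule gr W} {j : ZMod 2} {f : V →ₗ[F] W}
    (hf : ∀ k, ∀ v ∈ M.part k, f v ∈ N.part (k + j))
    (h : ∀ g v, f (M.act (gen g) v) = (-1 : F) ^ (j.val * (par g).val) • N.act (gen g) (f v)) :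
    f ∈ SuperModule.homOfParity M N j := by
  refine ⟨hf, fun l a ha => ?_⟩
  rw [hgr] at ha
  induction ha using Submodule.span_induction with
  | mem a ha =>
    obtain ⟨l, rfl, rfl⟩ := ha
    induction l with
    | nil => simp
    | cons g l ih =>
      intro v
      simp only [List.map_cons, List.prod_cons, map_mul, Module.End.mul_apply, h, ih,
        List.sum_cons, neg_one_pow_val_add, map_smul, smul_smul]
  | zero => simp
  | add a b _ _ iha ihb => intro v; simp [iha, ihb]
  | smul r a _ ih => intro v; simp [ih, smul_comm r]

/-! ### Homogeneous components -/

theorem isCompl_of_isInternal {part : ZMod 2 → Submodule F V} (h : DirectSum.IsInternal part) :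
    IsCompl (part 0) (part 1) :=
  (DirectSum.isInternal_submodule_iff_isCompl part (by decide)
    (by ext x; simpa using eq_zero_or_one x)).1 h

theorem isInternal_of_isCompl {part : ZMod 2 → Submodule F V} (h : IsCompl (part 0) (part 1)) :
    DirectSum.IsInternal part :=
  (DirectSum.isInternal_submodule_iff_isCompl part (by decide)
    (by ext x; simpa using eq_zero_or_one x)).2 h

theorem exists_components {part : ZMod 2 → Submodule F V} (h : DirectSum.IsInternal part) (v : V) :
    ∃ v₀ ∈ part 0, ∃ v₁ ∈ part 1, v = v₀ + v₁ := by
  obtain ⟨a, ha, b, hb, rfl⟩ := Submodule.mem_sup.1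
    (show v ∈ part 0 ⊔ part 1 by rw [(isCompl_of_isInternal h).sup_eq_top]; trivial)
  exact ⟨a, ha, b, hb, rfl⟩

theorem components_eq_zero {part : ZMod 2 → Submodule F V} (h : DirectSum.IsInternal part)
    {j : ZMod 2} {a b : V} (ha : a ∈ part j) (hb : b ∈ part (1 + j)) (hab : a + b = 0) :
    a = 0 ∧ b = 0 := by
  have key : ∀ a ∈ part 0, ∀ b ∈ part 1, a + b = 0 → a = 0 ∧ b = 0 := by
    intro a ha b hb hab
    have : a = 0 := (Submodule.disjoint_def.1 (isCompl_of_isInternal h).disjoint) a ha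
      (by rw [eq_neg_of_add_eq_zero_left hab]; exact (part 1).neg_mem hb)
    simp_all
  obtain rfl | rfl := eq_zero_or_one j
  · exact key a ha b (by simpa using hb) hab
  · rw [show (1 : ZMod 2) + 1 = 0 by decide] at hb
    exact (key b hb a ha (by rw [add_comm, hab])).symm

/-- The parity involution. -/
def parityInv {part : ZMod 2 → Submodule F V} (h : DirectSum.IsInternal part) : Module.End F V :=
  LinearMap.ofIsCompl (isCompl_of_isInternal h) (part 0).subtype (-(part 1).subtype)

theorem parityInv_of_mem {part : ZMod 2 → Submodule F V} (h : DirectSum.IsInternal part)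
    {j : ZMod 2} {v : V} (hv : v ∈ part j) : parityInv h v = (-1 : F) ^ j.val • v := by
  obtain rfl | rfl := eq_zero_or_one j
  · simpa [parityInv] using
      LinearMap.ofIsCompl_apply_left (isCompl_of_isInternal h) (φ := (part 0).subtype)
        (ψ := -(part 1).subtype) ⟨v, hv⟩
  · simpa [parityInv, ZMod.val_one] using
      LinearMap.ofIsCompl_apply_right (isCompl_of_isInternal h) (φ := (part 0).subtype)
        (ψ := -(part 1).subtype) ⟨v, hv⟩

theorem end_ext_of_isInternal {part : ZMod 2 → Submodule F V} (h : DirectSum.IsInternal part)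
    {f g : V →ₗ[F] W} (hfg : ∀ j, ∀ v ∈ part j, f v = g v) : f = g := by
  ext v
  obtain ⟨a, ha, b, hb, rfl⟩ := exists_components h v
  simp [hfg _ a ha, hfg _ b hb]

theorem parityInv_mul_self {part : ZMod 2 → Submodule F V} (h : DirectSum.IsInternal part) :
    parityInv h * parityInv h = 1 := by
  refine end_ext_of_isInternal h fun j v hv => ?_
  rw [Module.End.mul_apply, parityInv_of_mem h hv, map_smul, parityInv_of_mem h hv, smul_smul,
    ← pow_add, ← two_mul, pow_mul]
  simp

theorem mem_part_of_parityInv (h2 : (2 : F) ≠ 0) {part : ZMod 2 → Submodule F V}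
    (h : DirectSum.IsInternal part)
    {j : ZMod 2} {v : V} (hv : parityInv h v = (-1 : F) ^ j.val • v) : v ∈ part j := by
  obtain ⟨a, ha, b, hb, rfl⟩ := exists_components h v
  rw [map_add, parityInv_of_mem h ha, parityInv_of_mem h hb] at hv
  obtain rfl | rfl := eq_zero_or_one j
  · have : (2 : F) • b = 0 := by
      rw [two_smul]; nth_rewrite 1 [← (by simpa [ZMod.val_one] using hv : -b = b)]; simp
    rw [(smul_eq_zero.1 this).resolve_left h2]; simpa using ha
  · have : (2 : F) • a = 0 := by
      rw [two_smul]; nth_rewrite 1 [(by simpa [ZMod.val_one] using hv : a = -a)]; simp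
    rw [(smul_eq_zero.1 this).resolve_left h2]; simpa using hb

theorem parityInv_comm {part : ZMod 2 → Submodule F V} (h : DirectSum.IsInternal part)
    {j : ZMod 2} {T : Module.End F V} (hT : ∀ k, ∀ v ∈ part k, T v ∈ part (j + k)) :
    parityInv h * T = (-1 : F) ^ j.val • (T * parityInv h) := by
  refine end_ext_of_isInternal h fun k v hv => ?_
  have e := neg_one_pow_val_add (F := F) 1 j k
  simp only [ZMod.val_one, one_mul] at e
  simp [parityInv_of_mem h hv, parityInv_of_mem h (hT k v hv), e, mul_smul]

end Super

/-! ### Schur's lemma -/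

namespace SuperModule

variable {F A V W U : Type*} [Field F] [Ring A] [Algebra F A] {gr : ZMod 2 → Submodule F A}
  [AddCommGroup V] [Module F V] [AddCommGroup W] [Module F W] [AddCommGroup U] [Module F U]
  {M : SuperModule gr V} {N : SuperModule gr W} {R : SuperModule gr U}

/-- The sign in the definition of a homomorphism can be moved into the algebra element, component by
component. Kernels of odd homomorphisms are therefore stable under the action. -/
theorem exists_even_odd (hgr : ∀ a : A, ∃ b ∈ gr 0, ∃ c ∈ gr 1, a = b + c) {j : ZMod 2}
    {f : V →ₗ[F] W} (hf : f ∈ homOfParity M N j) (a : A) :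
    ∃ b : A, (∀ v, f (M.act a v) = N.act b (f v)) := by
  obtain ⟨b, hb, c, hc, rfl⟩ := hgr a
  refine ⟨((-1 : F) ^ (j.val * (0 : ZMod 2).val)) • b +
    ((-1 : F) ^ (j.val * (1 : ZMod 2).val)) • c, fun v => ?_⟩
  simp [hf.2 _ b hb, hf.2 _ c hc]

theorem comp_mem {i j : ZMod 2} {f : W →ₗ[F] U} {g : V →ₗ[F] W}
    (hf : f ∈ homOfParity N R i) (hg : g ∈ homOfParity M N j) :
    f ∘ₗ g ∈ homOfParity M R (j + i) := by
  refine ⟨fun k v hv => ?_, fun l a ha v => ?_⟩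
  · rw [← add_assoc]; exact hf.1 _ _ (hg.1 k v hv)
  · have e := neg_one_pow_val_add (F := F) l j i
    simp only [mul_comm l.val] at e
    simp [hg.2 l a ha, hf.2 l a ha, smul_smul, e]

theorem injective_of_irreducible (hgr : ∀ a : A, ∃ b ∈ gr 0, ∃ c ∈ gr 1, a = b + c)
    (hM : M.Irreducible) {j : ZMod 2} {f : V →ₗ[F] W} (hf : f ∈ homOfParity M N j) (h0 : f ≠ 0) :
    Function.Injective f := by
  rw [← LinearMap.ker_eq_bot]
  refine (hM.2 (LinearMap.ker f) (fun a v hv => ?_) fun v hv => ?_).resolve_right fun h => h0 ?_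
  · obtain ⟨b, hb⟩ := exists_even_odd hgr hf a
    simp_all
  · obtain ⟨a, ha, b, hb, rfl⟩ := exists_components M.isInternal v
    have := components_eq_zero N.isInternal (j := j) (by simpa using hf.1 0 a ha)
      (hf.1 1 b hb) (by simpa using hv)
    exact ⟨a, ⟨this.1, ha⟩, b, ⟨this.2, hb⟩, rfl⟩
  · exact LinearMap.ker_eq_top.1 h

theorem surjective_of_irreducible (hgr : ∀ a : A, ∃ b ∈ gr 0, ∃ c ∈ gr 1, a = b + c)
    (hN : N.Irreducible) {j : ZMod 2} {f : V →ₗ[F] W} (hf : f ∈ homOfParity M N j) (h0 : f ≠ 0) :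
    Function.Surjective f := by
  rw [← LinearMap.range_eq_top]
  refine (hN.2 (LinearMap.range f) (fun a v hv => ?_) fun v hv => ?_).resolve_left fun h => h0 ?_
  · obtain ⟨w, rfl⟩ := hv
    obtain ⟨b, hb, c, hc, rfl⟩ := hgr a
    have h1 : ∀ l, ∀ b ∈ gr l, N.act b (f w) ∈ LinearMap.range f := fun l b hb =>
      ⟨((-1 : F) ^ (j.val * l.val)) • M.act b w, by
        rw [map_smul, hf.2 l b hb, smul_smul, ← pow_add, ← two_mul, pow_mul]; simp⟩
    simpa using (LinearMap.range f).add_mem (h1 _ b hb) (h1 _ c hc)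
  · obtain ⟨w, rfl⟩ := hv
    obtain ⟨a, ha, b, hb, rfl⟩ := exists_components M.isInternal w
    have ha' := hf.1 0 a ha
    have hb' := hf.1 1 b hb
    obtain rfl | rfl := eq_zero_or_one j
    · exact ⟨f a, ⟨⟨a, rfl⟩, ha'⟩, f b, ⟨⟨b, rfl⟩, hb'⟩, by simp⟩
    · exact ⟨f b, ⟨⟨b, rfl⟩, hb'⟩, f a, ⟨⟨a, rfl⟩, ha'⟩, by simp [add_comm]⟩
  · exact LinearMap.range_eq_bot.1 h

theorem inverse_mem {j : ZMod 2} {f : V →ₗ[F] W} (hf : f ∈ homOfParity M N j)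
    (hb : Function.Bijective f) {g : W →ₗ[F] V} (hg : f ∘ₗ g = LinearMap.id) :
    g ∈ homOfParity N M j := by
  have hfg : ∀ w, f (g w) = w := fun w => LinearMap.congr_fun hg w
  have hgf : ∀ v, g (f v) = v := fun v => hb.1 (hfg _)
  refine ⟨fun k w hw => ?_, fun l a ha w => ?_⟩
  · have key : ∀ k, ∀ v, f v ∈ N.part k → v ∈ M.part (k + j) := by
      intro k v hv
      obtain ⟨a, ha, b, hb', rfl⟩ := exists_components M.isInternal v
      have ha' := hf.1 0 a ha
      have hb'' := hf.1 1 b hb'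
      by_cases hk : k = 0 + j
      · have h1 : f b + (f a - f (a + b)) = 0 := by simp
        have h2 := (components_eq_zero N.isInternal (j := 1 + j) hb''
          (by rw [(by decide : ∀ j : ZMod 2, 1 + (1 + j) = 0 + j) j]
              exact (N.part _).sub_mem ha' (hk ▸ hv)) h1).1
        have : b = 0 := hb.1 (by simpa using h2)
        subst this
        rw [hk, (by decide : ∀ j : ZMod 2, 0 + j + j = 0) j]; simpa using ha
      · have hk : k = 1 + j := (by decide : ∀ j k : ZMod 2, ¬k = 0 + j → k = 1 + j) j k hk
        have h1 : f a + (f b - f (a + b)) = 0 := by simp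
        have h2 := (components_eq_zero N.isInternal (j := 0 + j) ha'
          (by rw [(by decide : ∀ j : ZMod 2, 1 + (0 + j) = 1 + j) j]
              exact (N.part _).sub_mem hb'' (hk ▸ hv)) h1).1
        have : a = 0 := hb.1 (by simpa using h2)
        subst this
        rw [hk, (by decide : ∀ j : ZMod 2, 1 + j + j = 1) j]; simpa using hb'
    exact key k _ (by rwa [hfg])
  · apply hb.1
    rw [hfg, map_smul, hf.2 l a ha, smul_smul, ← pow_add, ← two_mul, pow_mul, hfg]
    simp

theorem id_mem : LinearMap.id ∈ homOfParity M M 0 :=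
  ⟨fun k v hv => by simpa using hv, fun l a _ v => by simp⟩

/-- Schur's lemma: subtracting an eigenvalue leaves an even homomorphism that is not injective,
hence zero. -/
theorem even_end_eq_smul [IsAlgClosed F] [FiniteDimensional F V]
    (hgr : ∀ a : A, ∃ b ∈ gr 0, ∃ c ∈ gr 1, a = b + c)
    (hM : M.Irreducible) {f : V →ₗ[F] V} (hf : f ∈ homOfParity M M 0) :
    ∃ r : F, f = r • LinearMap.id := by
  have := hM.1
  obtain ⟨r, hr⟩ := Module.End.exists_eigenvalue f
  obtain ⟨v, hv⟩ := hr.exists_hasEigenvector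
  refine ⟨r, ?_⟩
  by_contra h
  have h1 := injective_of_irreducible hgr hM
    ((homOfParity M M 0).sub_mem hf ((homOfParity M M 0).smul_mem r id_mem)) (sub_ne_zero.2 h)
  exact hv.2 (h1 (by simp [Module.End.mem_eigenspace_iff.1 hv.1]))

theorem disjoint_homOfParity (M : SuperModule gr V) (N : SuperModule gr W) :
    Disjoint (homOfParity M N 0) (homOfParity M N 1) := by
  rw [Submodule.disjoint_def]
  intro f h0 h1
  refine end_ext_of_isInternal M.isInternal fun k v hv => ?_
  have a := h0.1 k v hv
  have b := h1.1 k v hv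
  refine (components_eq_zero N.isInternal (j := k) (b := - f v) (by simpa using a) ?_
    (by simp)).1
  rw [add_comm]; exact (N.part _).neg_mem b

theorem finrank_hom [FiniteDimensional F V] [FiniteDimensional F W] (M : SuperModule gr V)
    (N : SuperModule gr W) : Module.finrank F (hom M N) =
      Module.finrank F (homOfParity M N 0) + Module.finrank F (homOfParity M N 1) := by
  have := Submodule.finrank_sup_add_finrank_inf_eq (homOfParity M N 0) (homOfParity M N 1)
  rw [(disjoint_homOfParity M N).eq_bot, finrank_bot, add_zero] at this
  exact this

theorem finrank_even_end [IsAlgClosed F] [FiniteDimensional F V]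
    (hgr : ∀ a : A, ∃ b ∈ gr 0, ∃ c ∈ gr 1, a = b + c) (hM : M.Irreducible) :
    Module.finrank F (homOfParity M M 0) = 1 := by
  have := hM.1
  refine finrank_eq_one_iff'.2 ⟨⟨LinearMap.id, id_mem⟩, ?_, ?_⟩
  · intro h
    obtain ⟨v, hv⟩ := exists_ne (0 : V)
    exact hv (LinearMap.congr_fun (congrArg Subtype.val h) v)
  · rintro ⟨f, hf⟩
    obtain ⟨r, rfl⟩ := even_end_eq_smul hgr hM hf
    exact ⟨r, rfl⟩

/-- A nonzero odd endomorphism `f` is bijective with odd inverse, and for odd `g` the composite `f⁻¹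
g` is even, hence a scalar. -/
theorem finrank_odd_end [IsAlgClosed F] [FiniteDimensional F V]
    (hgr : ∀ a : A, ∃ b ∈ gr 0, ∃ c ∈ gr 1, a = b + c) (hM : M.Irreducible)
    (h : homOfParity M M 1 ≠ ⊥) : Module.finrank F (homOfParity M M 1) = 1 := by
  obtain ⟨f, hf, h0⟩ := Submodule.exists_mem_ne_zero_of_ne_bot h
  have hb : Function.Bijective f :=
    ⟨injective_of_irreducible hgr hM hf h0, surjective_of_irreducible hgr hM hf h0⟩
  refine finrank_eq_one_iff'.2 ⟨⟨f, hf⟩, fun h => h0 (congrArg Subtype.val h), ?_⟩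
  rintro ⟨g, hg⟩
  let e := LinearEquiv.ofBijective f hb
  have he : f ∘ₗ (e.symm : V →ₗ[F] V) = LinearMap.id := by
    ext v; exact e.apply_symm_apply v
  have h1 := comp_mem (inverse_mem hf hb he) hg
  obtain ⟨r, hr⟩ := even_end_eq_smul hgr hM (show _ ∈ homOfParity M M 0 from h1)
  refine ⟨r, Subtype.ext ?_⟩
  ext v
  have := congrArg f (LinearMap.congr_fun hr v)
  have h2 : f (e.symm (g v)) = g v := e.apply_symm_apply _
  simpa [h2] using this.symm

theorem finrank_hom_self [IsAlgClosed F] [FiniteDimensional F V]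
    (hgr : ∀ a : A, ∃ b ∈ gr 0, ∃ c ∈ gr 1, a = b + c) (hM : M.Irreducible) :
    (homOfParity M M 1 = ⊥ ∧ Module.finrank F (hom M M) = 1) ∨
    (homOfParity M M 1 ≠ ⊥ ∧ Module.finrank F (hom M M) = 2) := by
  rw [finrank_hom, finrank_even_end hgr hM]
  by_cases h : homOfParity M M 1 = ⊥
  · left; simp [h]
  · right; simp [h, finrank_odd_end hgr hM h]

end SuperModule

theorem exists_even_add_odd {F A G : Type*} [Field F] [Ring A] [Algebra F A] {gen : G → A}
    {par : G → ZMod 2} {gr : ZMod 2 → Submodule F A}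
    (hgr : ∀ j, gr j = wordGr F gen par j) (hgen : Algebra.adjoin F (Set.range gen) = ⊤) (a : A) :
    ∃ b ∈ gr 0, ∃ c ∈ gr 1, a = b + c := by
  suffices a ∈ gr 0 ⊔ gr 1 by
    obtain ⟨b, hb, c, hc, h⟩ := Submodule.mem_sup.1 this
    exact ⟨b, hb, c, hc, h.symm⟩
  have ha : a ∈ Subalgebra.toSubmodule (Algebra.adjoin F (Set.range gen)) := by
    rw [hgen]; trivial
  rw [Algebra.adjoin_eq_span] at ha
  refine Submodule.span_le.2 ?_ ha
  intro w hw
  obtain ⟨l, rfl⟩ : ∃ l : List G, w = (l.map gen).prod := by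
    induction hw using Submonoid.closure_induction with
    | mem x hx => obtain ⟨g, rfl⟩ := hx; exact ⟨[g], by simp⟩
    | one => exact ⟨[], by simp⟩
    | mul x y _ _ hx hy =>
      obtain ⟨l, rfl⟩ := hx
      obtain ⟨m, rfl⟩ := hy
      exact ⟨l ++ m, by simp⟩
  have hm : (l.map gen).prod ∈ gr (l.map par).sum := by
    rw [hgr]; exact Submodule.subset_span ⟨l, rfl, rfl⟩
  have : (l.map par).sum = 0 ∨ (l.map par).sum = 1 := by
    generalize (l.map par).sum = t; revert t; decide
  rcases this with h | h <;> rw [h] at hm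
  · exact Submodule.mem_sup_left hm
  · exact Submodule.mem_sup_right hm

/-! ## Commuting involutions -/

/-- Each `K t` preserves the fixed space of the involutions already treated and splits it into
eigenspaces for `1` and `-1`. The map `T t` embeds each of these into the other, so they have equal
dimension. -/
theorem finrank_eq_two_pow_mul_finrank_fixed {F W ι : Type*} [Field F] [AddCommGroup W]
    [Module F W] [FiniteDimensional F W] (h2 : (2 : F) ≠ 0) {K T : ι → Module.End F W}
    (hK : ∀ t, K t * K t = 1) (hKK : ∀ t u, K t * K u = K u * K t)
    (hT : ∀ t, Function.Injective (T t)) (hTK : ∀ t, T t * K t = -(K t * T t))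
    (hTK' : ∀ t u, t ≠ u → T t * K u = K u * T t) (s : Finset ι) :
    Module.finrank F W =
      2 ^ s.card * Module.finrank F (⨅ t ∈ s, LinearMap.ker (K t - 1) : Submodule F W) := by
  classical
  induction s using Finset.induction_on with
  | empty => rw [show (⨅ t ∈ (∅ : Finset ι), LinearMap.ker (K t - 1) : Submodule F W) = ⊤ by simp]; simp
  | insert t s hts ih =>
    rw [ih, Finset.card_insert_of_notMem hts, pow_succ, mul_assoc]
    congr 1
    set U : Submodule F W := ⨅ t ∈ s, LinearMap.ker (K t - 1) with hU
    have hmem : ∀ w, w ∈ U ↔ ∀ u ∈ s, K u w = w := by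
      intro w; simp [hU, Submodule.mem_iInf, sub_eq_zero]
    have hUK : ∀ w ∈ U, K t w ∈ U := by
      intro w hw
      rw [hmem] at hw ⊢
      intro u hu
      rw [← Module.End.mul_apply, hKK, Module.End.mul_apply, hw u hu]
    have hUT : ∀ w ∈ U, T t w ∈ U := by
      intro w hw
      rw [hmem] at hw ⊢
      intro u hu
      rw [← Module.End.mul_apply, ← hTK' t u (by rintro rfl; exact hts hu),
        Module.End.mul_apply, hw u hu]
    have hKt : ∀ w, K t (K t w) = w := fun w => by
      rw [← Module.End.mul_apply, hK, Module.End.one_apply]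
    have hTt : ∀ w, T t (K t w) = -K t (T t w) := fun w => by
      rw [← Module.End.mul_apply, hTK, LinearMap.neg_apply, Module.End.mul_apply]
    set U₁ : Submodule F W := LinearMap.ker (K t - 1) ⊓ U with hU₁
    set U₂ : Submodule F W := LinearMap.ker (K t + 1) ⊓ U with hU₂
    have m₁ : ∀ w, w ∈ U₁ ↔ K t w = w ∧ w ∈ U := by
      intro w; simp [hU₁, sub_eq_zero]
    have m₂ : ∀ w, w ∈ U₂ ↔ K t w = -w ∧ w ∈ U := by
      intro w; simp [hU₂, eq_neg_iff_add_eq_zero]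
    have hins : (⨅ u ∈ insert t s, LinearMap.ker (K u - 1) : Submodule F W) = U₁ := by
      rw [Finset.iInf_insert]
    rw [hins]
    have hinf : U₁ ⊓ U₂ = ⊥ := by
      rw [Submodule.eq_bot_iff]
      rintro w ⟨h1, h2'⟩
      have h3 := ((m₁ w).1 h1).1.symm.trans ((m₂ w).1 h2').1
      have : (2 : F) • w = 0 := by rw [two_smul]; nth_rewrite 1 [h3]; simp
      exact (smul_eq_zero.1 this).resolve_left h2
    have hsup : U₁ ⊔ U₂ = U := by
      refine le_antisymm (sup_le inf_le_right inf_le_right) fun w hw => ?_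
      refine Submodule.mem_sup.2 ⟨(2 : F)⁻¹ • (w + K t w), ?_, (2 : F)⁻¹ • (w - K t w), ?_, ?_⟩
      · rw [m₁]
        exact ⟨by simp [hKt, add_comm], U.smul_mem _ (U.add_mem hw (hUK w hw))⟩
      · rw [m₂]
        refine ⟨by simp [hKt, ← smul_neg], U.smul_mem _ (U.sub_mem hw (hUK w hw))⟩
      · rw [← smul_add, add_add_sub_cancel, ← two_smul F w, smul_smul, inv_mul_cancel₀ h2,
          one_smul]
    have hle : ∀ A B : Submodule F W, (∀ w ∈ A, T t w ∈ B) →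
        Module.finrank F A ≤ Module.finrank F B := by
      intro A B h
      rw [(Submodule.equivMapOfInjective (T t) (hT t) A).finrank_eq]
      exact Submodule.finrank_mono (Submodule.map_le_iff_le_comap.2 h)
    have e1 := hle U₁ U₂ fun w hw => by
      rw [m₁] at hw; rw [m₂]
      exact ⟨by rw [← neg_eq_iff_eq_neg, ← hTt, hw.1], hUT w hw.2⟩
    have e2 := hle U₂ U₁ fun w hw => by
      rw [m₂] at hw; rw [m₁]
      exact ⟨by rw [← neg_inj, ← hTt, hw.1, map_neg], hUT w hw.2⟩
    have := Submodule.finrank_sup_add_finrank_inf_eq U₁ U₂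
    rw [hinf, hsup, finrank_bot] at this
    omega

/-! ## Graded modules of a given weight over the polynomial and Clifford generators -/

section Clifford

variable {F : Type*} [Field F] {n : ℕ} {V W : Type*} [AddCommGroup V] [Module F V]
  [AddCommGroup W] [Module F W]

/-- The operators `X`, `C` make `V` a graded module over the subalgebra generated by the `x_k` and
`c_k`, on which `x_k ^ 2` acts by `q (i k)`. -/
structure IsClifford (i : Fin n → ℕ) (X C : Fin n → Module.End F V)
    (part : ZMod 2 → Submodule F V) : Prop where
  internal : DirectSum.IsInternal part
  X_mem : ∀ a k, ∀ v ∈ part k, X a v ∈ part (0 + k)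
  C_mem : ∀ a k, ∀ v ∈ part k, C a v ∈ part (1 + k)
  X_sq : ∀ a, X a * X a = q F (i a) • (1 : Module.End F V)
  X_zero : ∀ a, i a = 0 → X a = 0
  X_comm : ∀ a b, X a * X b = X b * X a
  C_sq : ∀ a, C a * C a = 1
  C_anti : ∀ a b, a ≠ b → C a * C b = -(C b * C a)
  XC : ∀ a, X a * C a = -(C a * X a)
  XC_far : ∀ a b, a ≠ b → X a * C b = C b * X a

/-- Parities of the generators of the subalgebra generated by the `x_k` and `c_k`. -/
def xcPar : Fin n ⊕ Fin n → ZMod 2 := Sum.elim (fun _ => 0) (fun _ => 1)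

/-- Grading of the free algebra on the `x_k` and `c_k`. -/
def xcGr (F : Type*) [Field F] (n : ℕ) (j : ZMod 2) :
    Submodule F (FreeAlgebra F (Fin n ⊕ Fin n)) :=
  wordGr F (FreeAlgebra.ι F) xcPar j

theorem xc_even_odd (a : FreeAlgebra F (Fin n ⊕ Fin n)) :
    ∃ b ∈ xcGr F n 0, ∃ c ∈ xcGr F n 1, a = b + c :=
  exists_even_add_odd (gen := FreeAlgebra.ι F) (fun _ => rfl) (FreeAlgebra.adjoin_range_ι F _) a

namespace IsClifford

variable {i : Fin n → ℕ} {X C : Fin n → Module.End F V} {part : ZMod 2 → Submodule F V}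
  {X' C' : Fin n → Module.End F W} {part' : ZMod 2 → Submodule F W}

/-- The supermodule given by the operators `X` and `C`. -/
def toSuper (h : IsClifford i X C part) : SuperModule (xcGr F n) V :=
  SuperModule.ofGen (gen := FreeAlgebra.ι F) (par := xcPar) (fun _ => rfl)
    (FreeAlgebra.lift F (Sum.elim X C)) part h.internal (by
      rintro (a | a) k v hv
      · simpa [xcPar] using h.X_mem a k v hv
      · simpa [xcPar] using h.C_mem a k v hv)

theorem toSuper_act_ι (h : IsClifford i X C part) (g) :
    h.toSuper.act (FreeAlgebra.ι F g) = Sum.elim X C g := by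
  simp [toSuper, SuperModule.ofGen]

theorem mem_homOfParity_iff (h : IsClifford i X C part) (h' : IsClifford i X' C' part')
    {j : ZMod 2} {f : V →ₗ[F] W} : f ∈ SuperModule.homOfParity h.toSuper h'.toSuper j ↔
      (∀ k, ∀ v ∈ part k, f v ∈ part' (k + j)) ∧ (∀ a v, f (X a v) = X' a (f v)) ∧
      (∀ a v, f (C a v) = (-1 : F) ^ j.val • C' a (f v)) := by
  constructor
  · intro hf
    refine ⟨hf.1, fun a v => ?_, fun a v => ?_⟩
    · have := hf.2 _ _ (gen_mem_gr (par := xcPar) (gr := xcGr F n) (fun _ => rfl) (Sum.inl a)) v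
      simpa [toSuper_act_ι, xcPar] using this
    · have := hf.2 _ _ (gen_mem_gr (par := xcPar) (gr := xcGr F n) (fun _ => rfl) (Sum.inr a)) v
      simpa [toSuper_act_ι, xcPar, ZMod.val_one] using this
  · rintro ⟨h1, h2, h3⟩
    refine mem_homOfParity_of_gen (gen := FreeAlgebra.ι F) (par := xcPar) (fun _ => rfl) h1 ?_
    rintro (a | a) v
    · simpa [toSuper_act_ι, xcPar] using h2 a v
    · simpa [toSuper_act_ι, xcPar, ZMod.val_one] using h3 a v

/-- The map `f ↦ T f S`. -/
def sandwich (T : Module.End F W) (S : Module.End F V) : Module.End F (V →ₗ[F] W) where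
  toFun f := T ∘ₗ f ∘ₗ S
  map_add' f g := by ext; simp
  map_smul' r f := by ext; simp

theorem sandwich_apply (T : Module.End F W) (S : Module.End F V) (f : V →ₗ[F] W) (v : V) :
    sandwich T S f v = T (f (S v)) := rfl

theorem sandwich_mul (T T' : Module.End F W) (S S' : Module.End F V) :
    sandwich T S * sandwich T' S' = sandwich (T * T') (S' * S) := rfl

theorem sandwich_neg_left (T : Module.End F W) (S : Module.End F V) :
    sandwich (-T) S = -sandwich T S := rfl

theorem sandwich_neg_right (T : Module.End F W) (S : Module.End F V) :
    sandwich T (-S) = -sandwich T S := by ext; simp [sandwich_apply]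

theorem sandwich_smul_left (r : F) (T : Module.End F W) (S : Module.End F V) :
    sandwich (r • T) S = r • sandwich T S := rfl

theorem sandwich_smul_right (r : F) (T : Module.End F W) (S : Module.End F V) :
    sandwich T (r • S) = r • sandwich T S := by ext; simp [sandwich_apply]

theorem sandwich_one_one : sandwich (1 : Module.End F W) (1 : Module.End F V) = 1 := rfl

/-- The product of `c_a` and the parity involution. -/
def E (h : IsClifford i X C part) (a : Fin n) : Module.End F V := C a * parityInv h.internal

theorem parityInv_mul_X (h : IsClifford i X C part) (a) :
    parityInv h.internal * X a = X a * parityInv h.internal := by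
  simpa using parityInv_comm h.internal (h.X_mem a)

theorem parityInv_mul_C (h : IsClifford i X C part) (a) :
    parityInv h.internal * C a = -(C a * parityInv h.internal) := by
  simpa [ZMod.val_one] using parityInv_comm h.internal (h.C_mem a)

theorem E_X (h : IsClifford i X C part) (a) : E h a * X a = -(X a * E h a) := by
  rw [E, mul_assoc, h.parityInv_mul_X, ← mul_assoc, ← mul_assoc, h.XC, neg_mul, neg_neg]

theorem E_X_far (h : IsClifford i X C part) {a b} (hab : a ≠ b) : E h a * X b = X b * E h a := by
  rw [E, mul_assoc, h.parityInv_mul_X, ← mul_assoc, ← mul_assoc, h.XC_far _ _ hab.symm]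

theorem E_C (h : IsClifford i X C part) (a) : E h a * C a = -(C a * E h a) := by
  rw [E, mul_assoc, h.parityInv_mul_C, mul_neg]

theorem E_C_far (h : IsClifford i X C part) {a b} (hab : a ≠ b) : E h a * C b = C b * E h a := by
  rw [E, mul_assoc, h.parityInv_mul_C, mul_neg, ← mul_assoc, ← mul_assoc, h.C_anti _ _ hab, neg_mul,
    neg_neg]

theorem E_E (h : IsClifford i X C part) (a b) :
    E h a * E h b = -(C a * C b) := by
  have := parityInv_mul_self h.internal
  simp only [E]
  rw [mul_assoc, ← mul_assoc (parityInv _) (C b), h.parityInv_mul_C, neg_mul, mul_assoc, this,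
    mul_one, mul_neg]

theorem E_anti (h : IsClifford i X C part) {a b} (hab : a ≠ b) :
    E h a * E h b = -(E h b * E h a) := by
  rw [E_E, E_E, h.C_anti _ _ hab]

/-- The commuting involutions on homs whose common fixed points are the homomorphisms. -/
def homInv (h : IsClifford i X C part) (h' : IsClifford i X' C' part') :
    Fin n ⊕ {a // i a ≠ 0} → Module.End F (V →ₗ[F] W)
  -- For even `f` the maps `f ↦ c_a f c_a` and `f ↦ σ f σ` (`σ` the parity involution) fix `f`, and
  -- for odd `f` both negate it. With `c_a σ` in place of `c_a` both parities are fixed at once, up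
  -- to the sign from `σ c_a = -c_a σ`.
  | .inl a => (-1 : F) • sandwich (h'.E a) (h.E a)
  | .inr a => (q F (i a))⁻¹ • sandwich (X' a) (X a)

/-- Maps anticommuting with one of the involutions `homInv` and commuting with the others. -/
def homFlip (V : Type*) [AddCommGroup V] [Module F V] (i : Fin n → ℕ)
    (X' C' : Fin n → Module.End F W) :
    Fin n ⊕ {a // i a ≠ 0} → Module.End F (V →ₗ[F] W)
  -- Left multiplication must anticommute with `c_a σ` only. If `i a ≠ 0` it must also commute with
  -- the involution of `x_a`, which excludes `c_a`; if `i a = 0` then `x_a` is zero, and `c_a`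
  -- serves.
  | .inl a => sandwich (if i a = 0 then C' a else X' a) 1
  -- The product `c_a x_a` anticommutes with `x_a`, while the two signs from passing `c_a σ` cancel.
  | .inr a => sandwich (C' a * X' a) 1

variable (hq : ∀ a, i a ≠ 0 → q F (i a) ≠ 0)

include hq in
theorem homInv_mul_self (h : IsClifford i X C part) (h' : IsClifford i X' C' part') (t) :
    homInv h h' t * homInv h h' t = 1 := by
  rcases t with a | ⟨a, ha⟩
  · simp [homInv, sandwich_mul, E_E, h.C_sq, h'.C_sq, sandwich_neg_left, sandwich_neg_right,
      sandwich_one_one]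
  · simp [homInv, sandwich_mul, h.X_sq, h'.X_sq, smul_smul, sandwich_smul_left,
      sandwich_smul_right, sandwich_one_one, hq a ha]

theorem homInv_comm (h : IsClifford i X C part) (h' : IsClifford i X' C' part') (t u) :
    homInv h h' t * homInv h h' u = homInv h h' u * homInv h h' t := by
  rcases t with a | ⟨a, ha⟩ <;> rcases u with b | ⟨b, hb⟩
  · obtain rfl | hab := eq_or_ne a b
    · rfl
    · simp only [homInv, sandwich_mul, mul_smul_comm, smul_mul_assoc]
      rw [h'.E_anti hab, h.E_anti hab.symm, sandwich_neg_left, sandwich_neg_right, neg_neg]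
  · simp only [homInv, sandwich_mul, mul_smul_comm, smul_mul_assoc]
    obtain rfl | hab := eq_or_ne a b
    · rw [h'.E_X, ← neg_eq_iff_eq_neg.2 (h.E_X a), sandwich_neg_left, sandwich_neg_right, neg_neg,
        smul_comm]
    · rw [h'.E_X_far hab, h.E_X_far hab, smul_comm]
  · simp only [homInv, sandwich_mul, mul_smul_comm, smul_mul_assoc]
    obtain rfl | hab := eq_or_ne b a
    · rw [h'.E_X, ← neg_eq_iff_eq_neg.2 (h.E_X b), sandwich_neg_left, sandwich_neg_right, neg_neg,
        smul_comm]
    · rw [h'.E_X_far hab, h.E_X_far hab, smul_comm]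
  · simp only [homInv, sandwich_mul, mul_smul_comm, smul_mul_assoc]
    rw [h'.X_comm a b, h.X_comm a b, smul_comm]

theorem injective_of_mul_self {T : Module.End F V} {r : F} (hr : r ≠ 0) (hT : T * T = r • 1) :
    Function.Injective T := by
  intro v w hvw
  have : r • v = r • w := by
    have := congrArg T hvw
    rwa [← Module.End.mul_apply, ← Module.End.mul_apply, hT] at this
  exact smul_right_injective V hr this

include hq in
theorem homFlip_injective (h' : IsClifford i X' C' part') (t) :
    Function.Injective (homFlip V i X' C' t) := by
  rcases t with a | ⟨a, ha⟩
  · by_cases ha : i a = 0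
    · refine injective_of_mul_self one_ne_zero ?_
      simp [homFlip, ha, sandwich_mul, h'.C_sq, sandwich_one_one]
    · refine injective_of_mul_self (hq a ha) ?_
      simp [homFlip, ha, sandwich_mul, h'.X_sq, sandwich_one_one, sandwich_smul_left]
  · refine injective_of_mul_self (neg_ne_zero.2 (hq a ha)) ?_
    have : C' a * X' a * (C' a * X' a) = (-q F (i a)) • (1 : Module.End F W) := by
      rw [neg_smul, mul_assoc, ← mul_assoc (X' a), h'.XC, neg_mul, mul_neg, mul_assoc, h'.X_sq, mul_smul_comm,
        mul_one, mul_smul_comm, h'.C_sq]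
    simp only [homFlip, sandwich_mul, this, sandwich_one_one, sandwich_smul_left, mul_one]

theorem homFlip_mul_homInv (h : IsClifford i X C part) (h' : IsClifford i X' C' part') (t) :
    homFlip V i X' C' t * homInv h h' t = -(homInv h h' t * homFlip V i X' C' t) := by
  rcases t with a | ⟨a, ha⟩
  · by_cases ha : i a = 0
    · simp [homFlip, homInv, ha, sandwich_mul, h'.E_C, sandwich_neg_left]
    · simp [homFlip, homInv, ha, sandwich_mul, h'.E_X, sandwich_neg_left]
  · have : X' a * (C' a * X' a) = -(C' a * X' a * X' a) := by
      rw [← mul_assoc, h'.XC, neg_mul]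
    simp [homFlip, homInv, sandwich_mul, this, sandwich_neg_left]

theorem homFlip_mul_homInv_far (h : IsClifford i X C part) (h' : IsClifford i X' C' part')
    (t u) (htu : t ≠ u) :
    homFlip V i X' C' t * homInv h h' u = homInv h h' u * homFlip V i X' C' t := by
  have hX : ∀ a b, a ≠ b → X' a * (C' b * X' b) = C' b * X' b * X' a := fun a b hab => by
    rw [← mul_assoc, h'.XC_far _ _ hab, mul_assoc, h'.X_comm, mul_assoc]
  have hE : ∀ a b, h'.E a * (C' b * X' b) = C' b * X' b * h'.E a := fun a b => by
    obtain rfl | hab := eq_or_ne a b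
    · rw [← mul_assoc, h'.E_C, neg_mul, mul_assoc, h'.E_X, mul_neg, neg_neg, mul_assoc]
    · rw [← mul_assoc, h'.E_C_far hab, mul_assoc, h'.E_X_far hab, mul_assoc]
  rcases t with a | ⟨a, ha⟩ <;> rcases u with b | ⟨b, hb⟩
  · have hab : b ≠ a := by rintro rfl; exact htu rfl
    by_cases ha : i a = 0
    · simp [homFlip, homInv, ha, sandwich_mul, h'.E_C_far hab]
    · simp [homFlip, homInv, ha, sandwich_mul, h'.E_X_far hab]
  · by_cases ha : i a = 0
    · have hab : b ≠ a := by rintro rfl; exact hb ha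
      simp [homFlip, homInv, ha, sandwich_mul, h'.XC_far _ _ hab]
    · simp [homFlip, homInv, ha, sandwich_mul, h'.X_comm b a]
  · simp [homFlip, homInv, sandwich_mul, hE]
  · have hab : b ≠ a := by rintro rfl; exact htu rfl
    simp [homFlip, homInv, sandwich_mul, hX _ _ hab]

-- Being a homomorphism is a condition on each parity component with its own sign. The involutions
-- `homInv` encode both at once, so that the sum of the even and odd parts becomes a common fixed
-- space.
include hq in
theorem hom_eq_fixed (h2 : (2 : F) ≠ 0) (h : IsClifford i X C part)
    (h' : IsClifford i X' C' part') :
    SuperModule.hom h.toSuper h'.toSuper =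
      ⨅ t ∈ Finset.univ, LinearMap.ker (homInv h h' t - 1) := by
  have hσ : ∀ v, parityInv h.internal (parityInv h.internal v) = v := fun v => by
    rw [← Module.End.mul_apply, parityInv_mul_self, Module.End.one_apply]
  have hσ' : ∀ v, parityInv h'.internal (parityInv h'.internal v) = v := fun v => by
    rw [← Module.End.mul_apply, parityInv_mul_self, Module.End.one_apply]
  have hσX' : ∀ a v, parityInv h'.internal (X' a v) = X' a (parityInv h'.internal v) :=
    fun a v => LinearMap.congr_fun (h'.parityInv_mul_X a) v
  have hσX : ∀ a v, parityInv h.internal (X a v) = X a (parityInv h.internal v) :=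
    fun a v => LinearMap.congr_fun (h.parityInv_mul_X a) v
  have hσC : ∀ a v, parityInv h.internal (C a v) = -C a (parityInv h.internal v) :=
    fun a v => LinearMap.congr_fun (h.parityInv_mul_C a) v
  have hσC' : ∀ a v, parityInv h'.internal (C' a v) = -C' a (parityInv h'.internal v) :=
    fun a v => LinearMap.congr_fun (h'.parityInv_mul_C a) v
  have hCC : ∀ a v, C' a (C' a v) = v := fun a v => LinearMap.congr_fun (h'.C_sq a) v
  have hCC0 : ∀ a v, C a (C a v) = v := fun a v => LinearMap.congr_fun (h.C_sq a) v
  have hXX' : ∀ a v, X' a (X' a v) = q F (i a) • v := fun a v => LinearMap.congr_fun (h'.X_sq a) v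
  have hmem : ∀ f, f ∈ (⨅ t ∈ Finset.univ, LinearMap.ker (homInv h h' t - 1)) ↔
      ∀ t, homInv h h' t f = f := by
    intro f; simp [Submodule.mem_iInf, sub_eq_zero]
  apply le_antisymm
  · have key : ∀ j : ZMod 2, SuperModule.homOfParity h.toSuper h'.toSuper j ≤
        ⨅ t ∈ Finset.univ, LinearMap.ker (homInv h h' t - 1) := by
      intro j f hf
      rw [hmem]
      have h0 := hf
      rw [mem_homOfParity_iff] at h0
      obtain ⟨h3, h4, h5⟩ := h0
      have hfσ : ∀ v, parityInv h'.internal (f v) =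
          (-1 : F) ^ j.val • f (parityInv h.internal v) := by
        intro v
        have : parityInv h'.internal ∘ₗ f =
          (-1 : F) ^ j.val • (f ∘ₗ parityInv h.internal) := by
          refine end_ext_of_isInternal h.internal fun k v hv => ?_
          have e := neg_one_pow_val_add (F := F) 1 k j
          simp only [ZMod.val_one, one_mul] at e
          simp only [LinearMap.comp_apply, LinearMap.smul_apply, map_smul,
            parityInv_of_mem h.internal hv, parityInv_of_mem h'.internal (h3 k v hv), e, mul_smul]
          rw [smul_comm]
        exact LinearMap.congr_fun this v
      rintro (a | ⟨a, ha⟩)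
      · ext v
        simp only [homInv, sandwich_apply, E, Module.End.mul_apply, LinearMap.smul_apply, neg_smul,
          one_smul, LinearMap.neg_apply]
        rw [hfσ, hσC, hσ, map_neg, h5, map_smul, map_neg, map_smul, hCC, smul_neg, neg_neg,
          smul_smul, ← pow_add, ← two_mul, pow_mul]
        simp
      · ext v
        simp [homInv, sandwich_apply, h4, hXX', smul_smul, hq a ha]
    exact sup_le (key 0) (key 1)
  · intro f hf
    rw [hmem] at hf
    -- The conjugate of `f` by the parity involutions: `(f + g)/2` and `(f - g)/2` are the even and
    -- the odd part of `f`.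
    set g : V →ₗ[F] W := sandwich (parityInv h'.internal) (parityInv h.internal) f with hg
    have hgv : ∀ v, parityInv h'.internal (f (parityInv h.internal v)) = g v := fun v => rfl
    have hfv : ∀ v, parityInv h'.internal (g (parityInv h.internal v)) = f v := fun v => by
      rw [← hgv, hσ, hσ']
    have hgC : ∀ a v, g (C a v) = C' a (f v) := fun a v => by
      have h6 := LinearMap.congr_fun (hf (.inl a)) v
      simp only [homInv, sandwich_apply, E, Module.End.mul_apply, LinearMap.smul_apply, neg_smul,
          one_smul, LinearMap.neg_apply] at h6
      rw [← hgv, hσC, map_neg, map_neg, ← h6, map_neg, hCC]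
    have hfC : ∀ a v, f (C a v) = C' a (g v) := fun a v => by
      have := hgC a (parityInv h.internal v)
      rw [← hfv, hσC, map_neg, this, map_neg, hσC', neg_neg, hgv]
    have hσf : ∀ v, parityInv h'.internal (f v) = g (parityInv h.internal v) := fun v => by
      rw [← hgv, hσ]
    have hσg : ∀ v, parityInv h'.internal (g v) = f (parityInv h.internal v) := fun v => by
      rw [← hfv, hσ]
    have hfX : ∀ a v, f (X a v) = X' a (f v) := fun a v => by
      -- At residue `0` there is no involution from `x_a`. The field `X_zero` is used instead; `x_a
      -- ^ 2 = 0` alone would not give this commutation.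
      by_cases ha : i a = 0
      · simp [h.X_zero a ha, h'.X_zero a ha]
      · have := LinearMap.congr_fun (hf (.inr ⟨a, ha⟩)) v
        simp only [homInv, sandwich_apply, LinearMap.smul_apply] at this
        rw [← this, map_smul, hXX', smul_smul, inv_mul_cancel₀ (hq a ha), one_smul]
    have hgX : ∀ a v, g (X a v) = X' a (g v) := fun a v => by
      rw [← hgv, ← hgv, hσX, hfX, hσX']
    have hsum : f = (2 : F)⁻¹ • (f + g) + (2 : F)⁻¹ • (f - g) := by
      rw [← smul_add, add_add_sub_cancel, ← two_smul F f, smul_smul, inv_mul_cancel₀ h2, one_smul]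
    rw [hsum]
    refine Submodule.add_mem_sup (Submodule.smul_mem _ _ ?_) (Submodule.smul_mem _ _ ?_)
    · rw [mem_homOfParity_iff]
      refine ⟨fun k v hv => ?_, fun a v => by simp [hfX, hgX], fun a v => by
        simp [hfC, hgC, add_comm]⟩
      apply mem_part_of_parityInv h2 h'.internal
      rw [LinearMap.add_apply, map_add, hσf, hσg, parityInv_of_mem h.internal hv]
      simp [add_comm]
    · rw [mem_homOfParity_iff]
      refine ⟨fun k v hv => ?_, fun a v => by simp [hfX, hgX], fun a v => by
        simp [hfC, hgC, ZMod.val_one]⟩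
      apply mem_part_of_parityInv h2 h'.internal
      have e := neg_one_pow_val_add (F := F) 1 k 1
      simp only [ZMod.val_one, one_mul, pow_one] at e
      rw [LinearMap.sub_apply, map_sub, hσf, hσg, parityInv_of_mem h.internal hv, e]
      simp [mul_smul, smul_sub, sub_eq_add_neg, add_comm]

include hq in
/-- The dimension of the space of linear maps between two modules of the same weight. -/
theorem finrank_mul_finrank [FiniteDimensional F V] [FiniteDimensional F W] (h2 : (2 : F) ≠ 0)
    (h : IsClifford i X C part) (h' : IsClifford i X' C' part') :
    Module.finrank F V * Module.finrank F W = 2 ^ (n + Fintype.card {a // i a ≠ 0}) *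
      Module.finrank F (SuperModule.hom h.toSuper h'.toSuper) := by
  rw [hom_eq_fixed hq h2, ← Module.finrank_linearMap F F,
    finrank_eq_two_pow_mul_finrank_fixed h2 (homInv_mul_self hq h h') (homInv_comm h h')
      (homFlip_injective hq h') (homFlip_mul_homInv h h') (homFlip_mul_homInv_far h h')
      Finset.univ]
  simp

end IsClifford

end Clifford

/-! ## The modules `L(i)` -/

section Tensor

variable {F : Type*} [Field F] {n : ℕ}

theorem prod_sign_update_of_not_lt {a k : Fin n} (h : ¬ a < k) (ε : Fin n → ZMod 2) (t : ZMod 2) :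
    ∏ j ∈ Finset.univ.filter (· < k), (-1 : F) ^ (Function.update ε a t j).val =
      ∏ j ∈ Finset.univ.filter (· < k), (-1 : F) ^ (ε j).val := by
  refine Finset.prod_congr rfl fun j hj => ?_
  rw [Function.update_of_ne]
  rintro rfl
  exact h (Finset.mem_filter.1 hj).2

theorem neg_one_pow_val_succ (t : ZMod 2) : (-1 : F) ^ (t + 1).val = -(-1) ^ t.val := by
  have := neg_one_pow_val_add (F := F) 1 t 1
  simpa [ZMod.val_one] using this

theorem prod_sign_update_of_lt {a k : Fin n} (h : a < k) (ε : Fin n → ZMod 2) :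
    ∏ j ∈ Finset.univ.filter (· < k), (-1 : F) ^ (Function.update ε a (ε a + 1) j).val =
      -∏ j ∈ Finset.univ.filter (· < k), (-1 : F) ^ (ε j).val := by
  have ha : a ∈ Finset.univ.filter (· < k) := by simpa using h
  rw [← Finset.mul_prod_erase _ _ ha, ← Finset.mul_prod_erase _ (fun j => (-1 : F) ^ (ε j).val) ha,
    Function.update_self, neg_one_pow_val_succ, neg_mul]
  congr 2
  refine Finset.prod_congr rfl fun j hj => ?_
  rw [Function.update_of_ne (Finset.ne_of_mem_erase hj)]

theorem tensorC_apply (k : Fin n) (f : TensorSpace F n) (ε) : tensorC k f ε =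
    (∏ j ∈ Finset.univ.filter (· < k), (-1) ^ (ε j).val) * f (Function.update ε k (ε k + 1)) := rfl

theorem tensorC_mul_self (k : Fin n) : tensorC k * tensorC k = (1 : Module.End F _) := by
  refine LinearMap.ext fun f => ?_
  funext ε
  have h1 : ε k + 1 + 1 = ε k := by rw [add_assoc, show (1 : ZMod 2) + 1 = 0 by decide, add_zero]
  rw [Module.End.mul_apply, tensorC_apply, tensorC_apply,
    prod_sign_update_of_not_lt (lt_irrefl k), ← mul_assoc, Function.update_idem,
    Function.update_self, h1, Function.update_eq_self, ← Finset.prod_mul_distrib]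
  simp [← mul_pow]

theorem tensorC_anti_of_lt {a b : Fin n} (hab : a < b) :
    tensorC a * tensorC b = (-(tensorC b * tensorC a) : Module.End F (TensorSpace F n)) := by
  refine LinearMap.ext fun f => ?_
  funext ε
  rw [LinearMap.neg_apply, Pi.neg_apply, Module.End.mul_apply, Module.End.mul_apply,
    tensorC_apply, tensorC_apply, tensorC_apply, tensorC_apply, prod_sign_update_of_lt hab,
    prod_sign_update_of_not_lt hab.not_gt, Function.update_of_ne hab.ne,
    Function.update_of_ne hab.ne', Function.update_comm hab.ne]
  ring

theorem tensorC_anti {a b : Fin n} (hab : a ≠ b) :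
    tensorC a * tensorC b = (-(tensorC b * tensorC a) : Module.End F (TensorSpace F n)) := by
  rcases lt_or_gt_of_ne hab with h | h
  · exact tensorC_anti_of_lt h
  · rw [tensorC_anti_of_lt h, neg_neg]

theorem sum_update_succ (ε : Fin n → ZMod 2) (k : Fin n) :
    ∑ j, Function.update ε k (ε k + 1) j = 1 + ∑ j, ε j := by
  rw [Finset.sum_update_of_mem (Finset.mem_univ k), ← Finset.sum_erase_add _ _ (Finset.mem_univ k),
    Finset.sdiff_singleton_eq_erase]
  ring

theorem tensorC_mem (k : Fin n) (j : ZMod 2) (f) (hf : f ∈ tensorPart F n j) :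
    tensorC k f ∈ tensorPart F n (1 + j) := by
  intro ε hε
  rw [tensorC_apply, hf _ ?_, mul_zero]
  rw [sum_update_succ]
  rintro rfl
  exact hε (by rw [← add_assoc, show (1 : ZMod 2) + 1 = 0 by decide, zero_add])

theorem tensorPart_isInternal : DirectSum.IsInternal (tensorPart F n) := by
  classical
  refine isInternal_of_isCompl ⟨?_, ?_⟩
  · rw [Submodule.disjoint_def]
    intro f h0 h1
    funext ε
    by_cases h : ∑ k, ε k = 0
    · exact h1 ε (by rw [h]; decide)
    · exact h0 ε h
  · rw [codisjoint_iff, Submodule.eq_top_iff']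
    intro f
    refine Submodule.mem_sup.2 ⟨fun ε => if ∑ k, ε k = 0 then f ε else 0, fun ε h => if_neg h,
      fun ε => if ∑ k, ε k = 0 then 0 else f ε, fun ε h => if_pos ?_, ?_⟩
    · exact (eq_zero_or_one _).resolve_right h
    · funext ε; by_cases h : ∑ k, ε k = 0 <;> simp [h]

/-- The summand `L(i)^τ`, on the space of `L(i)`, is a module of weight `τ · i`. -/
theorem IsClifford.twist {V : Type*} [AddCommGroup V] [Module F V] {i : Fin n → ℕ}
    {X C : Fin n → Module.End F V} {part : ZMod 2 → Submodule F V} (h : IsClifford i X C part)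
    (τ : Equiv.Perm (Fin n)) :
    IsClifford (permute τ i) (fun k => X (τ⁻¹ k)) (fun k => C (τ⁻¹ k)) part where
  internal := h.internal
  X_mem _ := h.X_mem _
  C_mem _ := h.C_mem _
  X_sq _ := h.X_sq _
  X_zero _ := h.X_zero _
  X_comm _ _ := h.X_comm _ _
  C_sq _ := h.C_sq _
  C_anti _ _ hab := h.C_anti _ _ fun e => hab ((τ⁻¹).injective e)
  XC _ := h.XC _
  XC_far _ _ hab := h.XC_far _ _ fun e => hab ((τ⁻¹).injective e)

variable [IsAlgClosed F]

theorem root_mul_self (a : F) : root a * root a = a := by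
  rw [← sq]; exact (IsAlgClosed.exists_pow_nat_eq a (n := 2) two_pos).choose_spec

theorem tensorX_apply (i : Fin n → ℕ) (k : Fin n) (f : TensorSpace F n) (ε) :
    tensorX i k f ε = (-1) ^ (ε k).val * root (q F (i k)) * f ε := rfl

theorem tensor_isClifford (i : Fin n → ℕ) :
    IsClifford i (tensorX i) tensorC (tensorPart F n) where
  internal := tensorPart_isInternal
  X_mem a k v hv := by
    intro ε hε
    rw [tensorX_apply, hv ε (by simpa using hε), mul_zero]
  C_mem := tensorC_mem
  X_sq a := by
    refine LinearMap.ext fun f => ?_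
    funext ε
    have h1 : ((-1 : F) ^ (ε a).val) * (-1) ^ (ε a).val = 1 := by simp [← mul_pow]
    have h2 := root_mul_self (q F (i a))
    simp only [Module.End.mul_apply, tensorX_apply, LinearMap.smul_apply, Module.End.one_apply,
      Pi.smul_apply, smul_eq_mul]
    linear_combination (root (q F (i a)) * root (q F (i a)) * f ε) * h1 + f ε * h2
  X_zero a ha := by
    have h2 : root (q F (i a)) = 0 := by
      have := root_mul_self (q F (i a)); simpa [q, ha] using this
    refine LinearMap.ext fun f => ?_
    funext ε
    simp [tensorX_apply, h2]
  X_comm a b := by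
    refine LinearMap.ext fun f => ?_
    funext ε
    simp only [Module.End.mul_apply, tensorX_apply]
    ring
  C_sq := tensorC_mul_self
  C_anti a b hab := tensorC_anti hab
  XC a := by
    refine LinearMap.ext fun f => ?_
    funext ε
    simp only [Module.End.mul_apply, tensorX_apply, LinearMap.neg_apply, Pi.neg_apply,
      tensorC_apply, Function.update_self, neg_one_pow_val_succ]
    ring
  XC_far a b hab := by
    refine LinearMap.ext fun f => ?_
    funext ε
    simp only [Module.End.mul_apply, tensorX_apply, tensorC_apply, Function.update_of_ne hab]
    ring

/-- By finite dimension there is a minimal nonzero graded submodule of the tensor product. -/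
theorem nonempty_component (i : Fin n → ℕ) : Nonempty (Component F i) := by
  classical
  let S : Set (Submodule F (TensorSpace F n)) := {N | IsTensorSub i N ∧ N ≠ ⊥}
  have hS : S.Nonempty := by
    refine ⟨⊤, ⟨fun _ _ _ => trivial, fun _ _ _ => trivial, fun v _ => ?_⟩, ?_⟩
    · obtain ⟨a, ha, b, hb, h⟩ := exists_components (tensorPart_isInternal (F := F) (n := n)) v
      exact ⟨a, ⟨trivial, ha⟩, b, ⟨trivial, hb⟩, h⟩
    · exact top_ne_bot
  obtain ⟨N, hN, hmin⟩ := WellFounded.has_min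
    (wellFounded_lt (α := Submodule F (TensorSpace F n))) S hS
  refine ⟨⟨N, hN.1, hN.2, fun N' hle hN' => ?_⟩⟩
  by_contra! h
  exact hmin N' ⟨hN', h.1⟩ (lt_of_le_of_ne hle h.2)

namespace Component

variable {i : Fin n → ℕ} (L : Component F i)

theorem incl_injective : Function.Injective L.incl := Subtype.val_injective

instance : FiniteDimensional F L.Space := inferInstanceAs (FiniteDimensional F L.carrier)

instance : Nontrivial L.Space := Submodule.nontrivial_iff_ne_bot.2 L.ne_bot

/-- The grading of `L(i)`. -/
def part (j : ZMod 2) : Submodule F L.Space := (tensorPart F n j).comap L.incl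

theorem end_eq {f g : Module.End F L.Space} (h : ∀ v, L.incl (f v) = L.incl (g v)) : f = g := by
  ext1 v; exact L.incl_injective (h v)

theorem isClifford : IsClifford i L.X L.C L.part := by
  have T := tensor_isClifford (F := F) i
  refine ⟨?_, fun a k v hv => T.X_mem a k _ hv, fun a k v hv => T.C_mem a k _ hv,
    fun a => L.end_eq fun v => LinearMap.congr_fun (T.X_sq a) (L.incl v),
    fun a ha => L.end_eq fun v => LinearMap.congr_fun (T.X_zero a ha) (L.incl v),
    fun a b => L.end_eq fun v => LinearMap.congr_fun (T.X_comm a b) (L.incl v),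
    fun a => L.end_eq fun v => LinearMap.congr_fun (T.C_sq a) (L.incl v),
    fun a b hab => L.end_eq fun v => LinearMap.congr_fun (T.C_anti a b hab) (L.incl v),
    fun a => L.end_eq fun v => LinearMap.congr_fun (T.XC a) (L.incl v),
    fun a b hab => L.end_eq fun v => LinearMap.congr_fun (T.XC_far a b hab) (L.incl v)⟩
  refine isInternal_of_isCompl ⟨?_, ?_⟩
  · rw [Submodule.disjoint_def]
    intro v h0 h1
    apply L.incl_injective
    rw [map_zero]
    exact Submodule.disjoint_def.1 (isCompl_of_isInternal T.internal).disjoint _ h0 h1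
  · rw [codisjoint_iff, Submodule.eq_top_iff']
    intro v
    obtain ⟨a, ha, b, hb, h⟩ := L.isSub.graded v.1 v.2
    exact Submodule.mem_sup.2 ⟨⟨a, ha.1⟩, ha.2, ⟨b, hb.1⟩, hb.2, Subtype.ext h.symm⟩

theorem eq_bot_or_eq_top {N : Submodule F L.Space} (hX : ∀ a, ∀ v ∈ N, L.X a v ∈ N)
    (hC : ∀ a, ∀ v ∈ N, L.C a v ∈ N) (hgr : IsGradedSub L.part N) : N = ⊥ ∨ N = ⊤ := by
  have h := L.minimal (N.map L.incl) (by rintro _ ⟨v, -, rfl⟩; exact v.2) ⟨?_, ?_, ?_⟩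
  · refine h.imp (fun h => ?_) fun h => ?_
    · rw [Submodule.eq_bot_iff]
      intro v hv
      apply L.incl_injective
      rw [map_zero, ← Submodule.mem_bot F, ← h]
      exact ⟨v, hv, rfl⟩
    · rw [Submodule.eq_top_iff']
      intro v
      obtain ⟨w, hw, hwv⟩ : L.incl v ∈ N.map L.incl := h ▸ v.2
      rwa [L.incl_injective hwv] at hw
  · rintro a _ ⟨v, hv, rfl⟩; exact ⟨_, hX a v hv, rfl⟩
  · rintro a _ ⟨v, hv, rfl⟩; exact ⟨_, hC a v hv, rfl⟩
  · rintro _ ⟨v, hv, rfl⟩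
    obtain ⟨a, ha, b, hb, rfl⟩ := hgr v hv
    exact ⟨L.incl a, ⟨⟨a, ha.1, rfl⟩, ha.2⟩, L.incl b, ⟨⟨b, hb.1, rfl⟩, hb.2⟩, map_add _ _ _⟩

theorem irreducible : L.isClifford.toSuper.Irreducible := by
  refine ⟨inferInstance, fun N hN hgr => L.eq_bot_or_eq_top (fun a v hv => ?_) (fun a v hv => ?_)
    hgr⟩
  · simpa [IsClifford.toSuper_act_ι] using hN (FreeAlgebra.ι F (Sum.inl a)) v hv
  · simpa [IsClifford.toSuper_act_ι] using hN (FreeAlgebra.ι F (Sum.inr a)) v hv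

end Component

variable {i j : Fin n → ℕ}

/-- Any two irreducible components of the same weight are isomorphic, up to a permutation. -/
theorem exists_hom_ne_zero (h2 : (2 : F) ≠ 0) (hq : ∀ a, j a ≠ 0 → q F (j a) ≠ 0)
    (L : Component F i) (L' : Component F j) {τ : Equiv.Perm (Fin n)} (hτ : permute τ i = j) :
    ∃ (l : ZMod 2) (f : L'.Space →ₗ[F] L.Space), f ≠ 0 ∧
      (∀ k, ∀ v ∈ L'.part k, f v ∈ L.part (k + l)) ∧
      (∀ a v, f (L'.X a v) = L.X (τ⁻¹ a) (f v)) ∧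
      ∀ a v, f (L'.C a v) = (-1 : F) ^ l.val • L.C (τ⁻¹ a) (f v) := by
  subst hτ
  -- The dimension count alone forces a nonzero homomorphism, since both spaces are nonzero.
  have h := IsClifford.finrank_mul_finrank hq h2 L'.isClifford (L.isClifford.twist τ)
  have hpos : 0 < Module.finrank F L'.Space * Module.finrank F L.Space :=
    Nat.mul_pos Module.finrank_pos Module.finrank_pos
  rw [h] at hpos
  have h0 := Nat.pos_of_mul_pos_left hpos
  rw [SuperModule.finrank_hom] at h0
  obtain ⟨l, hl⟩ : ∃ l, SuperModule.homOfParity L'.isClifford.toSuper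
      (L.isClifford.twist τ).toSuper l ≠ ⊥ := by
    by_contra! hc
    rw [hc, hc] at h0
    simp at h0
  obtain ⟨f, hf, hf0⟩ := Submodule.exists_mem_ne_zero_of_ne_bot hl
  rw [IsClifford.mem_homOfParity_iff] at hf
  exact ⟨l, f, hf0, hf⟩

theorem eq_two_pow_of_mul_self {d m : ℕ} (h : d * d = 2 ^ m) : Even m ∧ d = 2 ^ (m / 2) := by
  obtain ⟨k, -, rfl⟩ := (Nat.dvd_prime_pow Nat.prime_two).1 (Dvd.intro d h)
  rw [← pow_add] at h
  have := Nat.pow_right_injective le_rfl h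
  exact ⟨⟨k, this.symm⟩, by congr 1; omega⟩

/-- The dimension and the type of `L(i)`. -/
theorem Component.finrank_and_odd (h2 : (2 : F) ≠ 0) (hq : ∀ a, i a ≠ 0 → q F (i a) ≠ 0)
    (L : Component F i) :
    Module.finrank F L.Space = 2 ^ (n - Fintype.card {a // i a = 0} / 2) ∧
    (SuperModule.homOfParity L.isClifford.toSuper L.isClifford.toSuper 1 = ⊥ ↔
      Even (Fintype.card {a // i a = 0})) := by
  have h := IsClifford.finrank_mul_finrank hq h2 L.isClifford L.isClifford
  have hc : Fintype.card {a // i a = 0} + Fintype.card {a // i a ≠ 0} = n := by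
    have : Fintype.card {a // i a ≠ 0} = Fintype.card (Fin n) - Fintype.card {a // i a = 0} :=
      Fintype.card_subtype_compl (fun a => i a = 0)
    have h3 := Fintype.card_subtype_le (fun a => i a = 0)
    simp only [Fintype.card_fin] at this h3
    omega
  -- With `γ` residues equal to `0`, the square of `dim L` is `2 ^ (2 n - γ)` times 1 or 2. An
  -- exponent of 2 in a square is even, so the parity of `γ` decides which.
  rcases SuperModule.finrank_hom_self xc_even_odd L.irreducible with ⟨h0, h1⟩ | ⟨h0, h1⟩
  · rw [h1, mul_one] at h
    obtain ⟨he, hd⟩ := eq_two_pow_of_mul_self h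
    rw [hd]
    refine ⟨by congr 1; have := he.two_dvd; omega, iff_of_true h0 ?_⟩
    rw [Nat.even_iff] at he ⊢
    omega
  · rw [h1, ← pow_succ] at h
    obtain ⟨he, hd⟩ := eq_two_pow_of_mul_self h
    rw [hd]
    refine ⟨by congr 1; rw [Nat.even_iff] at he; omega, iff_of_false h0 ?_⟩
    rw [Nat.even_iff] at he ⊢
    omega

end Tensor

/-! ## Arithmetic of weights -/

section Weights

variable {F : Type*} [Field F]

theorem natCast_eq_zero_iff_of_lt (p : ℕ) [CharP F p] {a : ℕ} (ha : a < p) :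
    (a : F) = 0 ↔ a = 0 := by
  rw [CharP.cast_eq_zero_iff F p]
  exact ⟨fun h => Nat.eq_zero_of_dvd_of_lt h ha, fun h => h ▸ dvd_zero _⟩

theorem two_ne_zero_of_char (p : ℕ) [CharP F p] (hp : 3 ≤ p) : (2 : F) ≠ 0 := by
  have := (natCast_eq_zero_iff_of_lt (F := F) p (a := 2) (by omega)).not
  simpa using this

theorem natCast_inj_of_lt (p : ℕ) [CharP F p] {a b : ℕ} (ha : a < p) (hb : b < p)
    (h : (a : F) = b) : a = b :=
  CharP.natCast_injOn_Iio F p ha hb h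

theorem natCast_self_eq_zero (p : ℕ) [CharP F p] {a : ℕ} (h : a = p) : (a : F) = 0 := by
  rw [h, CharP.cast_eq_zero]

/-- The difference factors as `(a - b)(a + b + 1)`, and `a + b + 1 ≤ p` with equality only for `a =
b = (p - 1)/2`. -/
theorem q_injective (p : ℕ) [CharP F p] {a b : ℕ} (ha : 2 * a + 1 ≤ p)
    (hb : 2 * b + 1 ≤ p) (h : q F a = q F b) : a = b := by
  have h1 : ((a : F) - b) * ((a + b + 1 : ℕ) : F) = 0 := by
    push_cast; unfold q at h; linear_combination h
  rcases mul_eq_zero.1 h1 with h1 | h1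
  · exact natCast_inj_of_lt p (by omega) (by omega) (sub_eq_zero.1 h1)
  · rw [CharP.cast_eq_zero_iff F p] at h1
    have := Nat.le_of_dvd (by omega) h1
    omega

theorem q_ne_zero (p : ℕ) [CharP F p] (hp : 3 ≤ p) {a : ℕ} (ha : 2 * a + 1 ≤ p) (h0 : a ≠ 0) :
    q F a ≠ 0 := fun h =>
  h0 (q_injective p ha (by omega) (h.trans (by simp [q])))

variable [IsAlgClosed F]

/-- The scalar `Ω` for a pair of adjacent residues. -/
def omegaPair (F : Type*) [Field F] [IsAlgClosed F] (a b : ℕ) : F :=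
  root (1 - 2 * (q F a + q F b) / (q F a - q F b) ^ 2)

theorem omegaPair_comm (a b : ℕ) : omegaPair F a b = omegaPair F b a := by
  unfold omegaPair
  rw [add_comm, ← neg_sub (q F b), neg_sq]

theorem omegaPair_mul_self (a b : ℕ) : omegaPair F a b * omegaPair F a b =
    1 - 2 * (q F a + q F b) / (q F a - q F b) ^ 2 := root_mul_self _

/-- Clearing denominators, `Ω ^ 2 (q(a) - q(b)) ^ 2 = (a - b - 1)(a - b + 1)(a + b)(a + b + 2)`.
This is why admissibility is the condition `i_k ≠ i_{k+1} ± 1`. -/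
theorem omegaPair_eq_zero_iff (p : ℕ) [CharP F p] (hp : 3 ≤ p) {a b : ℕ} (ha : 2 * a + 1 ≤ p)
    (hb : 2 * b + 1 ≤ p) (hab : a ≠ b) : omegaPair F a b = 0 ↔ a = b + 1 ∨ b = a + 1 := by
  have hq : q F a - q F b ≠ 0 := fun h => hab (q_injective p ha hb (sub_eq_zero.1 h))
  have h1 : omegaPair F a b * omegaPair F a b * (q F a - q F b) ^ 2 =
      (((a : F) - (b + 1 : ℕ)) * (((a + 1 : ℕ) : F) - b)) *
        (((a + b : ℕ) : F) * (a + b + 2 : ℕ)) := by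
    rw [omegaPair_mul_self, sub_mul, div_mul_cancel₀ _ (pow_ne_zero 2 hq)]
    unfold q; push_cast; ring
  constructor
  · intro h
    rw [h, zero_mul, zero_mul] at h1
    rcases mul_eq_zero.1 h1.symm with h1 | h1 <;> rcases mul_eq_zero.1 h1 with h1 | h1
    · exact .inl (natCast_inj_of_lt p (by omega) (by omega) (sub_eq_zero.1 h1))
    · exact .inr (natCast_inj_of_lt p (by omega) (by omega) (sub_eq_zero.1 h1)).symm
    · rw [natCast_eq_zero_iff_of_lt p (by omega)] at h1; omega
    -- The factor `a + b + 2` can equal `p`, but then `a` and `b` are `(p - 1)/2` and `(p - 3)/2`,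
    -- which are neighbours anyway.
    · rw [CharP.cast_eq_zero_iff F p] at h1
      obtain ⟨k, hk⟩ := h1
      have : k < 2 := by
        by_contra! h
        have := Nat.mul_le_mul_left p h
        omega
      interval_cases k <;> omega
  · intro h
    have h0 : ((a : F) - (b + 1 : ℕ)) * (((a + 1 : ℕ) : F) - b) = 0 := by
      rcases h with rfl | rfl <;> simp
    rw [h0, zero_mul] at h1
    simpa [hq] using h1

end Weights

/-! ## Relations in `L(i)` -/

section Xi

variable {F : Type*} [Field F] {n : ℕ} {V : Type*} [AddCommGroup V] [Module F V]
  {i : Fin n → ℕ} {X C : Fin n → Module.End F V} {part : ZMod 2 → Submodule F V}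

namespace IsClifford

theorem isPair (h : IsClifford i X C part) {a b : Fin n} (hab : a ≠ b) :
    IsPair (q F (i a)) (q F (i b)) (X a) (X b) (C a) (C b) :=
  ⟨h.X_sq _, h.X_sq _, h.X_comm _ _, h.C_sq _, h.C_sq _, h.C_anti _ _ hab.symm, h.XC _, h.XC _,
    h.XC_far _ _ hab, h.XC_far _ _ hab.symm⟩

theorem isTriple (h : IsClifford i X C part) {a b c : Fin n} (hab : a ≠ b) (hac : a ≠ c)
    (hbc : b ≠ c) : IsTriple (q F (i a)) (q F (i b)) (q F (i c)) (X a) (X b) (X c)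
      (C a) (C b) (C c) :=
  ⟨h.X_sq _, h.X_sq _, h.X_sq _, h.X_comm _ _, h.X_comm _ _, h.X_comm _ _, h.C_sq _, h.C_sq _,
    h.C_sq _, h.C_anti _ _ hab.symm, h.C_anti _ _ hac.symm, h.C_anti _ _ hbc.symm,
    h.XC _, h.XC _, h.XC _, h.XC_far _ _ hab, h.XC_far _ _ hac, h.XC_far _ _ hab.symm,
    h.XC_far _ _ hbc, h.XC_far _ _ hac.symm, h.XC_far _ _ hbc.symm⟩

end IsClifford

/-- The operator `Ξ` for the positions `a` and `b`. -/
def xiOp (i : Fin n → ℕ) (X C : Fin n → Module.End F V) (a b : Fin n) : Module.End F V :=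
  -((q F (i a) - q F (i b))⁻¹ • mixer (X a) (X b) (C a) (C b))

theorem xiOp_eq (a b : Fin n) :
    xiOp i X C a b = (-(q F (i a) - q F (i b))⁻¹) • mixer (X a) (X b) (C a) (C b) := by
  rw [xiOp, neg_smul]

namespace IsClifford

theorem xiOp_swap (h : IsClifford i X C part) {a b : Fin n} (hab : a ≠ b) :
    xiOp i X C b a = -xiOp i X C a b := by
  have := (h.isPair hab).mixer_relations.2.1
  rw [xiOp, xiOp, this, ← neg_sub, inv_neg, neg_smul]

theorem xiOp_mul_X (h : IsClifford i X C part) {a b : Fin n} (hab : a ≠ b)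
    (hq : q F (i a) - q F (i b) ≠ 0) :
    xiOp i X C a b * X a = X b * xiOp i X C a b - (1 + C a * C b) := by
  have := (h.isPair hab).mixer_relations.2.2.1
  rw [xiOp_eq, smul_mul_assoc, this, mul_smul_comm, smul_add, smul_smul, neg_mul,
    inv_mul_cancel₀ hq, neg_one_smul]
  exact (sub_eq_add_neg _ _).symm

theorem xiOp_mul_C_left (h : IsClifford i X C part) {a b : Fin n} (hab : a ≠ b) :
    xiOp i X C a b * C a = C b * xiOp i X C a b := by
  rw [xiOp_eq, smul_mul_assoc, (h.isPair hab).mixer_relations.2.2.2.1, mul_smul_comm]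

theorem xiOp_mul_C_right (h : IsClifford i X C part) {a b : Fin n} (hab : a ≠ b) :
    xiOp i X C a b * C b = C a * xiOp i X C a b := by
  rw [xiOp_eq, smul_mul_assoc, (h.isPair hab).mixer_relations.2.2.2.2, mul_smul_comm]

theorem xiOp_mul_X_far (h : IsClifford i X C part) {a b c : Fin n} (hac : c ≠ a) (hbc : c ≠ b) :
    xiOp i X C a b * X c = X c * xiOp i X C a b := by
  rw [xiOp_eq, smul_mul_assoc, mixer_mul_comm (h.X_comm _ _) (h.X_comm _ _), mul_smul_comm]
  rw [mul_assoc, ← h.XC_far _ _ hbc, ← mul_assoc, ← h.XC_far _ _ hac, mul_assoc]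

theorem xiOp_mul_C_far (h : IsClifford i X C part) {a b c : Fin n} (hac : c ≠ a) (hbc : c ≠ b) :
    xiOp i X C a b * C c = C c * xiOp i X C a b := by
  rw [xiOp_eq, smul_mul_assoc, mixer_mul_comm (h.XC_far _ _ hac.symm) (h.XC_far _ _ hbc.symm),
    mul_smul_comm]
  rw [mul_assoc, h.C_anti _ _ hbc.symm, mul_neg, ← mul_assoc, h.C_anti _ _ hac.symm, neg_mul,
    neg_neg, mul_assoc]

theorem xiOp_mul_xiOp_far (h : IsClifford i X C part) {a b c d : Fin n} (hac : c ≠ a)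
    (hbc : c ≠ b) (had : d ≠ a) (hbd : d ≠ b) :
    xiOp i X C a b * xiOp i X C c d = xiOp i X C c d * xiOp i X C a b := by
  have h1 := h.xiOp_mul_X_far hac hbc
  have h2 := h.xiOp_mul_X_far had hbd
  have h3 := h.xiOp_mul_C_far hac hbc
  have h4 := h.xiOp_mul_C_far had hbd
  rw [xiOp_eq c d, smul_mul_assoc, mul_smul_comm, mixer_mul_comm h1.symm h2.symm]
  rw [mul_assoc, ← h4, ← mul_assoc, ← h3, mul_assoc]

theorem xiOp_mul_self [IsAlgClosed F] (h : IsClifford i X C part) {a b : Fin n} (hab : a ≠ b) :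
    xiOp i X C a b * xiOp i X C a b =
      (1 - omegaPair F (i a) (i b) * omegaPair F (i a) (i b)) • 1 := by
  rw [xiOp_eq, smul_mul_smul_comm, (h.isPair hab).mixer_relations.1, smul_smul,
    omegaPair_mul_self]
  congr 1
  field_simp
  ring

variable {a b c : Fin n}

theorem xiOp_yang_baxter (h : IsClifford i X C part) (hab : a ≠ b) (hac : a ≠ c) (hbc : b ≠ c)
    (qab : q F (i a) - q F (i b) ≠ 0) (qac : q F (i a) - q F (i c) ≠ 0)
    (qbc : q F (i b) - q F (i c) ≠ 0) :
    xiOp i X C b c * xiOp i X C a b =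
      xiOp i X C a b * xiOp i X C a c + xiOp i X C a c * xiOp i X C b c ∧
    xiOp i X C a b * xiOp i X C b c =
      xiOp i X C a c * xiOp i X C a b + xiOp i X C b c * xiOp i X C a c := by
  obtain ⟨h1, h2⟩ := (h.isTriple hab hac hbc).yang_baxter
  simp only [xiOp_eq, smul_mul_smul_comm]
  set S := mixer (X a) (X b) (C a) (C b)
  set T := mixer (X b) (X c) (C b) (C c)
  set W := mixer (X a) (X c) (C a) (C c)
  set r := q F (i a) - q F (i b) with hr
  set s := q F (i a) - q F (i c) with hs
  set t := q F (i b) - q F (i c) with ht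
  have e : ∀ x : Module.End F V, x = s⁻¹ • s • x := fun x => by
    rw [smul_smul, inv_mul_cancel₀ qac, one_smul]
  constructor
  · rw [e (T * S), h1]
    match_scalars <;> field_simp
  · rw [e (S * T), h2]
    match_scalars <;> field_simp

end IsClifford

end Xi

/-! ## The operators on `D^i` -/

/-! ### Simple transpositions and admissible products. -/

section Perm

variable {n : ℕ}

theorem lo_ne_hi (k : Fin (n - 1)) : lo k ≠ hi k := by
  simp [lo, hi, Fin.ext_iff]

theorem simple_lo (k : Fin (n - 1)) : simple k (lo k) = hi k := Equiv.swap_apply_left _ _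

theorem simple_hi (k : Fin (n - 1)) : simple k (hi k) = lo k := Equiv.swap_apply_right _ _

theorem simple_of_ne {k : Fin (n - 1)} {a : Fin n} (h : a ≠ lo k) (h' : a ≠ hi k) :
    simple k a = a := Equiv.swap_apply_of_ne_of_ne h h'

theorem simple_mul_self (k : Fin (n - 1)) : simple k * simple k = 1 := Equiv.swap_mul_self _ _

theorem simple_simple_mul (k : Fin (n - 1)) (τ : Equiv.Perm (Fin n)) :
    simple k * (simple k * τ) = τ := by
  rw [← mul_assoc, simple_mul_self, one_mul]

theorem inv_simple_mul (k : Fin (n - 1)) (τ : Equiv.Perm (Fin n)) (a : Fin n) :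
    (simple k * τ)⁻¹ a = τ⁻¹ (simple k a) := by
  rw [mul_inv_rev, Equiv.Perm.mul_apply, simple, Equiv.swap_inv]

theorem simple_comm {j k : Fin (n - 1)} (h : j.val + 1 < k.val) :
    simple j * simple k = simple k * simple j := by
  refine (Equiv.Perm.disjoint_iff_eq_or_eq.2 fun a => ?_).commute
  by_cases h1 : a = lo j ∨ a = hi j
  · right
    apply simple_of_ne <;> rcases h1 with rfl | rfl <;> simp [lo, hi, Fin.ext_iff] <;> omega
  · left
    push Not at h1
    exact simple_of_ne h1.1 h1.2

theorem lo_eq_hi {j k : Fin (n - 1)} (h : j.val + 1 = k.val) : lo k = hi j :=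
  Fin.ext h.symm

theorem simple_braid {j k : Fin (n - 1)} (h : j.val + 1 = k.val) :
    simple j * (simple k * simple j) = simple k * (simple j * simple k) := by
  have h1 : lo j ≠ hi k := by simp [lo, hi, Fin.ext_iff]; omega
  have h2 : hi j ≠ hi k := by simp [hi, Fin.ext_iff]; omega
  rw [← mul_assoc, ← mul_assoc]
  unfold simple
  rw [lo_eq_hi h]
  have e1 := Equiv.swap_mul_swap_mul_swap h2.symm h1.symm
  have e2 := Equiv.swap_mul_swap_mul_swap (lo_ne_hi j) h1
  rw [Equiv.swap_comm (hi j) (lo j), Equiv.swap_comm (hi k) (hi j)] at e1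
  rw [e1, e2, Equiv.swap_comm]

theorem permute_apply (τ : Equiv.Perm (Fin n)) (i : Fin n → ℕ) (a : Fin n) :
    permute τ i a = i (τ⁻¹ a) := rfl

theorem permute_one (i : Fin n → ℕ) : permute 1 i = i := rfl

theorem permute_permute (σ τ : Equiv.Perm (Fin n)) (i : Fin n → ℕ) :
    permute σ (permute τ i) = permute (σ * τ) i := by
  funext a; simp [permute, mul_inv_rev]

theorem permute_simple_mul_lo (k : Fin (n - 1)) (τ : Equiv.Perm (Fin n)) (i : Fin n → ℕ) :
    permute (simple k * τ) i (lo k) = permute τ i (hi k) := by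
  rw [permute_apply, inv_simple_mul, simple_lo, permute_apply]

theorem permute_simple_mul_hi (k : Fin (n - 1)) (τ : Equiv.Perm (Fin n)) (i : Fin n → ℕ) :
    permute (simple k * τ) i (hi k) = permute τ i (lo k) := by
  rw [permute_apply, inv_simple_mul, simple_hi, permute_apply]

theorem admissible_simple_mul_iff (k : Fin (n - 1)) (τ : Equiv.Perm (Fin n)) (i : Fin n → ℕ) :
    Admissible (permute (simple k * τ) i) k ↔ Admissible (permute τ i) k := by
  rw [Admissible, Admissible, permute_simple_mul_hi, permute_simple_mul_lo, and_comm]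

theorem isAdmissibleProduct_simple_mul_iff {i : Fin n → ℕ} {k : Fin (n - 1)}
    {τ : Equiv.Perm (Fin n)} (h : Admissible (permute τ i) k) :
    IsAdmissibleProduct i (simple k * τ) ↔ IsAdmissibleProduct i τ := by
  refine ⟨fun h' => ?_, fun h' => .step τ k h' h⟩
  have := IsAdmissibleProduct.step _ k h' ((admissible_simple_mul_iff k τ i).2 h)
  rwa [simple_simple_mul] at this

theorem IsAdmissibleProduct.mul {i : Fin n → ℕ} {σ τ : Equiv.Perm (Fin n)}
    (hσ : IsAdmissibleProduct (permute τ i) σ) (hτ : IsAdmissibleProduct i τ) :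
    IsAdmissibleProduct i (σ * τ) := by
  induction hσ with
  | one => rwa [one_mul]
  | step σ k _ h ih =>
    rw [permute_permute] at h
    rw [mul_assoc]
    exact .step _ _ ih h

end Perm

/-- The local conditions satisfied by the weights of completely splittable modules. -/
structure IsGoodWeight (p : ℕ) {n : ℕ} (j : Fin n → ℕ) : Prop where
  le : ∀ k, 2 * j k + 1 ≤ p
  ne : ∀ k : Fin (n - 1), j (lo k) ≠ j (hi k)
  triple : ∀ k l : Fin (n - 1), k.val + 1 = l.val → j (lo k) = j (hi l) →
    (j (lo k) = 0 ∧ j (hi k) = 1) ∨ (2 * j (lo k) + 3 = p ∧ 2 * j (hi k) + 1 = p)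

/-- All weights reached from `i` by admissible transpositions satisfy the local conditions, and
they are distinct. -/
structure IsGoodOrbit (p : ℕ) {n : ℕ} (i : Fin n → ℕ) : Prop where
  good : ∀ τ, IsAdmissibleProduct i τ → IsGoodWeight p (permute τ i)
  inj : ∀ σ τ, IsAdmissibleProduct i σ → IsAdmissibleProduct i τ → permute σ i = permute τ i →
    σ = τ

theorem IsGoodOrbit.le {p n : ℕ} {i : Fin n → ℕ} (h : IsGoodOrbit p i) (a) : 2 * i a + 1 ≤ p :=
  (h.good 1 .one).le a

theorem IsGoodOrbit.q_sub_ne_zero {F : Type*} [Field F] {p n : ℕ} [CharP F p] {i : Fin n → ℕ}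
    (hi' : IsGoodOrbit p i) {a b : Fin n} (h : i a ≠ i b) :
    q F (i a) - q F (i b) ≠ 0 := fun h' =>
  h (q_injective p (hi'.le a) (hi'.le b) (sub_eq_zero.1 h'))

/-! ### The operators on `D^i` and their relations. -/

section DOps

variable {F : Type*} [Field F] [IsAlgClosed F] {n : ℕ} {i : Fin n → ℕ} (L : Component F i)

open Classical in
/-- The element `z ^ τ`, which is `0` unless `τ ∈ P_i`. -/
def sgl (τ : Equiv.Perm (Fin n)) : L.Space →ₗ[F] DSpace L :=
  if h : IsAdmissibleProduct i τ then Finsupp.lsingle ⟨τ, h⟩ else 0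

theorem sgl_of_mem {τ : Equiv.Perm (Fin n)} (h : IsAdmissibleProduct i τ) (z : L.Space) :
    sgl L τ z = Finsupp.single ⟨τ, h⟩ z := by
  simp [sgl, h]

theorem sgl_of_notMem {τ : Equiv.Perm (Fin n)} (h : ¬ IsAdmissibleProduct i τ) (z : L.Space) :
    sgl L τ z = 0 := by
  simp [sgl, h]

theorem DSpace.hom_ext {W : Type*} [AddCommGroup W] [Module F W] {f g : DSpace L →ₗ[F] W}
    (h : ∀ τ, IsAdmissibleProduct i τ → ∀ z, f (sgl L τ z) = g (sgl L τ z)) : f = g := by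
  refine Finsupp.lhom_ext fun τ z => ?_
  simpa only [sgl_of_mem L τ.2] using h τ.1 τ.2 z

theorem DX_single (k : Fin n) (τ : P i) (z : L.Space) :
    DX L k (Finsupp.single τ z) = Finsupp.single τ (L.X (τ.1⁻¹ k) z) := by
  simp [DX]

theorem DC_single (k : Fin n) (τ : P i) (z : L.Space) :
    DC L k (Finsupp.single τ z) = Finsupp.single τ (L.C (τ.1⁻¹ k) z) := by
  simp [DC]

theorem DX_sgl (k : Fin n) (τ) (z : L.Space) : DX L k (sgl L τ z) = sgl L τ (L.X (τ⁻¹ k) z) := by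
  by_cases h : IsAdmissibleProduct i τ
  · simp only [sgl_of_mem L h, DX_single]
  · simp only [sgl_of_notMem L h, map_zero]

theorem DC_sgl (k : Fin n) (τ) (z : L.Space) : DC L k (sgl L τ z) = sgl L τ (L.C (τ⁻¹ k) z) := by
  by_cases h : IsAdmissibleProduct i τ
  · simp only [sgl_of_mem L h, DC_single]
  · simp only [sgl_of_notMem L h, map_zero]

variable {p : ℕ} [CharP F p] (hp : 3 ≤ p)

include hp in
theorem omegaPair_eq_zero_of_not_admissible {j : Fin n → ℕ} (hj : IsGoodWeight p j)
    {k : Fin (n - 1)} (h : ¬ Admissible j k) : omegaPair F (j (lo k)) (j (hi k)) = 0 := by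
  rw [omegaPair_eq_zero_iff p hp (hj.le _) (hj.le _) (hj.ne k)]
  unfold Admissible at h
  tauto

include hp in
theorem omegaPair_ne_zero_of_admissible {j : Fin n → ℕ} (hj : IsGoodWeight p j)
    {k : Fin (n - 1)} (h : Admissible j k) : omegaPair F (j (lo k)) (j (hi k)) ≠ 0 := by
  rw [Ne, omegaPair_eq_zero_iff p hp (hj.le _) (hj.le _) (hj.ne k)]
  unfold Admissible at h
  tauto

-- One formula covers all cases. If `s_k` is not admissible for `τ · i`, then `Ω` is zero; and if `τ
-- ∉ P_i` but `s_k τ ∈ P_i`, the step is not admissible and `Ω` is zero again. The relations below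
-- can thus be checked for formal symbols `z ^ τ`, with no case distinctions on membership in `P_i`.
open Classical in
include hp in
theorem DS_sgl (hi' : IsGoodOrbit p i) (k : Fin (n - 1)) (τ) (z : L.Space) :
    DS L k (sgl L τ z) = sgl L τ (xiOp i L.X L.C (τ⁻¹ (lo k)) (τ⁻¹ (hi k)) z) +
      omegaPair F (i (τ⁻¹ (lo k))) (i (τ⁻¹ (hi k))) • sgl L (simple k * τ) z := by
  by_cases h : IsAdmissibleProduct i τ
  · have e1 : Xi L ⟨τ, h⟩ k (Finsupp.single ⟨τ, h⟩ z) =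
        Finsupp.single ⟨τ, h⟩ (xiOp i L.X L.C (τ⁻¹ (lo k)) (τ⁻¹ (hi k)) z) := by
      simp only [Xi, xiOp, mixer, LinearMap.neg_apply, LinearMap.smul_apply, LinearMap.add_apply,
        Module.End.mul_apply, LinearMap.sub_apply, DX_single, DC_single, Finsupp.single_neg,
        ← Finsupp.single_add, ← Finsupp.single_sub, Finsupp.smul_single, permute_apply]
    have e2 : DS L k (Finsupp.single ⟨τ, h⟩ z) = Xi L ⟨τ, h⟩ k (Finsupp.single ⟨τ, h⟩ z) +
        (if h' : Admissible (permute τ i) k then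
          omegaScalar F (permute (simple k * τ) i) k •
            Finsupp.lsingle (⟨simple k * τ, .step τ k h h'⟩ : P i)
          else 0 : L.Space →ₗ[F] DSpace L) z := by
      simp only [DS, Finsupp.lsum_single, LinearMap.add_apply, LinearMap.comp_apply,
        Finsupp.lsingle_apply]
    rw [sgl_of_mem L h, sgl_of_mem L h, e2, e1]
    congr 1
    by_cases h' : Admissible (permute τ i) k
    · rw [dif_pos h', sgl_of_mem L (.step τ k h h'), LinearMap.smul_apply, Finsupp.lsingle_apply]
      congr 1
      rw [omegaPair_comm, omegaScalar, permute_simple_mul_hi, permute_simple_mul_lo]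
      rfl
    · rw [dif_neg h', ← permute_apply τ i, ← permute_apply τ i,
        omegaPair_eq_zero_of_not_admissible hp (hi'.good τ h) h']
      simp
  · rw [sgl_of_notMem L h, sgl_of_notMem L h, map_zero, zero_add]
    by_cases h' : IsAdmissibleProduct i (simple k * τ)
    · have h2 : ¬ Admissible (permute τ i) k := fun h2 =>
        h ((isAdmissibleProduct_simple_mul_iff h2).1 h')
      have h3 := omegaPair_eq_zero_of_not_admissible (F := F) hp (hi'.good _ h')
        (k := k) (by rwa [admissible_simple_mul_iff])
      rw [permute_simple_mul_hi, permute_simple_mul_lo, omegaPair_comm] at h3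
      rw [← permute_apply τ i, ← permute_apply τ i, h3, zero_smul]
    · rw [sgl_of_notMem L h', smul_zero]

/-! ### The relations of the affine Hecke-Clifford algebra -/

variable {L}

section Relations

variable {τ : Equiv.Perm (Fin n)}

theorem inv_ne {a b : Fin n} (h : a ≠ b) : τ⁻¹ a ≠ τ⁻¹ b := fun e => h ((τ⁻¹).injective e)

include hp in
theorem DS_mul_self (hi' : IsGoodOrbit p i) (k) : DS L k * DS L k = 1 := by
  refine DSpace.hom_ext L fun τ hτ z => ?_
  have hne := inv_ne (τ := τ) (lo_ne_hi k)
  have h1 := congrArg (sgl L τ) (LinearMap.congr_fun (L.isClifford.xiOp_mul_self hne) z)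
  simp only [Module.End.mul_apply, DS_sgl L hp hi', map_add, map_smul, inv_simple_mul, simple_lo,
    simple_hi, simple_simple_mul, Module.End.one_apply, L.isClifford.xiOp_swap hne,
    LinearMap.neg_apply, map_neg, LinearMap.smul_apply,
    omegaPair_comm (i (τ⁻¹ (hi k))) (i (τ⁻¹ (lo k)))] at h1 ⊢
  linear_combination (norm := module) h1

include hp in
theorem DS_mul_comm (hi' : IsGoodOrbit p i) {j k : Fin (n - 1)} (h : j.val + 1 < k.val) :
    DS L j * DS L k = DS L k * DS L j := by
  refine DSpace.hom_ext L fun τ hτ z => ?_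
  have n1 : lo k ≠ lo j := by simp [lo, Fin.ext_iff]; omega
  have n2 : lo k ≠ hi j := by simp [lo, hi, Fin.ext_iff]; omega
  have n3 : hi k ≠ lo j := by simp [lo, hi, Fin.ext_iff]; omega
  have n4 : hi k ≠ hi j := by simp [hi, Fin.ext_iff]; omega
  have h1 := congrArg (sgl L τ) (LinearMap.congr_fun (L.isClifford.xiOp_mul_xiOp_far
    (inv_ne (τ := τ) n1) (inv_ne n2) (inv_ne n3) (inv_ne n4)) z)
  simp only [Module.End.mul_apply, DS_sgl L hp hi', map_add, map_smul, inv_simple_mul,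
    simple_of_ne n1 n2, simple_of_ne n3 n4, simple_of_ne n1.symm n3.symm,
    simple_of_ne n2.symm n4.symm, ← mul_assoc, simple_comm h] at h1 ⊢
  linear_combination (norm := module) h1

include hp in
theorem DS_mul_DX (hi' : IsGoodOrbit p i) (k) :
    DS L k * DX L (lo k) = DX L (hi k) * DS L k - (1 + DC L (lo k) * DC L (hi k)) := by
  refine DSpace.hom_ext L fun τ hτ z => ?_
  have hne := inv_ne (τ := τ) (lo_ne_hi k)
  have h1 := congrArg (sgl L τ) (LinearMap.congr_fun (L.isClifford.xiOp_mul_X hne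
    (hi'.q_sub_ne_zero ((hi'.good τ hτ).ne k))) z)
  simp only [Module.End.mul_apply, DS_sgl L hp hi', map_add, map_smul, inv_simple_mul, simple_lo,
    simple_hi, Module.End.one_apply, DX_sgl, DC_sgl, LinearMap.sub_apply, LinearMap.add_apply,
    map_sub] at h1 ⊢
  linear_combination (norm := module) h1

include hp in
theorem DS_mul_DX_far (hi' : IsGoodOrbit p i) (k) {a : Fin n} (h : a ≠ lo k) (h' : a ≠ hi k) :
    DS L k * DX L a = DX L a * DS L k := by
  refine DSpace.hom_ext L fun τ hτ z => ?_
  have h1 := congrArg (sgl L τ) (LinearMap.congr_fun (L.isClifford.xiOp_mul_X_far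
    (inv_ne (τ := τ) h) (inv_ne h')) z)
  simp only [Module.End.mul_apply, DS_sgl L hp hi', map_add, map_smul, inv_simple_mul,
    simple_of_ne h h', DX_sgl] at h1 ⊢
  linear_combination (norm := module) h1

include hp in
theorem DS_mul_DC_lo (hi' : IsGoodOrbit p i) (k) :
    DS L k * DC L (lo k) = DC L (hi k) * DS L k := by
  refine DSpace.hom_ext L fun τ hτ z => ?_
  have hne := inv_ne (τ := τ) (lo_ne_hi k)
  have h1 := congrArg (sgl L τ) (LinearMap.congr_fun (L.isClifford.xiOp_mul_C_left hne) z)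
  simp only [Module.End.mul_apply, DS_sgl L hp hi', map_add, map_smul, inv_simple_mul, simple_lo,
    simple_hi, DC_sgl] at h1 ⊢
  linear_combination (norm := module) h1

include hp in
theorem DS_mul_DC_hi (hi' : IsGoodOrbit p i) (k) :
    DS L k * DC L (hi k) = DC L (lo k) * DS L k := by
  refine DSpace.hom_ext L fun τ hτ z => ?_
  have hne := inv_ne (τ := τ) (lo_ne_hi k)
  have h1 := congrArg (sgl L τ) (LinearMap.congr_fun (L.isClifford.xiOp_mul_C_right hne) z)
  simp only [Module.End.mul_apply, DS_sgl L hp hi', map_add, map_smul, inv_simple_mul, simple_lo,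
    simple_hi, DC_sgl] at h1 ⊢
  linear_combination (norm := module) h1

include hp in
theorem DS_mul_DC_far (hi' : IsGoodOrbit p i) (k) {a : Fin n} (h : a ≠ lo k) (h' : a ≠ hi k) :
    DS L k * DC L a = DC L a * DS L k := by
  refine DSpace.hom_ext L fun τ hτ z => ?_
  have h1 := congrArg (sgl L τ) (LinearMap.congr_fun (L.isClifford.xiOp_mul_C_far
    (inv_ne (τ := τ) h) (inv_ne h')) z)
  simp only [Module.End.mul_apply, DS_sgl L hp hi', map_add, map_smul, inv_simple_mul,
    simple_of_ne h h', DC_sgl] at h1 ⊢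
  linear_combination (norm := module) h1

include hp in
/-- The braid relation, in terms of the operators `Ξ` and the scalars `Ω` at three positions. -/
theorem xiOp_braid (hi' : IsGoodOrbit p i) (hτ : IsAdmissibleProduct i τ) {j k : Fin (n - 1)}
    (h : j.val + 1 = k.val) {a b c : Fin n} (ha : τ⁻¹ (lo j) = a) (hb : τ⁻¹ (hi j) = b)
    (hc : τ⁻¹ (hi k) = c) :
    omegaPair F (i a) (i b) • (xiOp i L.X L.C b c * xiOp i L.X L.C a b -
      xiOp i L.X L.C a b * xiOp i L.X L.C a c) =
        omegaPair F (i a) (i b) • (xiOp i L.X L.C a c * xiOp i L.X L.C b c) ∧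
    omegaPair F (i b) (i c) • (xiOp i L.X L.C a c * xiOp i L.X L.C a b +
      xiOp i L.X L.C b c * xiOp i L.X L.C a c) =
        omegaPair F (i b) (i c) • (xiOp i L.X L.C a b * xiOp i L.X L.C b c) ∧
    xiOp i L.X L.C a b * (xiOp i L.X L.C b c * xiOp i L.X L.C a b) +
      (omegaPair F (i a) (i b) * omegaPair F (i a) (i b)) • xiOp i L.X L.C a c =
    xiOp i L.X L.C b c * (xiOp i L.X L.C a b * xiOp i L.X L.C b c) +
      (omegaPair F (i b) (i c) * omegaPair F (i b) (i c)) • xiOp i L.X L.C a c := by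
  have hg := hi'.good τ hτ
  have hab : a ≠ b := by rw [← ha, ← hb]; exact inv_ne (lo_ne_hi j)
  have hac : a ≠ c := by
    rw [← ha, ← hc]; apply inv_ne; simp [lo, hi, Fin.ext_iff]; omega
  have hbc : b ≠ c := by
    rw [← hb, ← hc]; apply inv_ne; simp [hi, Fin.ext_iff]; omega
  have iab : i a ≠ i b := by rw [← ha, ← hb]; exact hg.ne j
  have ibc : i b ≠ i c := by rw [← hb, ← hc, ← lo_eq_hi h]; exact hg.ne k
  have qab := hi'.q_sub_ne_zero (F := F) iab
  have qbc := hi'.q_sub_ne_zero (F := F) ibc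
  -- When the outer residues agree, `IsGoodWeight.triple` leaves the weights `(0, 1, 0)` and
  -- `((p-3)/2, (p-1)/2, (p-3)/2)`. Both `Ω` vanish there, and `mixer_braid` applies.
  by_cases iac : i a = i c
  · have ht := hg.triple j k h (by rw [permute_apply, permute_apply, ha, hc, iac])
    rw [permute_apply, permute_apply, ha, hb] at ht
    have w1 : omegaPair F (i a) (i b) = 0 := by
      rw [omegaPair_eq_zero_iff p hp (hi'.le _) (hi'.le _) iab]; omega
    have w2 : omegaPair F (i b) (i c) = 0 := by
      rw [omegaPair_eq_zero_iff p hp (hi'.le _) (hi'.le _) ibc]; omega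
    rw [w1, w2]
    have hT := L.isClifford.isTriple hab hac hbc
    rw [← iac] at hT
    have hm := hT.mixer_braid (by
      rcases ht with ⟨h0, -⟩ | ⟨h0, h1⟩
      · exact .inl ⟨L.isClifford.X_zero a h0, L.isClifford.X_zero c (iac ▸ h0), by simp [q, h0]⟩
      · right
        have e0 := natCast_self_eq_zero (F := F) p h0
        have e1 := natCast_self_eq_zero (F := F) p h1
        push_cast at e0 e1
        have e2 := two_ne_zero_of_char (F := F) p hp
        have e4 : (4 : F) ≠ 0 := by
          rw [show (4 : F) = 2 * 2 by norm_num]; exact mul_ne_zero e2 e2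
        -- In `F` one has `2 (i a) = -3` and `2 (i b) = -1`, so `q (i a) = 3/4` and `q (i b) =
        -- -1/4`. Multiplying by 4 avoids the fractions.
        apply mul_left_cancel₀ e4
        unfold q
        linear_combination (2 * (i a : F) - 1) * e0 + (6 * (i b : F) + 3) * e1)
    refine ⟨by simp, by simp, ?_⟩
    simp only [zero_mul, zero_smul, add_zero, xiOp_eq, smul_mul_smul_comm]
    rw [← mul_assoc (mixer _ _ _ _), hm, ← iac, ← neg_sub (q F (i a)), inv_neg, smul_neg,
      ← neg_smul, mul_assoc (mixer _ _ _ _)]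
    congr 1
    ring
  · have qac := hi'.q_sub_ne_zero (F := F) iac
    obtain ⟨y1, y2⟩ := L.isClifford.xiOp_yang_baxter hab hac hbc qab qac qbc
    refine ⟨by rw [y1, add_sub_cancel_left], by rw [← y2], ?_⟩
    have s1 := L.isClifford.xiOp_mul_self hab
    have s2 := L.isClifford.xiOp_mul_self hbc
    set A := xiOp i L.X L.C a b
    set B := xiOp i L.X L.C b c
    set G := xiOp i L.X L.C a c
    -- Yang-Baxter turns `A B A` into `A² G + A G B` and `B A B` into `A G B + G B²`. The scalar
    -- squares `A² = 1 - Ω_ab²` and `B² = 1 - Ω_bc²` make the two sides agree.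
    have e1 : A * (B * A) = A * A * G + A * G * B := by rw [y1, mul_add]; simp only [mul_assoc]
    have e2 : B * (A * B) = A * G * B + G * (B * B) := by
      rw [← mul_assoc, y1, add_mul]; simp only [mul_assoc]
    rw [e1, e2, s1, s2, smul_mul_assoc, one_mul, mul_smul_comm, mul_one]
    module

-- Expanding both sides on `z ^ τ`, the components at `s_j τ`, `s_k τ` and `τ` are the three
-- identities of `xiOp_braid`. The remaining components agree term by term, using the braid relation
-- in `S_n` for the longest one.
include hp in
theorem DS_braid (hi' : IsGoodOrbit p i) {j k : Fin (n - 1)} (h : j.val + 1 = k.val) :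
    DS L j * DS L k * DS L j = DS L k * DS L j * DS L k := by
  refine DSpace.hom_ext L fun τ hτ z => ?_
  obtain ⟨h1, h2, h3⟩ := xiOp_braid (L := L) hp hi' hτ h rfl rfl rfl
  have g1 := congrArg (sgl L (simple j * τ)) (LinearMap.congr_fun h1 z)
  have g2 := congrArg (sgl L (simple k * τ)) (LinearMap.congr_fun h2 z)
  have g3 := congrArg (sgl L τ) (LinearMap.congr_fun h3 z)
  have n1 : hi k ≠ lo j := by simp [lo, hi, Fin.ext_iff]; omega
  have n2 : hi k ≠ hi j := by simp [hi, Fin.ext_iff]; omega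
  have n3 : lo j ≠ lo k := by simp [lo, Fin.ext_iff]; omega
  have sk : simple k (hi j) = hi k := by rw [← lo_eq_hi h, simple_lo]
  have sk' : simple k (hi k) = hi j := by rw [← lo_eq_hi h, simple_hi]
  have hb : simple j * (simple k * (simple j * τ)) = simple k * (simple j * (simple k * τ)) := by
    simpa only [mul_assoc] using congrArg (· * τ) (simple_braid h)
  have x1 := L.isClifford.xiOp_swap (inv_ne (τ := τ) (lo_ne_hi j))
  have x2 := L.isClifford.xiOp_swap (inv_ne (τ := τ) n2.symm)
  simp only [Module.End.mul_apply, DS_sgl L hp hi', map_add, map_smul, inv_simple_mul,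
    lo_eq_hi h, simple_lo, simple_hi, sk, sk', simple_of_ne n1 n2, simple_of_ne n3 n1.symm,
    simple_simple_mul, x1, x2, LinearMap.neg_apply, map_neg, map_sub, LinearMap.smul_apply,
    LinearMap.add_apply, LinearMap.sub_apply, hb,
    omegaPair_comm (i (τ⁻¹ (hi j))) (i (τ⁻¹ (lo j))),
    omegaPair_comm (i (τ⁻¹ (hi k))) (i (τ⁻¹ (hi j)))] at g1 g2 g3 ⊢
  linear_combination (norm := module) g1 + g2 + g3

end Relations

end DOps

/-! ## The module `D^i` -/

theorem HC.adjoin_range_gen (F : Type*) [Field F] (n : ℕ) :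
    Algebra.adjoin F (Set.range (HC.gen F (n := n))) = ⊤ := by
  have : Set.range (HC.gen F (n := n)) =
      RingQuot.mkAlgHom F (Rel F n) '' Set.range (FreeAlgebra.ι F) := by
    rw [← Set.range_comp]; rfl
  rw [this, ← AlgHom.map_adjoin, FreeAlgebra.adjoin_range_ι, Algebra.map_top,
    AlgHom.range_eq_top]
  exact RingQuot.mkAlgHom_surjective F (Rel F n)

theorem HC.even_odd {F : Type*} [Field F] {n : ℕ} (a : HC F n) :
    ∃ b ∈ HC.gr F (n := n) 0, ∃ c ∈ HC.gr F (n := n) 1, a = b + c :=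
  exists_even_add_odd (gen := HC.gen F) (par := Gen.parity) (fun _ => rfl)
    (HC.adjoin_range_gen F n) a

section DMod

variable {F : Type*} [Field F] [IsAlgClosed F] {n : ℕ} {i : Fin n → ℕ} (L : Component F i)

theorem mem_DPart {j : ZMod 2} {f : DSpace L} : f ∈ DPart L j ↔ ∀ τ, f τ ∈ L.part j := Iff.rfl

theorem sgl_mem_DPart {j : ZMod 2} (τ) {z : L.Space} (hz : z ∈ L.part j) :
    sgl L τ z ∈ DPart L j := by
  by_cases h : IsAdmissibleProduct i τ
  · rw [sgl_of_mem L h, mem_DPart]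
    intro σ
    classical
    rw [Finsupp.single_apply]
    split_ifs
    · exact hz
    · exact (L.part j).zero_mem
  · rw [sgl_of_notMem L h]; exact (DPart L j).zero_mem

theorem mem_of_sgl_mem {N : Submodule F (DSpace L)} {f : DSpace L}
    (h : ∀ τ : P i, sgl L τ.1 (f τ) ∈ N) : f ∈ N := by
  rw [← Finsupp.sum_single f]
  refine N.sum_mem fun τ _ => ?_
  simpa only [sgl_of_mem L τ.2] using h τ

theorem map_DPart_mem {T : Module.End F (DSpace L)} {j k : ZMod 2}
    (h : ∀ τ, IsAdmissibleProduct i τ → ∀ z ∈ L.part j, T (sgl L τ z) ∈ DPart L k)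
    {f : DSpace L} (hf : f ∈ DPart L j) : T f ∈ DPart L k :=
  mem_of_sgl_mem L (N := (DPart L k).comap T) fun τ => h τ.1 τ.2 _ (hf τ)

theorem DPart_isInternal : DirectSum.IsInternal (DPart L) := by
  refine isInternal_of_isCompl ⟨?_, ?_⟩
  · rw [Submodule.disjoint_def]
    intro f h0 h1
    ext1 τ
    exact Submodule.disjoint_def.1 (isCompl_of_isInternal L.isClifford.internal).disjoint _
      (h0 τ) (h1 τ)
  · rw [codisjoint_iff, Submodule.eq_top_iff']
    intro f
    refine mem_of_sgl_mem L fun τ => ?_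
    obtain ⟨a, ha, b, hb, h⟩ := exists_components L.isClifford.internal (f τ)
    rw [h, map_add]
    exact Submodule.add_mem_sup (sgl_mem_DPart L _ ha) (sgl_mem_DPart L _ hb)

theorem DX_apply (k : Fin n) (f : DSpace L) (τ : P i) :
    DX L k f τ = L.X (τ.1⁻¹ k) (f τ) := by
  induction f using Finsupp.induction_linear with
  | zero => simp
  | add f g hf hg => simp [hf, hg]
  | single σ z =>
    classical
    rw [DX_single, Finsupp.single_apply, Finsupp.single_apply]
    split_ifs with h
    · rw [h]
    · simp

theorem DC_apply (k : Fin n) (f : DSpace L) (τ : P i) :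
    DC L k f τ = L.C (τ.1⁻¹ k) (f τ) := by
  induction f using Finsupp.induction_linear with
  | zero => simp
  | add f g hf hg => simp [hf, hg]
  | single σ z =>
    classical
    rw [DC_single, Finsupp.single_apply, Finsupp.single_apply]
    split_ifs with h
    · rw [h]
    · simp

theorem DX_DX_apply (k : Fin n) (f : DSpace L) (τ : P i) :
    DX L k (DX L k f) τ = q F (permute τ.1 i k) • f τ := by
  rw [DX_apply, DX_apply]
  exact LinearMap.congr_fun (L.isClifford.X_sq _) _

theorem IsClifford.xiOp_mem {V : Type*} [AddCommGroup V] [Module F V]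
    {X C : Fin n → Module.End F V} {part : ZMod 2 → Submodule F V} (h : IsClifford i X C part)
    (a b : Fin n) {k : ZMod 2} {v : V} (hv : v ∈ part k) : xiOp i X C a b v ∈ part k := by
  have hX : ∀ a, ∀ v ∈ part k, X a v ∈ part k := fun a v hv => by simpa using h.X_mem a k v hv
  have hC : ∀ v ∈ part k, C a (C b v) ∈ part k := fun v hv => by
    have := h.C_mem a _ _ (h.C_mem b k v hv)
    rwa [← add_assoc, show (1 : ZMod 2) + 1 = 0 by decide, zero_add] at this
  simp only [xiOp, mixer, LinearMap.neg_apply, LinearMap.smul_apply, LinearMap.add_apply,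
    Module.End.mul_apply, LinearMap.sub_apply]
  exact (part k).neg_mem ((part k).smul_mem _ ((part k).add_mem
    ((part k).add_mem (hX _ _ hv) (hX _ _ hv))
    (hC _ ((part k).sub_mem (hX _ _ hv) (hX _ _ hv)))))

/-- The operators by which the generators act on `D^i`. -/
def DGen : Gen n → Module.End F (DSpace L)
  | .s k => DS L k
  | .x k => DX L k
  | .c k => DC L k

variable {p : ℕ} [CharP F p] (hp : 3 ≤ p) (hi' : IsGoodOrbit p i)

theorem DX_mul_comm (a b : Fin n) : DX L a * DX L b = DX L b * DX L a := by
  refine DSpace.hom_ext L fun τ hτ z => ?_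
  have := LinearMap.congr_fun (L.isClifford.X_comm (τ⁻¹ a) (τ⁻¹ b)) z
  simp only [Module.End.mul_apply, DX_sgl] at this ⊢
  rw [this]

theorem DC_mul_self (a : Fin n) : DC L a * DC L a = 1 := by
  refine DSpace.hom_ext L fun τ hτ z => ?_
  have := LinearMap.congr_fun (L.isClifford.C_sq (τ⁻¹ a)) z
  simp only [Module.End.mul_apply, DC_sgl, Module.End.one_apply] at this ⊢
  rw [this]

theorem DC_mul_anti {a b : Fin n} (hab : a ≠ b) : DC L a * DC L b = -(DC L b * DC L a) := by
  refine DSpace.hom_ext L fun τ hτ z => ?_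
  have := LinearMap.congr_fun (L.isClifford.C_anti _ _ (inv_ne (τ := τ) hab)) z
  simp only [Module.End.mul_apply, DC_sgl, LinearMap.neg_apply] at this ⊢
  rw [this, map_neg]

theorem DX_mul_DC (a : Fin n) : DX L a * DC L a = -(DC L a * DX L a) := by
  refine DSpace.hom_ext L fun τ hτ z => ?_
  have := LinearMap.congr_fun (L.isClifford.XC (τ⁻¹ a)) z
  simp only [Module.End.mul_apply, DC_sgl, DX_sgl, LinearMap.neg_apply] at this ⊢
  rw [this, map_neg]

theorem DX_mul_DC_far {a b : Fin n} (hab : a ≠ b) : DX L a * DC L b = DC L b * DX L a := by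
  refine DSpace.hom_ext L fun τ hτ z => ?_
  have := LinearMap.congr_fun (L.isClifford.XC_far _ _ (inv_ne (τ := τ) hab)) z
  simp only [Module.End.mul_apply, DC_sgl, DX_sgl] at this ⊢
  rw [this]

include hp hi' in
theorem DGen_rel {x y : FreeAlgebra F (Gen n)} (h : Rel F n x y) :
    FreeAlgebra.lift F (DGen L) x = FreeAlgebra.lift F (DGen L) y := by
  cases h <;>
    simp only [freeS, freeX, freeC, map_mul, map_one, map_neg, map_sub, map_add,
      FreeAlgebra.lift_ι_apply, DGen]
  · exact DS_mul_self hp hi' _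
  · exact DS_mul_comm hp hi' ‹_›
  · exact DS_braid hp hi' ‹_›
  · exact DX_mul_comm L _ _
  · exact DC_mul_self L _
  · exact DC_mul_anti L ‹_›
  · exact DS_mul_DX hp hi' _
  · exact DS_mul_DX_far hp hi' _ ‹_› ‹_›
  · exact DS_mul_DC_lo hp hi' _
  · exact DS_mul_DC_hi hp hi' _
  · exact DS_mul_DC_far hp hi' _ ‹_› ‹_›
  · exact DX_mul_DC L _
  · exact DX_mul_DC_far L ‹_›

include hp hi' in
/-- The formulas define a module over the affine Hecke-Clifford algebra. -/
theorem exists_isDModule : ∃ M : SuperModule (HC.gr F (n := n)) (DSpace L), IsDModule L M := by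
  let act : HC F n →ₐ[F] Module.End F (DSpace L) :=
    RingQuot.liftAlgHom F ⟨FreeAlgebra.lift F (DGen L), fun _ _ h => DGen_rel L hp hi' h⟩
  have hact : ∀ g, act (HC.gen F g) = DGen L g := fun g => by
    simp [act, HC.gen]
  refine ⟨SuperModule.ofGen (gen := HC.gen F) (par := Gen.parity) (fun _ => rfl) act (DPart L)
    (DPart_isInternal L) ?_, rfl, fun k => hact _, fun k => hact _, fun k => hact _⟩
  intro g k v hv
  rw [hact]
  rcases g with a | a | a
  · refine map_DPart_mem L (fun τ _ z hz => ?_) hv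
    rw [DGen, DS_sgl L hp hi', Gen.parity, zero_add]
    exact (DPart L k).add_mem (sgl_mem_DPart L _ (L.isClifford.xiOp_mem _ _ hz))
      ((DPart L k).smul_mem _ (sgl_mem_DPart L _ hz))
  · refine map_DPart_mem L (fun τ _ z hz => ?_) hv
    rw [DGen, DX_sgl]
    exact sgl_mem_DPart L _ (L.isClifford.X_mem _ _ _ hz)
  · refine map_DPart_mem L (fun τ _ z hz => ?_) hv
    rw [DGen, DC_sgl]
    exact sgl_mem_DPart L _ (L.isClifford.C_mem _ _ _ hz)

variable {L} {M : SuperModule (HC.gr F (n := n)) (DSpace L)} (hM : IsDModule L M)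

-- Distinct weights let a nonzero graded submodule be cut down to one summand, irreducibility of
-- `L(i)` fills that summand, and the nonzero `Ω` along admissible steps reach all others.
include hp hi' hM in
theorem IsDModule.irreducible : M.Irreducible := by
  classical
  have : Fintype (P i) := Fintype.ofFinite _
  have hnt : Nontrivial (DSpace L) := by
    have : Nonempty (P i) := ⟨⟨1, .one⟩⟩
    infer_instance
  refine ⟨hnt, fun N hN hgr => or_iff_not_imp_left.2 fun hbot => ?_⟩
  have hX : ∀ k, ∀ v ∈ N, DX L k v ∈ N := fun k v hv => hM.act_x k ▸ hN _ v hv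
  have hC : ∀ k, ∀ v ∈ N, DC L k v ∈ N := fun k v hv => hM.act_c k ▸ hN _ v hv
  have hS : ∀ k, ∀ v ∈ N, DS L k v ∈ N := fun k v hv => hM.act_s k ▸ hN _ v hv
  obtain ⟨v, hv, hv0⟩ := Submodule.exists_mem_ne_zero_of_ne_bot hbot
  obtain ⟨τ, hτ⟩ := Finsupp.ne_iff.1 hv0
  -- For `σ ≠ τ` some `x_k ^ 2` has different eigenvalues on the two summands. A normalized linear
  -- polynomial in it kills the summand at `σ` and fixes the one at `τ`.
  have hsep : ∀ s : Finset (P i), τ ∉ s → ∃ w ∈ N, w τ = v τ ∧ ∀ σ ∈ s, w σ = 0 := by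
    intro s
    induction s using Finset.induction_on with
    | empty => exact fun _ => ⟨v, hv, rfl, by simp⟩
    | insert σ s hσ ih =>
      intro hs
      rw [Finset.mem_insert, not_or] at hs
      obtain ⟨w, hw, hwτ, hw0⟩ := ih hs.2
      obtain ⟨k, hk⟩ : ∃ k, permute τ.1 i k ≠ permute σ.1 i k := by
        by_contra! h
        exact hs.1 (Subtype.ext (hi'.inj _ _ τ.2 σ.2 (funext h)))
      have hq : q F (permute τ.1 i k) - q F (permute σ.1 i k) ≠ 0 := hi'.q_sub_ne_zero hk
      refine ⟨(q F (permute τ.1 i k) - q F (permute σ.1 i k))⁻¹ •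
        (DX L k (DX L k w) - q F (permute σ.1 i k) • w), N.smul_mem _ (N.sub_mem
          (hX _ _ (hX _ _ hw)) (N.smul_mem _ hw)), ?_, fun ρ hρ => ?_⟩
      · rw [Finsupp.smul_apply, Finsupp.sub_apply, Finsupp.smul_apply, DX_DX_apply, ← sub_smul,
          smul_smul, inv_mul_cancel₀ hq, one_smul, hwτ]
      · rw [Finsupp.smul_apply, Finsupp.sub_apply, Finsupp.smul_apply, DX_DX_apply, ← sub_smul]
        rcases Finset.mem_insert.1 hρ with rfl | hρ
        · simp
        · simp [hw0 ρ hρ]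
  obtain ⟨w, hw, hwτ, hw0⟩ := hsep (Finset.univ.erase τ) (by simp)
  have hw' : w = sgl L τ.1 (v τ) := by
    rw [sgl_of_mem L τ.2]
    ext1 σ
    by_cases h : σ = τ
    · subst h; simp [hwτ]
    · rw [hw0 σ (by simp [h]), Finsupp.single_eq_of_ne h]
  have htop : N.comap (sgl L τ.1) = ⊤ := by
    refine (L.eq_bot_or_eq_top (fun a z hz => ?_) (fun a z hz => ?_) fun z hz => ?_).resolve_left
      fun h => hτ ?_
    · have := hX (τ.1 a) _ hz
      rwa [DX_sgl, show τ.1⁻¹ (τ.1 a) = a by simp] at this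
    · have := hC (τ.1 a) _ hz
      rwa [DC_sgl, show τ.1⁻¹ (τ.1 a) = a by simp] at this
    · obtain ⟨v₀, h0, v₁, h1, h⟩ := hgr _ hz
      rw [hM.part_eq] at h0 h1
      -- Homogeneous components of a vector supported at `τ` are again supported at `τ`, which makes
      -- the trace of `N` on this summand graded.
      have hcomp : ∀ σ, σ ≠ τ → v₀ σ = 0 ∧ v₁ σ = 0 := fun σ hσ => by
        refine components_eq_zero L.isClifford.internal (h0.2 σ)
          (by rw [add_zero]; exact h1.2 σ) ?_
        rw [← Finsupp.add_apply, ← h, sgl_of_mem L τ.2, Finsupp.single_eq_of_ne hσ]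
      have e0 : sgl L τ.1 (v₀ τ) = v₀ := by
        rw [sgl_of_mem L τ.2]
        ext1 σ
        by_cases h : σ = τ
        · subst h; simp
        · rw [(hcomp σ h).1, Finsupp.single_eq_of_ne h]
      have e1 : sgl L τ.1 (v₁ τ) = v₁ := by
        rw [sgl_of_mem L τ.2]
        ext1 σ
        by_cases h : σ = τ
        · subst h; simp
        · rw [(hcomp σ h).2, Finsupp.single_eq_of_ne h]
      refine ⟨v₀ τ, ⟨?_, h0.2 τ⟩, v₁ τ, ⟨?_, h1.2 τ⟩, ?_⟩
      · change sgl L τ.1 (v₀ τ) ∈ N; rw [e0]; exact h0.1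
      · change sgl L τ.1 (v₁ τ) ∈ N; rw [e1]; exact h1.1
      · rw [← Finsupp.add_apply, ← h, sgl_of_mem L τ.2, Finsupp.single_eq_same]
    · have : v τ ∈ N.comap (sgl L τ.1) := by rw [Submodule.mem_comap, ← hw']; exact hw
      rw [h] at this
      exact this
  have hstep : ∀ (σ) (k : Fin (n - 1)), IsAdmissibleProduct i σ → Admissible (permute σ i) k →
      N.comap (sgl L σ) = ⊤ → N.comap (sgl L (simple k * σ)) = ⊤ := by
    intro σ k hσ hk h
    rw [Submodule.eq_top_iff'] at h ⊢
    intro z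
    have h1 := N.sub_mem (hS k _ (h z)) (h (xiOp i L.X L.C (σ⁻¹ (lo k)) (σ⁻¹ (hi k)) z))
    rw [DS_sgl L hp hi', add_sub_cancel_left] at h1
    exact (N.smul_mem_iff (omegaPair_ne_zero_of_admissible hp (hi'.good σ hσ) hk)).1 h1
  -- The admissible word of `τ` is undone one letter at a time, since admissibility of a step and of
  -- its reverse are equivalent.
  have hone : N.comap (sgl L 1) = ⊤ := by
    obtain ⟨τ, hτ'⟩ := τ
    clear hτ hsep hwτ hw0 hw'
    induction hτ' with
    | one => exact htop
    | step σ k hσ hk ih =>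
      apply ih
      have := hstep _ k (.step σ k hσ hk) ((admissible_simple_mul_iff k σ i).2 hk) htop
      rwa [simple_simple_mul] at this
  have hall : ∀ σ, IsAdmissibleProduct i σ → N.comap (sgl L σ) = ⊤ := by
    intro σ hσ
    induction hσ with
    | one => exact hone
    | step σ k hσ hk ih => exact hstep _ _ hσ hk ih
  rw [Submodule.eq_top_iff']
  intro f
  refine mem_of_sgl_mem L fun σ => ?_
  have : f σ ∈ N.comap (sgl L σ.1) := by rw [hall σ.1 σ.2]; trivial
  exact this

end DMod

/-! ### Change of the base weight, and homomorphisms between the modules `D^i`. -/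

theorem IsAdmissibleProduct.inv {n : ℕ} {i : Fin n → ℕ} {τ : Equiv.Perm (Fin n)}
    (h : IsAdmissibleProduct i τ) : IsAdmissibleProduct (permute τ i) τ⁻¹ := by
  induction h with
  | one => exact .one
  | step τ k hτ hk ih =>
    have e : simple k * (simple k * τ) = τ := simple_simple_mul k τ
    have h1 : IsAdmissibleProduct (permute (simple k * τ) i) (simple k * 1) :=
      .step 1 k .one ((admissible_simple_mul_iff k τ i).2 hk)
    rw [mul_one] at h1
    have h2 := IsAdmissibleProduct.mul (σ := τ⁻¹) (by rwa [permute_permute, e]) h1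
    rwa [mul_inv_rev, show (simple k)⁻¹ = simple k from inv_eq_of_mul_eq_one_left
      (simple_mul_self k)]

/-- Paths of admissible steps can be concatenated and reversed. So right translation by `τ`
identifies `P_{τ · i}` with `P_i`, which makes `extend` a matching of summands of equal weight. -/
theorem isAdmissibleProduct_mul_iff {n : ℕ} {i : Fin n → ℕ} {σ τ : Equiv.Perm (Fin n)}
    (hτ : IsAdmissibleProduct i τ) :
    IsAdmissibleProduct (permute τ i) σ ↔ IsAdmissibleProduct i (σ * τ) := by
  refine ⟨fun h => h.mul hτ, fun h => ?_⟩
  have := IsAdmissibleProduct.mul (τ := τ⁻¹) (i := permute τ i) (σ := σ * τ)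
    (by rwa [permute_permute, inv_mul_cancel, permute_one]) hτ.inv
  rwa [mul_inv_cancel_right] at this

section Extend

variable {F : Type*} [Field F] [IsAlgClosed F] {n : ℕ} {i j : Fin n → ℕ} (L : Component F i)
  (L' : Component F j)

/-- The map `z ^ σ ↦ (φ z) ^ (σ τ)`. -/
def extend (τ : Equiv.Perm (Fin n)) (φ : L'.Space →ₗ[F] L.Space) : DSpace L' →ₗ[F] DSpace L :=
  Finsupp.lsum F fun σ : P j => sgl L (σ.1 * τ) ∘ₗ φ

variable {L L'} {τ : Equiv.Perm (Fin n)}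

theorem extend_sgl (hτ : IsAdmissibleProduct i τ) (hij : permute τ i = j)
    (φ : L'.Space →ₗ[F] L.Space) (σ : Equiv.Perm (Fin n)) (z : L'.Space) :
    extend L L' τ φ (sgl L' σ z) = sgl L (σ * τ) (φ z) := by
  by_cases h : IsAdmissibleProduct j σ
  · rw [sgl_of_mem L' h, extend, Finsupp.lsum_single]; rfl
  · rw [sgl_of_notMem L' h, map_zero, sgl_of_notMem L]
    rwa [← isAdmissibleProduct_mul_iff hτ, hij]

variable {p : ℕ} [CharP F p] (hp : 3 ≤ p) (hi : IsGoodOrbit p i) (hj : IsGoodOrbit p j)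
  {M : SuperModule (HC.gr F (n := n)) (DSpace L)} (hM : IsDModule L M)
  {N : SuperModule (HC.gr F (n := n)) (DSpace L')} (hN : IsDModule L' N)

theorem neg_one_pow_mul_neg_one_pow (l : ℕ) : ((-1 : F) ^ l) * (-1) ^ l = 1 := by
  rw [← pow_add, ← two_mul, pow_mul, neg_one_sq, one_pow]

-- The formula `DS_sgl` depends only on residues and on the operators at the positions concerned. A
-- map respecting the `x_a` and, up to sign, the `c_a` respects `Ξ`, since the `c`'s enter there in
-- pairs.
include hp hi hj hM hN in
theorem extend_mem_homOfParity (hτ : IsAdmissibleProduct i τ) (hij : permute τ i = j)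
    {φ : L'.Space →ₗ[F] L.Space} {l : ZMod 2}
    (h1 : ∀ k, ∀ v ∈ L'.part k, φ v ∈ L.part (k + l))
    (h2 : ∀ a v, φ (L'.X a v) = L.X (τ⁻¹ a) (φ v))
    (h3 : ∀ a v, φ (L'.C a v) = (-1 : F) ^ l.val • L.C (τ⁻¹ a) (φ v)) :
    extend L L' τ φ ∈ SuperModule.homOfParity N M l := by
  have hC : ∀ a b v, φ (L'.C a (L'.C b v)) = L.C (τ⁻¹ a) (L.C (τ⁻¹ b) (φ v)) := fun a b v => by
    rw [h3, h3, map_smul, smul_smul, neg_one_pow_mul_neg_one_pow, one_smul]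
  have hxi : ∀ a b v, φ (xiOp j L'.X L'.C a b v) =
      xiOp i L.X L.C (τ⁻¹ a) (τ⁻¹ b) (φ v) := fun a b v => by
    subst hij
    simp only [xiOp, mixer, LinearMap.neg_apply, LinearMap.smul_apply, LinearMap.add_apply,
      Module.End.mul_apply, LinearMap.sub_apply, map_neg, map_smul, map_add, map_sub, h2, hC,
      permute_apply]
  refine mem_homOfParity_of_gen (gen := HC.gen F) (par := Gen.parity) (fun _ => rfl)
    (fun k v hv => ?_) fun g => ?_
  · rw [hN.part_eq] at hv
    rw [hM.part_eq]
    refine mem_of_sgl_mem L' (N := (DPart L (k + l)).comap (extend L L' τ φ)) fun σ => ?_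
    change extend L L' τ φ (sgl L' σ.1 (v σ)) ∈ DPart L (k + l)
    rw [extend_sgl hτ hij]
    exact sgl_mem_DPart L _ (h1 k _ (hv σ))
  · rcases g with a | a | a
    · rw [hN.act_s, hM.act_s]
      refine LinearMap.congr_fun (f := extend L L' τ φ ∘ₗ DS L' a)
        (g := (-1 : F) ^ (l.val * (Gen.parity (Gen.s a)).val) • (DS L a ∘ₗ extend L L' τ φ)) ?_
      refine DSpace.hom_ext L' fun σ _ z => ?_
      subst hij
      simp only [LinearMap.comp_apply, LinearMap.smul_apply, DS_sgl L' hp hj, map_add, map_smul,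
        extend_sgl hτ rfl, DS_sgl L hp hi, hxi, Gen.parity, ZMod.val_zero, mul_zero, pow_zero,
        one_smul, mul_inv_rev, Equiv.Perm.mul_apply, permute_apply, mul_assoc]
    · rw [hN.act_x, hM.act_x]
      refine LinearMap.congr_fun (f := extend L L' τ φ ∘ₗ DX L' a)
        (g := (-1 : F) ^ (l.val * (Gen.parity (Gen.x a)).val) • (DX L a ∘ₗ extend L L' τ φ)) ?_
      refine DSpace.hom_ext L' fun σ _ z => ?_
      simp only [LinearMap.comp_apply, LinearMap.smul_apply, DX_sgl, extend_sgl hτ hij, h2,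
        Gen.parity, ZMod.val_zero, mul_zero, pow_zero, one_smul, mul_inv_rev,
        Equiv.Perm.mul_apply]
    · rw [hN.act_c, hM.act_c]
      refine LinearMap.congr_fun (f := extend L L' τ φ ∘ₗ DC L' a)
        (g := (-1 : F) ^ (l.val * (Gen.parity (Gen.c a)).val) • (DC L a ∘ₗ extend L L' τ φ)) ?_
      refine DSpace.hom_ext L' fun σ _ z => ?_
      simp only [LinearMap.comp_apply, LinearMap.smul_apply, DC_sgl, extend_sgl hτ hij, h3,
        Gen.parity, ZMod.val_one, mul_one, mul_inv_rev, Equiv.Perm.mul_apply, map_smul]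

theorem extend_ne_zero (hτ : IsAdmissibleProduct i τ) (hij : permute τ i = j)
    {φ : L'.Space →ₗ[F] L.Space} (h : φ ≠ 0) : extend L L' τ φ ≠ 0 := by
  obtain ⟨z, hz⟩ : ∃ z, φ z ≠ 0 := by
    by_contra! h'
    exact h (LinearMap.ext h')
  intro h0
  have := extend_sgl hτ hij φ 1 z
  rw [h0, LinearMap.zero_apply, one_mul, sgl_of_mem L hτ] at this
  exact hz (Finsupp.single_eq_zero.1 this.symm)

include hM hN in
theorem homOfParity_apply_DX {l : ZMod 2} {f : DSpace L →ₗ[F] DSpace L'}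
    (hf : f ∈ SuperModule.homOfParity M N l) (k : Fin n) (v : DSpace L) :
    f (DX L k v) = DX L' k (f v) := by
  have := hf.2 _ _ (gen_mem_gr (gr := HC.gr F (n := n)) (gen := HC.gen F) (par := Gen.parity)
    (fun _ => rfl) (Gen.x k)) v
  simpa [hM.act_x, hN.act_x, Gen.parity] using this

include hM hN in
theorem homOfParity_apply_DC {l : ZMod 2} {f : DSpace L →ₗ[F] DSpace L'}
    (hf : f ∈ SuperModule.homOfParity M N l) (k : Fin n) (v : DSpace L) :
    f (DC L k v) = (-1 : F) ^ l.val • DC L' k (f v) := by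
  have := hf.2 _ _ (gen_mem_gr (gr := HC.gr F (n := n)) (gen := HC.gen F) (par := Gen.parity)
    (fun _ => rfl) (Gen.c k)) v
  simpa [hM.act_c, hN.act_c, Gen.parity, ZMod.val_one] using this

-- Homomorphisms commute with every `x_k ^ 2`, and `q` separates the residues in range.
include hi hj hM hN in
theorem eq_permute_of_homOfParity {l : ZMod 2} {f : DSpace L →ₗ[F] DSpace L'}
    (hf : f ∈ SuperModule.homOfParity M N l) {z : L.Space} {τ : P j}
    (h : f (sgl L 1 z) τ ≠ 0) : i = permute τ.1 j := by
  funext k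
  have h1 : DX L k (DX L k (sgl L 1 z)) = q F (i k) • sgl L 1 z := by
    rw [sgl_of_mem L .one]
    ext1 σ
    rw [DX_DX_apply, Finsupp.smul_apply]
    by_cases hσ : σ = ⟨1, .one⟩
    · subst hσ; rw [permute_one]
    · rw [Finsupp.single_eq_of_ne hσ, smul_zero, smul_zero]
  have h2 := congrArg f h1
  rw [homOfParity_apply_DX hM hN hf, homOfParity_apply_DX hM hN hf, map_smul] at h2
  have h3 := DFunLike.congr_fun h2 τ
  rw [DX_DX_apply, Finsupp.smul_apply] at h3
  exact (q_injective p (hj.le _) (hi.le _) (smul_left_injective F h h3)).symm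

end Extend

/-! ### Isomorphism, type, dimension and eigenvalues. -/

section Consequences

variable {F : Type*} [Field F] [IsAlgClosed F] {n : ℕ} {i j : Fin n → ℕ} {L : Component F i}
  {L' : Component F j} {p : ℕ} [CharP F p] (hp : 3 ≤ p) (hi : IsGoodOrbit p i)
  (hj : IsGoodOrbit p j)
  {M : SuperModule (HC.gr F (n := n)) (DSpace L)} (hM : IsDModule L M)
  {N : SuperModule (HC.gr F (n := n)) (DSpace L')} (hN : IsDModule L' N)

include hi hj hM hN in
theorem IsDModule.exists_of_isomorphic (h : M.Isomorphic N) :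
    ∃ τ, IsAdmissibleProduct j τ ∧ i = permute τ j := by
  obtain ⟨f, hf, hb⟩ := h
  obtain ⟨z, hz⟩ := exists_ne (0 : L.Space)
  have hz' : sgl L 1 z ≠ 0 := by
    rw [sgl_of_mem L .one]; simpa using hz
  obtain ⟨g, hg, h, hh, rfl⟩ := Submodule.mem_sup.1 hf
  have hz2 : (g + h) (sgl L 1 z) ≠ 0 := fun e => hz' (hb.1 (by rw [e, map_zero]))
  obtain ⟨τ, hτ⟩ := Finsupp.ne_iff.1 hz2
  by_cases e : g (sgl L 1 z) τ = 0
  · refine ⟨τ.1, τ.2, eq_permute_of_homOfParity hi hj hM hN hh (z := z) fun e' => hτ ?_⟩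
    rw [LinearMap.add_apply, Finsupp.add_apply, e, e', add_zero]; rfl
  · exact ⟨τ.1, τ.2, eq_permute_of_homOfParity hi hj hM hN hg e⟩

-- A nonzero homomorphism of components of matching weight extends to the whole modules, and Schur's
-- lemma makes it bijective. The inverse of `τ` occurs because the extension goes from `M` to `N`.
include hp hi hj hM hN in
theorem IsDModule.isomorphic {τ : Equiv.Perm (Fin n)} (hτ : IsAdmissibleProduct i τ)
    (hij : permute τ i = j) : M.Isomorphic N := by
  have hτ' : IsAdmissibleProduct j τ⁻¹ := hij ▸ hτ.inv
  have hji : permute τ⁻¹ j = i := by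
    rw [← hij, permute_permute, inv_mul_cancel, permute_one]
  obtain ⟨l, φ, h0, h1, h2, h3⟩ := exists_hom_ne_zero (two_ne_zero_of_char p hp)
    (fun a h => q_ne_zero p hp (hi.le a) h) L' L hji
  have hf := extend_mem_homOfParity hp hj hi hN hM hτ' hji h1 h2 h3
  have hf0 := extend_ne_zero hτ' hji h0
  refine ⟨_, ?_, SuperModule.injective_of_irreducible HC.even_odd (hM.irreducible hp hi) hf hf0,
    SuperModule.surjective_of_irreducible HC.even_odd (hN.irreducible hp hj) hf hf0⟩
  obtain rfl | rfl := eq_zero_or_one l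
  · exact le_sup_left (a := SuperModule.homOfParity M N 0) hf
  · exact le_sup_right (b := SuperModule.homOfParity M N 1) hf

-- An odd endomorphism maps the summand at `1` to itself, because no other summand has the weight
-- `i`; conversely an odd endomorphism of `L(i)` extends.
include hp hi hM in
theorem IsDModule.odd_eq_bot_iff : SuperModule.homOfParity M M 1 = ⊥ ↔
    SuperModule.homOfParity L.isClifford.toSuper L.isClifford.toSuper 1 = ⊥ := by
  rw [← not_iff_not]
  constructor
  · intro h
    obtain ⟨f, hf, h0⟩ := Submodule.exists_mem_ne_zero_of_ne_bot h
    obtain ⟨z, hz⟩ := exists_ne (0 : L.Space)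
    have hz' : sgl L 1 z ≠ 0 := by
      rw [sgl_of_mem L .one]; simpa using hz
    have hz2 : f (sgl L 1 z) ≠ 0 := fun e => hz'
      (SuperModule.injective_of_irreducible HC.even_odd (hM.irreducible hp hi) hf h0
        (by rw [e, map_zero]))
    obtain ⟨τ, hτ⟩ := Finsupp.ne_iff.1 hz2
    have hτ1 : τ = ⟨1, .one⟩ := Subtype.ext (hi.inj _ _ τ.2 .one
      (eq_permute_of_homOfParity hi hi hM hM hf hτ).symm)
    let φ : L.Space →ₗ[F] L.Space := Finsupp.lapply ⟨1, .one⟩ ∘ₗ f ∘ₗ sgl L 1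
    have hφ : ∀ z, φ z = f (sgl L 1 z) ⟨1, .one⟩ := fun _ => rfl
    refine Submodule.ne_bot_iff _ |>.2 ⟨φ, ?_, fun e => hτ ?_⟩
    · rw [IsClifford.mem_homOfParity_iff]
      refine ⟨fun k v hv => ?_, fun a v => ?_, fun a v => ?_⟩
      · have := hf.1 k (sgl L 1 v) (by rw [hM.part_eq]; exact sgl_mem_DPart L _ hv)
        rw [hM.part_eq] at this
        exact this _
      · have := DX_sgl L a 1 v
        rw [inv_one, Equiv.Perm.one_apply] at this
        rw [hφ, ← this, homOfParity_apply_DX hM hM hf, DX_apply]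
        rfl
      · have := DC_sgl L a 1 v
        rw [inv_one, Equiv.Perm.one_apply] at this
        rw [hφ, ← this, homOfParity_apply_DC hM hM hf, Finsupp.smul_apply, DC_apply]
        rfl
    · rw [hτ1, ← hφ, e]; rfl
  · intro h
    obtain ⟨φ, hφ, h0⟩ := Submodule.exists_mem_ne_zero_of_ne_bot h
    rw [IsClifford.mem_homOfParity_iff] at hφ
    exact Submodule.ne_bot_iff _ |>.2 ⟨_, extend_mem_homOfParity hp hi hi hM hM .one
      (permute_one i) hφ.1 (fun a v => hφ.2.1 a v) (fun a v => hφ.2.2 a v),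
      extend_ne_zero .one (permute_one i) h0⟩

include hp hi hM in
theorem IsDModule.type : (Even (Fintype.card {a // i a = 0}) → M.IsTypeM) ∧
    (Odd (Fintype.card {a // i a = 0}) → M.IsTypeQ) := by
  have hirr := hM.irreducible hp hi
  have h := (Component.finrank_and_odd (two_ne_zero_of_char p hp)
    (fun a h => q_ne_zero p hp (hi.le a) h) L).2
  rw [← hM.odd_eq_bot_iff hp hi] at h
  rcases SuperModule.finrank_hom_self HC.even_odd hirr with ⟨h0, h1⟩ | ⟨h0, h1⟩
  · exact ⟨fun _ => ⟨hirr, h1⟩, fun h' => absurd (h.1 h0) (Nat.not_even_iff_odd.2 h')⟩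
  · exact ⟨fun h' => absurd (h.2 h') h0, fun _ => ⟨hirr, h1⟩⟩

include hp hi in
theorem finrank_DSpace (L : Component F i) : Module.finrank F (DSpace L) =
    2 ^ (n - Fintype.card {a // i a = 0} / 2) * Nat.card (P i) := by
  classical
  have : Fintype (P i) := Fintype.ofFinite _
  rw [← (Component.finrank_and_odd (two_ne_zero_of_char p hp)
    (fun a h => q_ne_zero p hp (hi.le a) h) L).1, Nat.card_eq_fintype_card,
    mul_comm]
  have e := (Finsupp.linearEquivFunOnFinite F L.Space (P i)).finrank_eq
  rw [e, Module.finrank_pi_fintype, Finset.sum_const, Finset.card_univ, smul_eq_mul]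

theorem incl_X_apply (a : Fin n) (z : L.Space) (ε : Fin n → ZMod 2) :
    L.incl (L.X a z) ε = (-1) ^ (ε a).val * root (q F (i a)) * L.incl z ε := rfl

/-- In the coordinates `e_ε` of each summand `x_k` is diagonal, so a polynomial in `x_k` acts by its
values. -/
theorem incl_aeval_DX (k : Fin n) (f : DSpace L) (τ : P i) (ε : Fin n → ZMod 2)
    (P : Polynomial F) : L.incl (Polynomial.aeval (DX L k) P f τ) ε =
      P.eval ((-1) ^ (ε (τ.1⁻¹ k)).val * root (q F (i (τ.1⁻¹ k)))) * L.incl (f τ) ε := by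
  induction P using Polynomial.induction_on' with
  | add P Q hP hQ => simp [hP, hQ, add_mul]
  | monomial m r =>
    rw [Polynomial.aeval_monomial, Polynomial.eval_monomial, Module.End.mul_apply,
      Module.algebraMap_end_apply, Finsupp.smul_apply, map_smul, Pi.smul_apply, smul_eq_mul,
      mul_assoc]
    congr 1
    induction m generalizing f with
    | zero => simp
    | succ m ih =>
      rw [pow_succ, Module.End.mul_apply, ih, DX_apply, incl_X_apply, pow_succ]
      simp only [mul_assoc]

include hM in
theorem IsDModule.completelySplittable : CompletelySplittable M := by
  classical
  intro k
  rw [hM.act_x]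
  let S : Finset F := (Finset.univ : Finset (Fin n × ZMod 2)).image
    fun a => (-1) ^ a.2.val * root (q F (i a.1))
  -- The product runs over the finite set of possible eigenvalues, each taken once, so it stays
  -- squarefree when some of them coincide, as at residue `0`.
  refine Module.End.isSemisimple_of_squarefree_aeval_eq_zero
    (p := ∏ r ∈ S, (Polynomial.X - Polynomial.C r)) ?_ ?_
  · exact (Polynomial.separable_prod_X_sub_C_iff'.2
      fun x _ y _ h => h).squarefree
  · refine LinearMap.ext fun f => Finsupp.ext fun τ => ?_
    apply L.incl_injective
    funext ε
    rw [incl_aeval_DX, Polynomial.eval_prod, Finset.prod_eq_zero (i := (-1) ^ (ε (τ.1⁻¹ k)).val *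
      root (q F (i (τ.1⁻¹ k)))), zero_mul]
    · simp
    · exact Finset.mem_image.2 ⟨(τ.1⁻¹ k, ε (τ.1⁻¹ k)), Finset.mem_univ _, rfl⟩
    · simp

include hi hM in
theorem IsDModule.isIntegral : IsIntegral p M := by
  refine ⟨inferInstance, fun k a ha => ?_⟩
  rw [hM.act_x] at ha
  obtain ⟨f, hf⟩ := ha.exists_hasEigenvector
  obtain ⟨τ, hτ⟩ := Finsupp.ne_iff.1 hf.2
  have h := DFunLike.congr_fun hf.apply_eq_smul τ
  rw [pow_two, Module.End.mul_apply, DX_DX_apply, Finsupp.smul_apply] at h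
  have hle := (hi.good τ.1 τ.2).le k
  exact ⟨permute τ.1 i k, by omega, (smul_left_injective F hτ h).symm⟩

end Consequences

/-! ## Heaps and their linear extensions -/

open Relation

/-- A heap of type `A` with contents bounded by `(p - 1) / 2`, subject to a local condition on
consecutive boxes on a diagonal. -/
structure IsHeap (p : ℕ) {B : Type*} (r : B → B → Prop) (c : B → ℕ) : Prop where
  bound : ∀ A, 2 * c A + 1 ≤ p
  adj : ∀ A B, r A B → c A = c B + 1 ∨ c B = c A + 1
  comp : ∀ A B, A ≠ B → (c A = c B ∨ c A = c B + 1 ∨ c B = c A + 1) →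
    TransGen r A B ∨ TransGen r B A
  triple : ∀ A B C, r A B → r B C → c A = c C →
    (∃ B', B' ≠ B ∧ TransGen r A B' ∧ TransGen r B' C) ∨ (c A = 0 ∧ c B = 1) ∨
      (2 * c A + 3 = p ∧ 2 * c B + 1 = p)

/-- Labelings that increase along the relation. -/
def IsLinExt {B : Type*} (r : B → B → Prop) {n : ℕ} (T : Fin n ≃ B) : Prop :=
  ∀ A B, r A B → T.symm A < T.symm B

namespace IsLinExt

variable {B : Type*} {r : B → B → Prop} {n : ℕ} {T : Fin n ≃ B}

theorem lt (hT : IsLinExt r T) {X Y : B} (h : TransGen r X Y) : T.symm X < T.symm Y := by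
  induction h with
  | single h => exact hT _ _ h
  | tail _ h ih => exact ih.trans (hT _ _ h)

theorem lt' (hT : IsLinExt r T) {a b : Fin n} (h : TransGen r (T a) (T b)) : a < b := by
  simpa using hT.lt h

/-- An intermediate box would need a label strictly between two consecutive ones. -/
theorem rel_of_consecutive (hT : IsLinExt r T) {a b : Fin n} (hab : a.val + 1 = b.val)
    (h : TransGen r (T a) (T b)) : r (T a) (T b) := by
  rcases TransGen.tail'_iff.1 h with ⟨C, h1, h2⟩
  rcases reflTransGen_iff_eq_or_transGen.1 h1 with rfl | h1
  · exact h2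
  · have e1 := hT.lt h1
    have e2 := hT _ _ h2
    rw [Equiv.symm_apply_apply, Fin.lt_def] at e1 e2
    omega

end IsLinExt

/-- The labeling `T ∘ τ⁻¹`. -/
def relabel {B : Type*} {n : ℕ} (τ : Equiv.Perm (Fin n)) (T : Fin n ≃ B) : Fin n ≃ B :=
  (τ⁻¹ : Fin n ≃ Fin n).trans T

section Heap

variable {p : ℕ} {B : Type*} {r : B → B → Prop} {c : B → ℕ} {n : ℕ} {T T' : Fin n ≃ B}

theorem relabel_apply (τ : Equiv.Perm (Fin n)) (a : Fin n) : relabel τ T a = T (τ⁻¹ a) := rfl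

theorem relabel_symm_apply (τ : Equiv.Perm (Fin n)) (X : B) :
    (relabel τ T).symm X = τ (T.symm X) := rfl

theorem relabel_relabel (σ τ : Equiv.Perm (Fin n)) :
    relabel σ (relabel τ T) = relabel (σ * τ) T := by
  ext a; simp [relabel_apply]

theorem relabel_one : relabel 1 T = T := by ext a; simp [relabel_apply]

theorem relabel_injective {σ τ : Equiv.Perm (Fin n)} (h : relabel σ T = relabel τ T) : σ = τ := by
  ext1 a
  have := congrArg (fun S : Fin n ≃ B => S.symm (T a)) h
  simpa [relabel_symm_apply] using this

theorem comp_relabel (τ : Equiv.Perm (Fin n)) : c ∘ relabel τ T = permute τ (c ∘ T) := rfl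

namespace IsHeap

variable (H : IsHeap p r c)

include H in
theorem rel_of_near (hT : IsLinExt r T) (k : Fin (n - 1))
    (h : c (T (lo k)) = c (T (hi k)) ∨ c (T (lo k)) = c (T (hi k)) + 1 ∨
      c (T (hi k)) = c (T (lo k)) + 1) : r (T (lo k)) (T (hi k)) := by
  refine hT.rel_of_consecutive rfl
    ((H.comp _ _ (fun e => lo_ne_hi k (T.injective e)) h).resolve_right fun h' => ?_)
  have := hT.lt' h'
  rw [Fin.lt_def] at this
  simp [lo, hi] at this

-- Only a covering pair in the two swapped positions could be put out of order, but its contents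
-- differ by one, contrary to admissibility.
include H in
theorem relabel_simple (hT : IsLinExt r T) {k : Fin (n - 1)} (hk : Admissible (c ∘ T) k) :
    IsLinExt r (relabel (simple k) T) := by
  intro X Y hXY
  rw [relabel_symm_apply, relabel_symm_apply]
  have h := hT X Y hXY
  have hne : ¬ (T.symm X = lo k ∧ T.symm Y = hi k) := by
    rintro ⟨hX, hY⟩
    have := H.adj _ _ hXY
    rw [Equiv.symm_apply_eq] at hX hY
    subst hX hY
    unfold Admissible at hk
    simp only [Function.comp_apply] at hk
    tauto
  generalize T.symm X = a at *
  generalize T.symm Y = b at *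
  have hv : ∀ x : Fin n, (simple k x).val =
      if x.val = k.val then k.val + 1 else if x.val = k.val + 1 then k.val else x.val := fun x => by
    simp only [simple, Equiv.swap_apply_def, lo, hi, Fin.ext_iff]
    split_ifs <;> rfl
  simp only [lo, hi, Fin.ext_iff] at hne
  rw [Fin.lt_def] at h ⊢
  rw [hv, hv]
  split_ifs <;> omega

include H in
theorem relabel_isLinExt (hT : IsLinExt r T) {τ : Equiv.Perm (Fin n)}
    (hτ : IsAdmissibleProduct (c ∘ T) τ) : IsLinExt r (relabel τ T) := by
  induction hτ with
  | one => rwa [relabel_one]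
  | step τ k _ hk ih =>
    rw [← relabel_relabel]
    exact H.relabel_simple ih hk

end IsHeap

/-- A bijection without descents is the identity. -/
theorem eq_one_of_no_descent (σ : Equiv.Perm (Fin n)) (h : ∀ k, σ (lo k) < σ (hi k)) : σ = 1 := by
  have hmono : StrictMono σ := by
    cases n with
    | zero => exact fun a => a.elim0
    | succ m => exact Fin.strictMono_iff_lt_succ.2 fun a => h a
  let e : Fin n ≃o Fin n := hmono.orderIsoOfSurjective _ σ.surjective
  have : e = OrderIso.refl _ := Subsingleton.elim _ _
  ext1 a
  exact DFunLike.congr_fun this a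

/-- This is the termination measure of the sorting argument. The weights of adjacent positions
differ by one, so removing a descent lowers the sum by its size. -/
theorem sum_lt_of_descent (σ : Equiv.Perm (Fin n)) {k : Fin (n - 1)} (h : σ (hi k) < σ (lo k)) :
    ∑ a : Fin n, (n - a.val) * (σ (simple k a)).val < ∑ a : Fin n, (n - a.val) * (σ a).val := by
  have key : ∀ f : Fin n → ℕ, ∑ a, f a = f (lo k) + (f (hi k) +
      ∑ a ∈ (Finset.univ.erase (lo k)).erase (hi k), f a) := fun f => by
    rw [Finset.add_sum_erase _ _ (by simp [(lo_ne_hi k).symm]),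
      Finset.add_sum_erase _ _ (Finset.mem_univ _)]
  rw [key, key fun a => (n - a.val) * (σ a).val, simple_lo, simple_hi,
    Finset.sum_congr rfl fun a ha => by
      rw [simple_of_ne (by simp at ha; exact ha.2) (by simp at ha; exact ha.1)]]
  rw [← add_assoc, ← add_assoc]
  refine Nat.add_lt_add_right ?_ _
  have hk : n - (lo k).val = (n - (hi k).val) + 1 := by
    have := k.2
    simp only [lo, hi]; omega
  rw [hk, Fin.lt_def] at *
  nlinarith

namespace IsHeap

variable (H : IsHeap p r c)

include H in
/-- Any two linear extensions are connected by admissible transpositions. -/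
theorem exists_relabel (hT : IsLinExt r T) (hT' : IsLinExt r T') :
    ∃ τ, IsAdmissibleProduct (c ∘ T) τ ∧ T' = relabel τ T := by
  induction hm : ∑ a : Fin n, (n - a.val) * (T.symm (T' a)).val using Nat.strong_induction_on
    generalizing T' with
  | _ m ih =>
    by_cases h : ∀ k, T.symm (T' (lo k)) < T.symm (T' (hi k))
    · have := eq_one_of_no_descent (T'.trans T.symm) h
      refine ⟨1, .one, ?_⟩
      rw [relabel_one]
      ext1 a
      have := DFunLike.congr_fun this a
      simpa [Equiv.symm_apply_eq] using this
    · push Not at h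
      obtain ⟨k, hk⟩ := h
      have hk' : T.symm (T' (hi k)) < T.symm (T' (lo k)) := lt_of_le_of_ne hk fun e =>
        lo_ne_hi k (T'.injective (T.symm.injective e)).symm
      -- At a descent of `T⁻¹ T'` the two boxes cannot have neighbouring contents: they would be
      -- comparable in the order of `T'`, against their order in `T`.
      have hadm : Admissible (c ∘ T') k := by
        by_contra h
        have : c (T' (lo k)) = c (T' (hi k)) + 1 ∨ c (T' (hi k)) = c (T' (lo k)) + 1 := by
          unfold Admissible at h
          simp only [Function.comp_apply] at h
          tauto
        exact absurd (hT _ _ (H.rel_of_near hT' k (Or.inr this))) (not_lt.2 hk'.le)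
      have hlt := sum_lt_of_descent (T'.trans T.symm) hk'
      obtain ⟨τ, hτ, h⟩ := ih _ (hm ▸ hlt) (H.relabel_simple hT' hadm) (by
        refine Finset.sum_congr rfl fun a _ => ?_
        rw [relabel_apply, show (simple k)⁻¹ = simple k from inv_eq_of_mul_eq_one_left
          (simple_mul_self k)]
        rfl)
      have h' : T' = relabel (simple k * τ) T := by
        rw [← relabel_relabel, ← h, relabel_relabel, simple_mul_self, relabel_one]
      refine ⟨simple k * τ, .step τ k hτ ?_, h'⟩
      rw [← comp_relabel, ← h, comp_relabel]
      have := (admissible_simple_mul_iff k 1 (c ∘ T')).2 hadm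
      rwa [mul_one] at this

include H in
/-- A linear extension is determined by its sequence of contents. -/
theorem eq_of_comp_eq (hT : IsLinExt r T) (hT' : IsLinExt r T') (h : c ∘ T = c ∘ T') : T = T' := by
  ext1 a
  induction a using WellFoundedLT.induction with
  | _ a ih =>
    by_contra hne
    have hc : c (T a) = c (T' a) := congrFun h a
    -- At the first disagreement the two boxes have equal content, so they are comparable. The
    -- smaller one already has an earlier label in the other extension, where both extensions agree:
    -- it would then be used twice.
    rcases H.comp _ _ hne (Or.inl hc) with h1 | h1
    · have h2 := hT'.lt h1
      rw [Equiv.symm_apply_apply] at h2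
      have h3 := ih _ h2
      rw [Equiv.apply_symm_apply] at h3
      exact h2.ne (T.injective h3)
    · have h2 := hT.lt h1
      rw [Equiv.symm_apply_apply] at h2
      have h3 := ih _ h2
      rw [Equiv.apply_symm_apply] at h3
      exact h2.ne (T'.injective h3.symm)

-- Consecutive labels with equal or neighbouring contents sit on a covering pair. This excludes
-- equal neighbours; a pattern `a, b, a` is a chain whose only middle box is the one labelled
-- between, and `IsHeap.triple` leaves the two exceptions.
include H in
theorem isGoodWeight (hT : IsLinExt r T) : IsGoodWeight p (c ∘ T) where
  le k := H.bound _
  ne k h := by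
    have := H.adj _ _ (H.rel_of_near hT k (Or.inl h))
    simp only [Function.comp_apply] at h
    omega
  triple k l hkl h := by
    simp only [Function.comp_apply] at h ⊢
    have hlo : lo l = hi k := lo_eq_hi hkl
    have hlt : (lo k).val + 2 = (hi l).val := by simp only [lo, hi]; omega
    have hAC : TransGen r (T (lo k)) (T (hi l)) :=
      (H.comp _ _ (fun e => by have := T.injective e; simp [Fin.ext_iff] at this; omega)
        (Or.inl h)).resolve_right fun h' => by
          have := hT.lt' h'
          rw [Fin.lt_def] at this
          omega
    have hmid : ∀ X, TransGen r (T (lo k)) X → TransGen r X (T (hi l)) → X = T (hi k) := by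
      intro X h1 h2
      have e1 := hT.lt h1
      have e2 := hT.lt h2
      rw [Equiv.symm_apply_apply, Fin.lt_def] at e1 e2
      rw [← Equiv.symm_apply_eq, Fin.ext_iff]
      simp only [lo, hi] at *
      omega
    rcases TransGen.tail'_iff.1 hAC with ⟨X, h1, h2⟩
    rcases reflTransGen_iff_eq_or_transGen.1 h1 with rfl | h1
    · have := H.adj _ _ h2
      omega
    · obtain rfl := hmid X h1 (.single h2)
      have h1' := hT.rel_of_consecutive (a := lo k) (b := hi k) rfl h1
      rcases H.triple _ _ _ h1' h2 h with ⟨X, hX, h3, h4⟩ | h' | h'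
      · exact absurd (hmid X h3 h4) hX
      · exact Or.inl h'
      · exact Or.inr h'

include H in
theorem isGoodOrbit (hT : IsLinExt r T) : IsGoodOrbit p (c ∘ T) where
  good _ hτ := H.isGoodWeight (H.relabel_isLinExt hT hτ)
  inj _ _ hσ hτ h := relabel_injective
    (H.eq_of_comp_eq (H.relabel_isLinExt hT hσ) (H.relabel_isLinExt hT hτ) h)

-- Relabelling by `τ` is injective, and it is onto the linear extensions by `exists_relabel`. So
-- `P_i` counts tableaux.
include H in
theorem card_P (hT : IsLinExt r T) :
    Nat.card (P (c ∘ T)) = Nat.card {S : Fin n ≃ B // IsLinExt r S} := by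
  refine Nat.card_congr (Equiv.ofBijective
    (fun τ => ⟨relabel τ.1 T, H.relabel_isLinExt hT τ.2⟩) ⟨fun σ τ h => ?_, fun S => ?_⟩)
  · exact Subtype.ext (relabel_injective (congrArg Subtype.val h))
  · obtain ⟨τ, hτ, h⟩ := H.exists_relabel hT S.2
    exact ⟨⟨τ, hτ⟩, Subtype.ext h.symm⟩

end IsHeap

/-- Linear extensions exist, given a rank function. -/
theorem exists_isLinExt [Finite B] (hn : Nat.card B = n) (f : B → ℕ)
    (hf : ∀ X Y, r X Y → f X < f Y) : ∃ T : Fin n ≃ B, IsLinExt r T := by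
  have := Fintype.ofFinite B
  let e := Fintype.equivFin B
  -- Ties of the rank are broken by an arbitrary enumeration, giving a linear order compatible with
  -- `r`.
  let g : B → ℕ ×ₗ Fin (Fintype.card B) := fun X => toLex (f X, e X)
  have hg : Function.Injective g := fun X Y h => e.injective (congrArg (fun a => (ofLex a).2) h)
  let : LinearOrder B := LinearOrder.lift' g hg
  let T := monoEquivOfFin B (by rw [← Nat.card_eq_fintype_card, hn])
  refine ⟨T.toEquiv, fun X Y h => ?_⟩
  change T.symm X < T.symm Y
  rw [T.symm.lt_iff_lt]
  exact Prod.Lex.toLex_lt_toLex.2 (Or.inl (hf X Y h))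

end Heap

open Relation

/-! ## The boxes of a placed skew shifted Young diagram -/

theorem IsStrictPartition.le_sub {lam : ℕ → ℕ} (h : IsStrictPartition lam) (k : ℕ)
    (hk : lam k ≠ 0) : k + lam k ≤ lam 0 := by
  induction k with
  | zero => simp
  | succ k ih =>
    have := h k hk
    have := ih (by omega)
    omega

theorem IsStrictPartition.add_le {lam : ℕ → ℕ} (h : IsStrictPartition lam) {k l : ℕ} (hkl : k ≤ l)
    (hl : lam l ≠ 0) : l + lam l ≤ k + lam k := by
  induction l, hkl using Nat.le_induction with
  | base => exact le_rfl
  | succ l _ ih =>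
    have := h l hl
    have := ih (by omega)
    omega

namespace PlacedDiagram

variable {D : PlacedDiagram}

/-- The right ends `k + lam k` decrease weakly down the nonempty rows, and so do those of `mu`.
Where `mu` is zero only the staircase bound `row ≤ column` remains, whence the last hypothesis. -/
theorem convex {A B : D.Box} {b : ℕ × ℕ} (h1 : A.1.1 ≤ b.1) (h2 : b.1 ≤ B.1.1) (h3 : A.1.2 ≤ b.2)
    (h4 : b.2 ≤ B.1.2) (h5 : b.1 ≤ b.2) : b ∈ skewBoxes D.lam D.mu := by
  obtain ⟨⟨r, c⟩, hA⟩ := A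
  obtain ⟨⟨r', c'⟩, hB⟩ := B
  obtain ⟨x, y⟩ := b
  obtain ⟨hA1, hA2⟩ : r + D.mu r ≤ c ∧ c < r + D.lam r := hA
  obtain ⟨hB1, hB2⟩ : r' + D.mu r' ≤ c' ∧ c' < r' + D.lam r' := hB
  change x + D.mu x ≤ y ∧ y < x + D.lam x
  simp only at h1 h2 h3 h4 h5
  constructor
  · by_cases h : D.mu x = 0
    · omega
    · have := D.mu_strict.add_le h1 h
      omega
  · have := D.lam_strict.add_le h2 (by omega)
    omega

theorem row_le_col (A : D.Box) : A.1.1 ≤ A.1.2 := by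
  have := A.2.1
  omega

instance : Finite D.Box := by
  refine Set.Finite.to_subtype (Set.Finite.subset
    ((Set.finite_Iio (D.lam 0 + 1)).prod (Set.finite_Iio (D.lam 0 + 1))) ?_)
  rintro ⟨r, c⟩ ⟨h1, h2⟩
  have := D.lam_strict.le_sub r (by simp only at *; omega)
  simp only [Set.mem_prod, Set.mem_Iio] at *
  omega

/-- The next box in the row or in the column. -/
def Next (A B : D.Box) : Prop := RightOf A B ∨ BelowOf A B

theorem content_of_rightOf {A B : D.Box} (h : RightOf A B) : D.content B = D.content A + 1 := by
  rw [D.content_succ, h]; simp only; omega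

theorem content_of_belowOf {A B : D.Box} (h : BelowOf A B) : D.content A = D.content B + 1 := by
  rw [D.content_succ, h]; simp only; omega

theorem reflTransGen_next {A B : D.Box} (h1 : A.1.1 ≤ B.1.1) (h2 : A.1.2 ≤ B.1.2) :
    ReflTransGen Next A B := by
  induction hm : (B.1.1 - A.1.1) + (B.1.2 - A.1.2) generalizing A with
  | zero =>
    rw [show A = B from Subtype.ext (Prod.ext (by omega) (by omega))]
  | succ m ih =>
    have hA := row_le_col A
    have hB := row_le_col B
    -- Moving right before moving down keeps the path on the side `row ≤ column` of the staircase.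
    by_cases h : A.1.2 < B.1.2
    · let C : D.Box := ⟨(A.1.1, A.1.2 + 1), convex (A := A) (B := B) le_rfl h1
        (Nat.le_succ _) h (by simp only; omega)⟩
      exact .head (b := C) (Or.inl rfl) (ih h1 h (by simp only [C]; omega))
    · let C : D.Box := ⟨(A.1.1 + 1, A.1.2), convex (A := A) (B := B) (Nat.le_succ _)
        (by simp only; omega) le_rfl h2 (by simp only; omega)⟩
      exact .head (b := C) (Or.inr rfl) (ih (by simp only [C]; omega) h2 (by simp only [C]; omega))

theorem transGen_next {A B : D.Box} (h : A ≠ B) (h1 : A.1.1 ≤ B.1.1) (h2 : A.1.2 ≤ B.1.2) :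
    TransGen Next A B :=
  (reflTransGen_iff_eq_or_transGen.1 (reflTransGen_next h1 h2)).resolve_left (Ne.symm h)

theorem le_of_transGen_next {A B : D.Box} (h : TransGen Next A B) :
    A.1.1 ≤ B.1.1 ∧ A.1.2 ≤ B.1.2 ∧ A.1.1 + A.1.2 < B.1.1 + B.1.2 := by
  have step : ∀ {X Y : D.Box}, Next X Y → X.1.1 ≤ Y.1.1 ∧ X.1.2 ≤ Y.1.2 ∧
      X.1.1 + X.1.2 < Y.1.1 + Y.1.2 := by
    rintro X Y (h | h) <;> rw [h] <;> simp only <;> omega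
  induction h with
  | single h => exact step h
  | tail _ h ih => have := step h; omega

/-- Boxes of equal or neighbouring contents are comparable. -/
theorem comparable {A B : D.Box} (h : D.content A = D.content B ∨
    D.content A = D.content B + 1 ∨ D.content B = D.content A + 1) :
    (A.1.1 ≤ B.1.1 ∧ A.1.2 ≤ B.1.2) ∨ (B.1.1 ≤ A.1.1 ∧ B.1.2 ≤ A.1.2) := by
  rw [D.content_eq, D.content_succ, D.content_succ] at h
  omega

theorem comp_next {A B : D.Box} (hne : A ≠ B) (h : D.content A = D.content B ∨
    D.content A = D.content B + 1 ∨ D.content B = D.content A + 1) :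
    TransGen Next A B ∨ TransGen Next B A := by
  rcases comparable h with h | h
  · exact Or.inl (transGen_next hne h.1 h.2)
  · exact Or.inr (transGen_next hne.symm h.1 h.2)

/-- The chain goes around a unit square. The upper right corner is present by convexity; the lower
left one can be missing only at the staircase, where `content_zero` gives the contents `0, 1, 0`. -/
theorem triple_next {A B C : D.Box} (hAB : Next A B) (hBC : Next B C)
    (h : D.content A = D.content C) :
    (∃ B', B' ≠ B ∧ TransGen Next A B' ∧ TransGen Next B' C) ∨
      (D.content A = 0 ∧ D.content B = 1) := by
  have hA := row_le_col A
  rcases hAB with hAB | hAB <;> rcases hBC with hBC | hBC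
  · have h1 := content_of_rightOf hAB
    have h2 := content_of_rightOf hBC
    omega
  · have hC : C.1 = (A.1.1 + 1, A.1.2 + 1) := by rw [hBC, hAB]
    by_cases hX : (A.1.1 + 1, A.1.2) ∈ skewBoxes D.lam D.mu
    · refine Or.inl ⟨⟨_, hX⟩, fun e => ?_, .single (Or.inr rfl), .single (Or.inl hC)⟩
      rw [Subtype.ext_iff, hAB, Prod.ext_iff] at e
      simp at e
    · right
      have h0 := D.content_zero A (hAB ▸ B.2) (hC ▸ C.2) hX
      exact ⟨h0, by rw [content_of_rightOf hAB, h0]⟩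
  · have hC : C.1 = (A.1.1 + 1, A.1.2 + 1) := by rw [hBC, hAB]
    have hX : (A.1.1, A.1.2 + 1) ∈ skewBoxes D.lam D.mu :=
      convex (A := A) (B := C) le_rfl (by rw [hC]; simp) (Nat.le_succ _) (by rw [hC])
        (by simp only; omega)
    refine Or.inl ⟨⟨_, hX⟩, fun e => ?_, .single (Or.inl rfl), .single (Or.inr hC)⟩
    rw [Subtype.ext_iff, hAB, Prod.ext_iff] at e
    simp at e
  · have h1 := content_of_belowOf hAB
    have h2 := content_of_belowOf hBC
    omega

theorem adj_next {A B : D.Box} (h : Next A B) :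
    D.content A = D.content B + 1 ∨ D.content B = D.content A + 1 :=
  h.symm.imp content_of_belowOf content_of_rightOf

/-! ### Standard tableaux as linear extensions -/

theorem isHeap_next {p : ℕ} (hp : 3 ≤ p) (h : ∀ A, D.content A ≤ (p - 1) / 2) :
    IsHeap p (Next (D := D)) D.content where
  bound A := by have := h A; omega
  adj _ _ := adj_next
  comp _ _ := comp_next
  triple _ _ _ h1 h2 h3 := (triple_next h1 h2 h3).imp_right Or.inl

/-- Labelings of the boxes that increase along rows and columns. -/
def IsIncreasing {α : Type*} [Preorder α] (l : D.Box → α) : Prop :=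
  ∀ A B, TransGen Next A B → l A < l B

theorem isStandard_iff {n : ℕ} (T : Fin n ≃ D.Box) : D.IsStandard T ↔ IsLinExt Next T := by
  constructor
  · rintro ⟨h1, h2⟩ A B (h | h)
    · exact h1 _ _ (by rw [h]) (by rw [h]; simp)
    · exact h2 _ _ (by rw [h]) (by rw [h]; simp)
  · intro h
    refine ⟨fun A B h1 h2 => h.lt (transGen_next ?_ h1.le h2.le),
      fun A B h1 h2 => h.lt (transGen_next ?_ h2.le h1.le)⟩
    · rintro rfl; exact lt_irrefl _ h2
    · rintro rfl; exact lt_irrefl _ h2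

end PlacedDiagram

/-! ### The extended diagram and its heap. -/

open Relation

namespace PlacedDiagram

variable {D : PlacedDiagram} {p u n m : ℕ}

/-- The covering relation that defines `p`-standard tableaux of the extended shape. -/
inductive ExtNext (D : PlacedDiagram) (p u : ℕ) : D.ExtBox p u → D.ExtBox p u → Prop
  | box (A B) : Next A B → ExtNext D p u (.inl A) (.inl B)
  | enter (A) (e : Fin (p - 2 * u - 1)) : D.content A = u → e.val = 0 →
      ExtNext D p u (.inl A) (.inr e)
  | new (e e' : Fin (p - 2 * u - 1)) : e.val + 1 = e'.val → ExtNext D p u (.inr e) (.inr e')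
  | leave (A B) (e : Fin (p - 2 * u - 1)) : D.content A = u → BelowOf A B →
      e.val + 1 = p - 2 * u - 1 → ExtNext D p u (.inr e) (.inl B)

theorem transGen_ext_box {A B : D.Box} (h : TransGen Next A B) :
    TransGen (ExtNext D p u) (.inl A) (.inl B) :=
  h.lift _ fun _ _ h => .box _ _ h

theorem transGen_ext_new {e e' : Fin (p - 2 * u - 1)} (h : e < e') :
    TransGen (ExtNext D p u) (.inr e) (.inr e') := by
  obtain ⟨e', he'⟩ := e'
  rw [Fin.lt_def] at h
  simp only at h
  induction e', (Nat.succ_le_of_lt h) using Nat.le_induction with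
  | base => exact .single (.new _ _ rfl)
  | succ k hk ih => exact (ih (by omega) (by omega)).tail (.new _ _ rfl)

theorem transGen_ext_enter {A : D.Box} (hA : D.content A = u) (e : Fin (p - 2 * u - 1)) :
    TransGen (ExtNext D p u) (.inl A) (.inr e) := by
  let e0 : Fin (p - 2 * u - 1) := ⟨0, by have := e.2; omega⟩
  have h0 : ExtNext D p u (.inl A) (.inr e0) := .enter A e0 hA rfl
  by_cases h : e.val = 0
  · rw [show e = e0 from Fin.ext h]; exact .single h0
  · exact .head h0 (transGen_ext_new (Fin.lt_def.2 (by simp only [e0]; omega)))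

theorem isPStandard_iff (S : Fin n ≃ D.ExtBox p u) :
    D.IsPStandard p u S ↔ IsLinExt (ExtNext D p u) S := by
  constructor
  · intro h X Y hXY
    cases hXY with
    | box A B h' =>
      rcases h' with h' | h'
      · exact h.row _ _ (by rw [h']) (by rw [h']; simp)
      · exact h.col _ _ (by rw [h']) (by rw [h']; simp)
    | enter A e hA _ => exact h.row_new A e hA
    | new e e' he => exact h.new_new _ _ (Fin.lt_def.2 (by omega))
    | leave A B e hA hB he => exact h.below A B e hA hB he
  · intro h
    refine ⟨fun A B h1 h2 => h.lt (transGen_ext_box (transGen_next ?_ h1.le h2.le)),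
      fun A B h1 h2 => h.lt (transGen_ext_box (transGen_next ?_ h2.le h1.le)),
      fun A e hA => h.lt (transGen_ext_enter hA e), fun e e' he => h.lt (transGen_ext_new he),
      fun A B e hA hB he => h _ _ (.leave A B e hA hB he)⟩
    · rintro rfl; exact lt_irrefl _ h2
    · rintro rfl; exact lt_irrefl _ h2

theorem extContent_inl (A : D.Box) : D.extContent p u (.inl A) = D.content A := rfl

theorem extContent_inr (hp : p = 2 * m + 1) (e : Fin (p - 2 * u - 1)) :
    D.extContent p u (.inr e) =
      if u + e.val + 1 ≤ m then u + e.val + 1 else 2 * m - u - (e.val + 1) := by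
  have : (p - 1) / 2 = m := by omega
  rw [extContent, this]
  split_ifs <;> omega

/-- The box below the box of content `u` precedes all boxes of content `u - 1` after it. -/
theorem exists_belowOf {A X : D.Box} (h : D.content A = D.content X + 1)
    (h2 : A.1.2 ≤ X.1.2) :
    ∃ B : D.Box, BelowOf A B ∧ ReflTransGen Next B X := by
  rw [D.content_succ] at h
  have hX := row_le_col X
  refine ⟨⟨(A.1.1 + 1, A.1.2), convex (A := A) (B := X) (by simp only; omega)
    (by simp only; omega) le_rfl h2 (by simp only; omega)⟩, rfl,
    reflTransGen_next (by simp only; omega) (by simp only; omega)⟩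

/-- The extended diagram is a heap. -/
theorem isHeap_ext (hp : p = 2 * m + 1) (hum : u + 1 ≤ m)
    (hle : ∀ A, D.content A ≤ u) (hu : ∃! A, D.content A = u) :
    IsHeap p (ExtNext D p u) (D.extContent p u) where
  bound X := by
    rcases X with A | e
    · have := hle A
      rw [extContent_inl]; omega
    · have := e.2
      rw [extContent_inr hp]; split_ifs <;> omega
  adj X Y h := by
    cases h with
    | box A B h => exact adj_next h
    | enter A e hA he =>
      rw [extContent_inl, extContent_inr hp, hA, he]; split_ifs <;> omega
    | new e e' he =>
      have := e.2
      have := e'.2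
      rw [extContent_inr hp, extContent_inr hp]; split_ifs <;> omega
    | leave A B e hA hB he =>
      have := content_of_belowOf hB
      rw [extContent_inl, extContent_inr hp]; split_ifs <;> omega
  comp := by
    -- Apart from the box `A` of content `u`, a box near an added one has content `u - 1`, and the
    -- added box is the last one. Such a box precedes `A`, or it is reached through the box below
    -- `A`, which follows the added row.
    have key : ∀ (A : D.Box) (e : Fin (p - 2 * u - 1)),
        (D.extContent p u (.inl A) = D.extContent p u (.inr e) ∨
          D.extContent p u (.inl A) = D.extContent p u (.inr e) + 1 ∨
          D.extContent p u (.inr e) = D.extContent p u (.inl A) + 1) →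
        TransGen (ExtNext D p u) (.inl A) (.inr e) ∨
          TransGen (ExtNext D p u) (.inr e) (.inl A) := by
      intro X e h
      obtain ⟨A, hA, hA'⟩ := hu
      by_cases hX : D.content X = u
      · exact Or.inl (transGen_ext_enter hX e)
      · have h1 := hle X
        have h2 := e.2
        rw [extContent_inl, extContent_inr hp] at h
        have h3 : D.content A = D.content X + 1 := by split_ifs at h <;> omega
        have h4 : e.val + 1 = p - 2 * u - 1 := by split_ifs at h <;> omega
        rcases comparable (Or.inr (Or.inl h3)) with h5 | h5
        · obtain ⟨B, hB, hBX⟩ := exists_belowOf h3 h5.2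
          have hlast : ExtNext D p u (.inr e) (.inl B) := .leave A B e hA hB h4
          rcases reflTransGen_iff_eq_or_transGen.1 hBX with rfl | hBX
          · exact Or.inr (.single hlast)
          · exact Or.inr (.head hlast (transGen_ext_box hBX))
        · exact Or.inl ((transGen_ext_box (transGen_next (by rintro rfl; exact hX hA) h5.1
            h5.2)).trans (transGen_ext_enter hA e))
    rintro (A | e) (A' | e') hne h
    · exact (comp_next (fun e => hne (congrArg _ e)) h).imp transGen_ext_box transGen_ext_box
    · exact key A e' h
    · exact (key A' e (by omega)).symm
    · rcases lt_or_gt_of_ne (fun h : e = e' => hne (congrArg _ h)) with h | h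
      · exact Or.inl (transGen_ext_new h)
      · exact Or.inr (transGen_ext_new h)
  triple X Y Z hXY hYZ h := by
    cases hXY with
    | box A B hAB =>
      cases hYZ with
      | box _ C hBC =>
        rcases triple_next hAB hBC h with ⟨B', h1, h2, h3⟩ | h'
        · exact Or.inl ⟨.inl B', fun e => h1 (Sum.inl_injective e), transGen_ext_box h2,
            transGen_ext_box h3⟩
        · exact Or.inr (Or.inl h')
      | enter _ e hB he =>
        have := hle A
        rw [extContent_inl, extContent_inr hp, he] at h
        split_ifs at h <;> omega
    | enter A e hA he =>
      cases hYZ with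
      | new _ e' he' =>
        -- Contents along the added row turn only at its peak `(p - 1)/2`. When `u = (p - 3)/2` the
        -- peak is the first added box.
        right; right
        rw [extContent_inl, extContent_inr hp] at *
        split_ifs at h ⊢ <;> omega
      | leave A' C _ hA' hC he' => omega
    | new e e' he =>
      have := e.2
      have := e'.2
      cases hYZ with
      | new _ e'' he'' =>
        have := e''.2
        right; right
        rw [extContent_inr hp, extContent_inr hp] at *
        split_ifs at h ⊢ <;> omega
      | leave A' C _ hA' hC he' =>
        have := content_of_belowOf hC
        rw [extContent_inl, extContent_inr hp] at h
        split_ifs at h <;> omega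
    | leave A B e hA hB he =>
      have h1 := content_of_belowOf hB
      cases hYZ with
      | box _ C hBC =>
        have h2 : D.content C = u := by
          rw [extContent_inl, extContent_inr hp] at h
          split_ifs at h <;> omega
        -- The third box would have content `u`, hence be `A` itself, although it lies below `A`.
        have h3 := le_of_transGen_next (TransGen.single hBC)
        have h4 : A = C := hu.unique hA h2
        have h5 : B.1.1 = A.1.1 + 1 := by rw [hB]
        rw [h4] at h5
        omega
      | enter _ e' hB' _ => omega

/-- A rank function on the extended diagram. -/
theorem exists_rank_ext (hu : ∃! A, D.content A = u) :
    ∃ f : D.ExtBox p u → ℕ, ∀ X Y, ExtNext D p u X Y → f X < f Y := by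
  obtain ⟨A, hA, hA'⟩ := hu
  -- Multiplying the row by `p + 1` leaves room for the `p - 2u - 1` added boxes between `A` and the
  -- box below it.
  refine ⟨Sum.elim (fun B => B.1.1 * (p + 1) + B.1.2)
    (fun e => A.1.1 * (p + 1) + A.1.2 + 1 + e.val), fun X Y h => ?_⟩
  cases h with
  | box B C h =>
    simp only [Sum.elim_inl]
    rcases h with h | h <;> rw [h] <;> simp only
    · omega
    · rw [add_mul]; omega
  | enter B e hB he =>
    rw [hA' B hB]
    simp only [Sum.elim_inl, Sum.elim_inr]; omega
  | new e e' he => simp only [Sum.elim_inr]; omega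
  | leave B C e hB hC he =>
    rw [hA' B hB] at hC
    have h1 : C.1.1 = A.1.1 + 1 := by rw [hC]
    have h2 : C.1.2 = A.1.2 := by rw [hC]
    have := e.2
    simp only [Sum.elim_inl, Sum.elim_inr, h1, h2, add_mul]; omega

theorem exists_rank :
    ∃ f : D.Box → ℕ, ∀ X Y, Next (D := D) X Y → f X < f Y := by
  refine ⟨fun B => B.1.1 + B.1.2, fun X Y h => ?_⟩
  exact (le_of_transGen_next (TransGen.single h)).2.2

/-- The numbers of boxes differ: `n - p + 2u + 1 < n` because `u ≤ (p - 3)/2`. -/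
theorem not_first_of_second (hp : p = 2 * m + 1) (h : D.Second p n u) : ¬ D.First p n := by
  rintro ⟨h1, -⟩
  obtain ⟨h2, h3, k, h4, ⟨h5, -⟩, -⟩ := h
  omega

theorem Second.unique {u' : ℕ} (h : D.Second p n u) (h' : D.Second p n u') : u = u' := by
  obtain ⟨-, -, k, h4, ⟨h5, -⟩, -⟩ := h
  obtain ⟨-, -, k', h4', ⟨h5', -⟩, -⟩ := h'
  omega

/-- The heap whose linear extensions are the tableaux attached to a diagram of the index set. -/
theorem exists_heap (hp3 : 3 ≤ p) (hp : p = 2 * m + 1) (hD : D.IsIndex p n) :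
    ∃ (B : Type) (r : B → B → Prop) (c : B → ℕ), Finite B ∧ Nat.card B = n ∧ IsHeap p r c ∧
      (∃ f : B → ℕ, ∀ X Y, r X Y → f X < f Y) ∧
      (∀ i : Fin n → ℕ, D.Affords p i ↔ ∃ T : Fin n ≃ B, IsLinExt r T ∧ i = c ∘ T) ∧
      D.gammaZero = Nat.card {b : B // c b = 0} ∧
      (D.First p n → D.numStandard n = Nat.card {T : Fin n ≃ B // IsLinExt r T}) ∧
      ∀ u, D.Second p n u → D.numPStandard p u n = Nat.card {T : Fin n ≃ B // IsLinExt r T} := by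
  by_cases hF : D.First p n
  · refine ⟨D.Box, Next, D.content, inferInstance, hF.1, isHeap_next hp3 hF.2, exists_rank,
      fun i => ⟨?_, ?_⟩, rfl, fun _ => ?_, fun u hu => absurd hF (not_first_of_second hp hu)⟩
    · rintro (⟨-, T, hT, h⟩ | ⟨u, hu, -⟩)
      · exact ⟨T, (isStandard_iff T).1 hT, funext h⟩
      · exact absurd hF (not_first_of_second hp hu)
    · rintro ⟨T, hT, rfl⟩
      exact Or.inl ⟨hF, T, (isStandard_iff T).2 hT, fun _ => rfl⟩
    · simp only [numStandard, isStandard_iff]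
  · obtain ⟨u, hu⟩ := hD.resolve_left hF
    have hu' := hu
    obtain ⟨h1, h2, k, h3, ⟨h4, h5⟩, h6⟩ := hu'
    refine ⟨D.ExtBox p u, ExtNext D p u, D.extContent p u, inferInstance, ?_,
      isHeap_ext hp (by omega) h5 h6, exists_rank_ext h6, fun i => ⟨?_, ?_⟩, ?_,
      fun h => absurd h hF, fun u' hu' => ?_⟩
    · rw [Nat.card_sum, h4, Nat.card_eq_fintype_card, Fintype.card_fin]; omega
    · rintro (⟨h, -⟩ | ⟨u', hu', S, hS, h⟩)
      · exact absurd h hF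
      · obtain rfl := hu.unique hu'
        exact ⟨S, (isPStandard_iff S).1 hS, funext h⟩
    · rintro ⟨S, hS, rfl⟩
      exact Or.inr ⟨u, hu, S, (isPStandard_iff S).2 hS, fun _ => rfl⟩
    · refine Nat.card_congr (Equiv.ofBijective (fun A => ⟨.inl A.1, A.2⟩) ⟨fun A A' h => ?_, ?_⟩)
      · exact Subtype.ext (Sum.inl_injective (congrArg Subtype.val h))
      · rintro ⟨A | e, h⟩
        · exact ⟨⟨A, h⟩, rfl⟩
        · have := e.2
          rw [extContent_inr hp] at h
          split_ifs at h
          omega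
    · obtain rfl := hu.unique hu'
      simp only [numPStandard, isPStandard_iff]

end PlacedDiagram

open Relation

namespace PlacedDiagram

variable {D E : PlacedDiagram} {p u n m : ℕ}

/-! ### Recovering a diagram from its vectors -/

theorem IsIncreasing.le_of_lt {l : D.Box → Fin n} (hl : IsIncreasing l) {A B : D.Box}
    (h : D.content A = D.content B ∨ D.content A = D.content B + 1 ∨
      D.content B = D.content A + 1) (hlt : l A < l B) : A.1.1 ≤ B.1.1 ∧ A.1.2 ≤ B.1.2 := by
  refine (comparable h).resolve_right fun h' => ?_
  have := hl B A (transGen_next (by rintro rfl; exact lt_irrefl _ hlt) h'.1 h'.2)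
  exact lt_asymm this hlt

/-- Labels increase along each diagonal, so the left neighbour of `B` is the last box of its content
before `B`. Neighbours are thus expressed through contents and labels alone. -/
theorem IsIncreasing.rightOf_iff {l : D.Box → Fin n} (hl : IsIncreasing l) (A B : D.Box) :
    RightOf A B ↔ D.content B = D.content A + 1 ∧ l A < l B ∧
      ∀ C, D.content C = D.content A → l A < l C → ¬ l C < l B := by
  constructor
  · intro h
    refine ⟨content_of_rightOf h, hl _ _ (.single (Or.inl h)), fun C hC hAC hCB => ?_⟩
    have h1 := hl.le_of_lt (Or.inl hC.symm) hAC
    rw [D.content_eq] at hC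
    have hne : C.1.1 ≠ A.1.1 := fun e => lt_irrefl _ (show l A < l A by
      rwa [show C = A from Subtype.ext (Prod.ext e (by omega))] at hAC)
    have hB1 : B.1.1 = A.1.1 := by rw [h]
    have hB2 : B.1.2 = A.1.2 + 1 := by rw [h]
    have := hl B C (transGen_next (by rintro rfl; exact lt_irrefl _ hCB) (by omega) (by omega))
    exact lt_asymm this hCB
  · rintro ⟨h1, h2, h3⟩
    have h4 := hl.le_of_lt (Or.inr (Or.inr h1)) h2
    rw [D.content_succ] at h1
    have hA := row_le_col A
    by_contra hne
    have hr : A.1.1 < B.1.1 := by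
      refine lt_of_le_of_ne h4.1 fun e => hne (Prod.ext e.symm ?_)
      simp only; omega
    -- The left neighbour of `B`, on the diagonal of `A`.
    let C : D.Box := ⟨(B.1.1, A.1.2 + (B.1.1 - A.1.1)), convex (A := A) (B := B) h4.1 le_rfl
      (by simp only; omega) (by simp only; omega) (by simp only; omega)⟩
    have hC1 : C.1.1 = B.1.1 := rfl
    have hC2 : C.1.2 = A.1.2 + (B.1.1 - A.1.1) := rfl
    refine h3 C (by rw [D.content_eq]; omega) (hl _ _ (transGen_next ?_ (by omega) (by omega)))
      (hl _ _ (transGen_next ?_ (by omega) (by omega)))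
    · intro e; rw [← e] at hC1; omega
    · intro e; rw [e] at hC2; omega

theorem IsIncreasing.belowOf_iff {l : D.Box → Fin n} (hl : IsIncreasing l) (A B : D.Box) :
    BelowOf A B ↔ D.content A = D.content B + 1 ∧ l A < l B ∧
      ∀ C, D.content C = D.content A → l A < l C → ¬ l C < l B := by
  constructor
  · intro h
    refine ⟨content_of_belowOf h, hl _ _ (.single (Or.inr h)), fun C hC hAC hCB => ?_⟩
    have h1 := hl.le_of_lt (Or.inl hC.symm) hAC
    rw [D.content_eq] at hC
    have hne : C.1.1 ≠ A.1.1 := fun e => lt_irrefl _ (show l A < l A by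
      rwa [show C = A from Subtype.ext (Prod.ext e (by omega))] at hAC)
    have hB1 : B.1.1 = A.1.1 + 1 := by rw [h]
    have hB2 : B.1.2 = A.1.2 := by rw [h]
    have := hl B C (transGen_next (by rintro rfl; exact lt_irrefl _ hCB) (by omega) (by omega))
    exact lt_asymm this hCB
  · rintro ⟨h1, h2, h3⟩
    have h4 := hl.le_of_lt (Or.inr (Or.inl h1)) h2
    rw [D.content_succ] at h1
    have hA := row_le_col A
    by_contra hne
    have hr : A.1.2 < B.1.2 := by
      refine lt_of_le_of_ne h4.2 fun e => hne (Prod.ext ?_ e.symm)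
      simp only; omega
    -- The box above `B`, on the diagonal of `A`.
    let C : D.Box := ⟨(A.1.1 + (B.1.2 - A.1.2), B.1.2), convex (A := A) (B := B)
      (by simp only; omega) (by simp only; omega) h4.2 le_rfl (by simp only; omega)⟩
    have hC1 : C.1.1 = A.1.1 + (B.1.2 - A.1.2) := rfl
    have hC2 : C.1.2 = B.1.2 := rfl
    refine h3 C (by rw [D.content_eq]; omega) (hl _ _ (transGen_next ?_ (by omega) (by omega)))
      (hl _ _ (transGen_next ?_ (by omega) (by omega)))
    · intro e; rw [← e] at hC2; omega
    · intro e; rw [e] at hC1; omega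

/-- The neighbour relations are functions of contents and labels by `rightOf_iff` and `belowOf_iff`,
so a bijection preserving both data preserves them. -/
theorem same_of_labels {l : D.Box → Fin n} (hl : IsIncreasing l) {l' : E.Box → Fin n}
    (hl' : IsIncreasing l') (e : D.Box ≃ E.Box) (hc : ∀ A, E.content (e A) = D.content A)
    (hll : ∀ A, l' (e A) = l A) : D.Same E := by
  refine ⟨e, hc, fun A B => ?_, fun A B => ?_⟩
  · rw [hl.rightOf_iff, hl'.rightOf_iff, ← e.forall_congr_right]
    simp only [hc, hll]
  · rw [hl.belowOf_iff, hl'.belowOf_iff, ← e.forall_congr_right]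
    simp only [hc, hll]

/-- Two occurrences of `a` in the vector `i` without an occurrence of `a - 1` in between. -/
def HasGap (i : Fin n → ℕ) (a : ℕ) : Prop :=
  ∃ k k', k < k' ∧ i k = a ∧ i k' = a ∧ ∀ l, k < l → l < k' → i l + 1 ≠ a

/-- The box below `A` is present, since otherwise `content_zero` would make the content zero; it has
content one less and lies before `B`. -/
theorem IsIncreasing.exists_between {l : D.Box → Fin n} (hl : IsIncreasing l) {A B : D.Box}
    (h0 : D.content A ≠ 0) (h : D.content A = D.content B) (hlt : l A < l B) :
    ∃ X, l A < l X ∧ l X < l B ∧ D.content X + 1 = D.content A := by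
  have h1 := hl.le_of_lt (Or.inl h) hlt
  rw [D.content_eq] at h
  have hA := row_le_col A
  have hne : A.1.1 ≠ B.1.1 := fun e => lt_irrefl _ (show l A < l A by
    rwa [← show A = B from Subtype.ext (Prod.ext e (by omega))] at hlt)
  have hX : (A.1.1 + 1, A.1.2) ∈ skewBoxes D.lam D.mu := by
    by_contra hX
    refine h0 (D.content_zero A ?_ ?_ hX)
    · exact convex (A := A) (B := B) le_rfl h1.1 (Nat.le_succ _) (by simp only; omega)
        (by simp only; omega)
    · exact convex (A := A) (B := B) (Nat.le_succ _) (by simp only; omega) (Nat.le_succ _)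
        (by simp only; omega) (by simp only; omega)
  refine ⟨⟨_, hX⟩, hl _ _ (.single (Or.inr rfl)), hl _ _ (transGen_next ?_ ?_ h1.2), ?_⟩
  · intro e
    have := congrArg (fun X : D.Box => X.1) e
    simp only [Prod.ext_iff] at this
    omega
  · simp only; omega
  · exact (content_of_belowOf (A := A) (B := ⟨_, hX⟩) rfl).symm

theorem isIncreasing_of_isStandard {T : Fin n ≃ D.Box} (hT : D.IsStandard T) :
    IsIncreasing T.symm :=
  fun _ _ h => ((isStandard_iff T).1 hT).lt h

theorem isIncreasing_of_isPStandard {S : Fin n ≃ D.ExtBox p u} (hS : D.IsPStandard p u S) :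
    IsIncreasing fun A : D.Box => S.symm (.inl A) :=
  fun _ _ h => ((isPStandard_iff S).1 hS).lt (transGen_ext_box h)

theorem not_hasGap_of_isStandard {T : Fin n ≃ D.Box} (hT : D.IsStandard T) {i : Fin n → ℕ}
    (hi : ∀ k, i k = D.content (T k)) {a : ℕ} (ha : 1 ≤ a) : ¬ HasGap i a := by
  rintro ⟨k, k', hkk, hk, hk', h⟩
  rw [hi] at hk hk'
  obtain ⟨X, h1, h2, h3⟩ := (isIncreasing_of_isStandard hT).exists_between (A := T k) (B := T k')
    (by omega) (by omega) (by simpa using hkk)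
  rw [Equiv.symm_apply_apply] at h1 h2
  refine h _ h1 h2 ?_
  rw [hi, Equiv.apply_symm_apply]; omega

theorem le_extContent_inr (hp : p = 2 * m + 1) (hum : u + 1 ≤ m) (e : Fin (p - 2 * u - 1)) :
    u ≤ D.extContent p u (.inr e) ∧
      (D.extContent p u (.inr e) = u → e.val + 1 = p - 2 * u - 1) := by
  have := e.2
  rw [extContent_inr hp]; split_ifs <;> omega

theorem not_hasGap_of_isPStandard (hp : p = 2 * m + 1) (hum : u + 1 ≤ m)
    {S : Fin n ≃ D.ExtBox p u} (hS : D.IsPStandard p u S) {i : Fin n → ℕ}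
    (hi : ∀ k, i k = D.extContent p u (S k)) {a : ℕ} (ha : 1 ≤ a) (hau : a < u) :
    ¬ HasGap i a := by
  rintro ⟨k, k', hkk, hk, hk', h⟩
  rw [hi] at hk hk'
  have hbox : ∀ k, D.extContent p u (S k) = a → ∃ A, k = S.symm (.inl A) ∧ D.content A = a := by
    intro k hk
    rcases hX : S k with A | e
    · rw [hX] at hk
      exact ⟨A, by rw [← hX, Equiv.symm_apply_apply], hk⟩
    · have := (le_extContent_inr (D := D) hp hum e).1
      rw [hX] at hk
      omega
  obtain ⟨A, rfl, hA⟩ := hbox k hk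
  obtain ⟨B, rfl, hB⟩ := hbox k' hk'
  obtain ⟨X, h1, h2, h3⟩ := (isIncreasing_of_isPStandard hS).exists_between (A := A) (B := B)
    (by omega) (by omega) hkk
  refine h _ h1 h2 ?_
  rw [hi, Equiv.apply_symm_apply, extContent_inl]; omega

/-- The box `A` and the last added box both have content `u`. A box of content `u - 1` labelled
after `A` lies weakly after the box below `A`, hence after the last added box. -/
theorem hasGap_of_isPStandard (hp : p = 2 * m + 1) (hum : u + 1 ≤ m)
    (hu : ∃! A, D.content A = u)
    {S : Fin n ≃ D.ExtBox p u} (hS : D.IsPStandard p u S) {i : Fin n → ℕ}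
    (hi : ∀ k, i k = D.extContent p u (S k)) : HasGap i u := by
  obtain ⟨A, hA, hA'⟩ := hu
  let e : Fin (p - 2 * u - 1) := ⟨p - 2 * u - 2, by omega⟩
  have he : e.val + 1 = p - 2 * u - 1 := by simp only [e]; omega
  refine ⟨S.symm (.inl A), S.symm (.inr e), hS.row_new A e hA, ?_, ?_, fun l h1 h2 hl => ?_⟩
  · rw [hi, Equiv.apply_symm_apply]; exact hA
  · rw [hi, Equiv.apply_symm_apply, extContent_inr hp]; split_ifs <;> omega
  · rw [hi] at hl
    rcases hX : S l with X | e'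
    · rw [← Equiv.eq_symm_apply] at hX
      subst hX
      rw [Equiv.apply_symm_apply, extContent_inl] at hl
      have h3 : D.content A = D.content X + 1 := by omega
      have h4 := (isIncreasing_of_isPStandard hS).le_of_lt (Or.inr (Or.inl h3)) h1
      obtain ⟨B, hB, hBX⟩ := exists_belowOf h3 h4.2
      have h5 := hS.below A B e hA hB he
      rcases reflTransGen_iff_eq_or_transGen.1 hBX with rfl | hBX
      · exact lt_asymm h5 h2
      · exact lt_asymm (h5.trans (isIncreasing_of_isPStandard hS _ _ hBX)) h2
    · have := (le_extContent_inr (D := D) hp hum e').1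
      rw [hX] at hl
      omega

/-- The original boxes of the extended diagram are determined by the sequence of contents. -/
theorem isPStandard_inl_iff (hp : p = 2 * m + 1) (hum : u + 1 ≤ m)
    (hle : ∀ A, D.content A ≤ u)
    {S : Fin n ≃ D.ExtBox p u} (hS : D.IsPStandard p u S) {i : Fin n → ℕ}
    (hi : ∀ k, i k = D.extContent p u (S k)) (k : Fin n) :
    (∃ A, S k = .inl A) ↔ i k < u ∨ (i k = u ∧ ∃ k', k < k' ∧ i k' = u) := by
  constructor
  · rintro ⟨A, hA⟩
    rw [← Equiv.eq_symm_apply] at hA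
    subst hA
    have h1 := hle A
    rw [hi, Equiv.apply_symm_apply, extContent_inl]
    rcases h1.lt_or_eq with h | h
    · exact Or.inl h
    · let e : Fin (p - 2 * u - 1) := ⟨p - 2 * u - 2, by omega⟩
      have he : e.val + 1 = p - 2 * u - 1 := by simp only [e]; omega
      refine Or.inr ⟨h, S.symm (.inr e), hS.row_new A e h, ?_⟩
      rw [hi, Equiv.apply_symm_apply, extContent_inr hp]; split_ifs <;> omega
  · intro h
    rcases hX : S k with A | e
    · exact ⟨A, rfl⟩
    · exfalso
      have h1 := le_extContent_inr (D := D) hp hum e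
      rw [← Equiv.eq_symm_apply] at hX
      subst hX
      rw [hi, Equiv.apply_symm_apply] at h
      obtain ⟨h2, k', h3, h4⟩ := h.resolve_left (by omega)
      have h5 := h1.2 h2
      rcases hX : S k' with A | e'
      · have := hi k'
        rw [hX, h4, extContent_inl] at this
        have h6 := hS.row_new A e this.symm
        rw [← Equiv.eq_symm_apply] at hX
        exact lt_asymm h6 (hX ▸ h3)
      · have := hi k'
        rw [hX, h4] at this
        have h6 := (le_extContent_inr (D := D) hp hum e').2 this.symm
        rw [← Equiv.eq_symm_apply] at hX
        rw [show e = e' from Fin.ext (by omega), hX] at h3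
        exact lt_irrefl _ h3

/-- A vector affords at most one placed diagram. -/
theorem same_of_affords (hp : p = 2 * m + 1) {i : Fin n → ℕ} (hD : D.Affords p i)
    (hE : E.Affords p i) : D.Same E := by
  rcases hD with ⟨-, T, hT, hi⟩ | ⟨u, ⟨hu1, hu2, -, -, ⟨-, hle⟩, hu⟩, S, hS, hi⟩ <;>
    rcases hE with ⟨-, T', hT', hi'⟩ | ⟨u', ⟨hu1', hu2', -, -, ⟨-, hle'⟩, hu'⟩, S', hS', hi'⟩
  · refine same_of_labels (isIncreasing_of_isStandard hT) (isIncreasing_of_isStandard hT')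
      (T.symm.trans T') (fun A => ?_) (fun A => by simp)
    rw [Equiv.trans_apply, ← hi', hi, Equiv.apply_symm_apply]
  · exact absurd (hasGap_of_isPStandard hp (by omega) hu' hS' hi')
      (not_hasGap_of_isStandard hT hi hu1')
  · exact absurd (hasGap_of_isPStandard hp (by omega) hu hS hi)
      (not_hasGap_of_isStandard hT' hi' hu1)
  · have g := hasGap_of_isPStandard hp (by omega) hu hS hi
    have g' := hasGap_of_isPStandard hp (by omega) hu' hS' hi'
    -- The number `u` is the least positive content with a gap.
    obtain rfl : u = u' := by
      rcases lt_trichotomy u u' with h | h | h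
      · exact absurd g (not_hasGap_of_isPStandard hp (by omega) hS' hi' hu1 h)
      · exact h
      · exact absurd g' (not_hasGap_of_isPStandard hp (by omega) hS hi hu1' h)
    -- The original boxes are those of content below `u` together with the earlier of the two boxes
    -- of content `u`, so the vector separates them from the added ones.
    have key : ∀ k, (∃ A, S k = .inl A) ↔ ∃ A, S' k = .inl A := fun k => by
      rw [isPStandard_inl_iff hp (by omega) hle hS hi,
        isPStandard_inl_iff hp (by omega) hle' hS' hi']
    have h1 : ∀ A, ∃ B, S' (S.symm (.inl A)) = .inl B := fun A =>
      (key _).1 ⟨A, Equiv.apply_symm_apply _ _⟩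
    choose f hf using h1
    have hf' : ∀ A, S'.symm (.inl (f A)) = S.symm (.inl A) := fun A => by
      rw [← hf, Equiv.symm_apply_apply]
    let e : D.Box ≃ E.Box := Equiv.ofBijective f ⟨fun A B h => ?_, fun B => ?_⟩
    · refine same_of_labels (isIncreasing_of_isPStandard hS) (isIncreasing_of_isPStandard hS')
        e (fun A => ?_) hf'
      have := hi (S.symm (.inl A))
      rwa [Equiv.apply_symm_apply, hi', hf] at this
    · exact Sum.inl_injective (S.symm.injective (by rw [← hf', ← hf', h]))
    · obtain ⟨A, hA⟩ := (key (S'.symm (.inl B))).2 ⟨B, Equiv.apply_symm_apply _ _⟩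
      refine ⟨A, Sum.inl_injective (β := Fin (p - 2 * u - 1)) ?_⟩
      rw [← hf, ← hA, Equiv.symm_apply_apply, Equiv.apply_symm_apply]

/-- Diagrams that are the same are afforded by the same vectors. -/
theorem Affords.of_same (h : D.Same E) {i : Fin n → ℕ} (hE : E.Affords p i) : D.Affords p i := by
  obtain ⟨e, hc, hr, hb⟩ := h
  have hPS : ∀ {u m}, E.InPS u m → D.InPS u m := fun h =>
    ⟨(Nat.card_congr e).trans h.1, fun A => hc A ▸ h.2 _⟩
  have hnext : ∀ A B, Next A B → Next (e A) (e B) := fun A B h =>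
    h.imp (hr A B).2 (hb A B).2
  rcases hE with ⟨hF, T, hT, hi⟩ | ⟨u, ⟨hu1, hu2, k, hk, hF, A₀, hA, hA'⟩, S, hS, hi⟩
  · refine Or.inl ⟨hPS hF, T.trans e.symm, ?_, fun k => ?_⟩
    · rw [isStandard_iff] at hT ⊢
      exact fun A B h => hT _ _ (hnext _ _ h)
    · rw [hi, ← hc, Equiv.trans_apply, Equiv.apply_symm_apply]
  · refine Or.inr ⟨u, ⟨hu1, hu2, k, hk, hPS hF, e.symm A₀, ?_, fun A h => ?_⟩,
      S.trans (Equiv.sumCongr e.symm (Equiv.refl _)), ?_, fun k => ?_⟩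
    · simp only; rw [← hc, Equiv.apply_symm_apply]; exact hA
    · rw [Equiv.eq_symm_apply]; exact hA' _ ((hc A).trans h)
    · rw [isPStandard_iff] at hS ⊢
      intro X Y h
      change S.symm (Sum.map e id X) < S.symm (Sum.map e id Y)
      refine hS _ _ ?_
      cases h with
      | box A B h => exact .box _ _ (hnext _ _ h)
      | enter A a h h' => exact .enter _ _ ((hc A).trans h) h'
      | new a b h => exact .new _ _ h
      | leave A B a h h' h'' => exact .leave (e A) (e B) _ ((hc A).trans h) ((hb A B).2 h') h''
    · rw [hi, Equiv.trans_apply]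
      rcases S k with A | a
      · change E.content A = D.content (e.symm A)
        rw [← hc, Equiv.apply_symm_apply]
      · rfl

theorem Affords.isIndex {i : Fin n → ℕ} (h : D.Affords p i) : D.IsIndex p n :=
  h.imp And.left fun ⟨u, hu, _⟩ => ⟨u, hu⟩

end PlacedDiagram

end HeckeClifford

end

/-! ### Assembly of the theorem. -/

theorem mainTheorem4 (F : Type*) [Field F] [IsAlgClosed F] (p : ℕ) [CharP F p] (hp : 3 ≤ p)
    (n : ℕ) :
    -- the modules `D_p` exist: some vector affords each diagram of the index set, and the formulas
    -- make `D^i` a module for every vector affording it and every choice of `L(i)`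
    (∀ D : HeckeClifford.PlacedDiagram, D.IsIndex p n →
      ∃ i : Fin n → ℕ, D.Affords p i) ∧
    (∀ (D : HeckeClifford.PlacedDiagram) (i : Fin n → ℕ), D.Affords p i →
      Nonempty (HeckeClifford.Component F i) ∧
      ∀ L : HeckeClifford.Component F i,
        ∃ M : HeckeClifford.SuperModule (HeckeClifford.HC.gr F (n := n))
          (HeckeClifford.DSpace L), HeckeClifford.IsDModule L M) ∧
    -- type and dimension
    (∀ (D : HeckeClifford.PlacedDiagram) (M : HeckeClifford.DpModule F p n D),
      (Even D.gammaZero → M.mod.IsTypeM) ∧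
      (Odd D.gammaZero → M.mod.IsTypeQ) ∧
      (D.First p n → Module.finrank F (HeckeClifford.DSpace M.comp) =
        2 ^ (n - D.gammaZero / 2) * D.numStandard n) ∧
      (∀ u, D.Second p n u → Module.finrank F (HeckeClifford.DSpace M.comp) =
        2 ^ (n - D.gammaZero / 2) * D.numPStandard p u n)) ∧
    -- integral irreducible completely splittable modules
    (∀ (D : HeckeClifford.PlacedDiagram) (M : HeckeClifford.DpModule F p n D),
      M.mod.Irreducible ∧ HeckeClifford.CompletelySplittable M.mod ∧
        HeckeClifford.IsIntegral p M.mod) ∧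
    -- isomorphic if and only if the diagrams are the same
    (∀ (D E : HeckeClifford.PlacedDiagram) (M : HeckeClifford.DpModule F p n D)
      (N : HeckeClifford.DpModule F p n E),
      M.mod.Isomorphic N.mod ↔ D.Same E) := by
  obtain ⟨m, hm⟩ : ∃ m, p = 2 * m + 1 := by
    have hprime : p.Prime := (CharP.char_is_prime_or_zero F p).resolve_right (by omega)
    obtain ⟨m, hm⟩ := hprime.odd_of_ne_two (by omega)
    exact ⟨m, hm⟩
  have hgood : ∀ {D : HeckeClifford.PlacedDiagram} {i : Fin n → ℕ}, D.Affords p i →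
      HeckeClifford.IsGoodOrbit p i := fun {D i} h => by
    obtain ⟨B, r, c, -, -, H, -, haff, -⟩ := D.exists_heap hp hm h.isIndex
    obtain ⟨T, hT, rfl⟩ := (haff i).1 h
    exact H.isGoodOrbit hT
  refine ⟨fun D hD => ?_, fun D i h => ⟨HeckeClifford.nonempty_component i, fun L =>
    HeckeClifford.exists_isDModule L hp (hgood h)⟩, fun D M => ?_, fun D M => ?_, fun D E M N => ?_⟩
  · obtain ⟨B, r, c, _, hcard, H, ⟨f, hf⟩, haff, -⟩ := D.exists_heap hp hm hD
    obtain ⟨T, hT⟩ := HeckeClifford.exists_isLinExt hcard f hf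
    exact ⟨_, (haff _).2 ⟨T, hT, rfl⟩⟩
  · obtain ⟨i, h, L, M, hM⟩ := M
    have hi := hgood h
    obtain ⟨B, r, c, _, hcard, H, -, haff, hγ, hF, hS⟩ := D.exists_heap hp hm h.isIndex
    obtain ⟨T, hT, rfl⟩ := (haff i).1 h
    have hγ' : D.gammaZero = Fintype.card {a // (c ∘ T) a = 0} := by
      rw [hγ, ← Nat.card_eq_fintype_card]
      exact (Nat.card_congr (T.subtypeEquiv fun _ => Iff.rfl)).symm
    rw [hγ']
    refine ⟨(hM.type hp hi).1, (hM.type hp hi).2, fun h => ?_, fun u h => ?_⟩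
    · rw [hF h, HeckeClifford.finrank_DSpace hp hi, H.card_P hT]
    · rw [hS u h, HeckeClifford.finrank_DSpace hp hi, H.card_P hT]
  · have hi := hgood M.affords
    exact ⟨M.isD.irreducible hp hi, M.isD.completelySplittable, M.isD.isIntegral hi⟩
  · have hi := hgood M.affords
    have hj := hgood N.affords
    refine ⟨fun h => ?_, fun h => ?_⟩
    · obtain ⟨τ, hτ, hij⟩ := M.isD.exists_of_isomorphic hi hj N.isD h
      obtain ⟨B, r, c, -, -, H, -, haff, -⟩ := E.exists_heap hp hm N.affords.isIndex
      obtain ⟨T, hT, hj'⟩ := (haff _).1 N.affords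
      -- The weight of `M` lies in the admissible orbit of the weight of `N`, so relabelling a
      -- tableau of `E` shows that it affords `E` as well as `D`.
      refine HeckeClifford.PlacedDiagram.same_of_affords hm M.affords ((haff _).2
        ⟨HeckeClifford.relabel τ T, H.relabel_isLinExt hT (hj' ▸ hτ), ?_⟩)
      rw [hij, hj']
      rfl
    · obtain ⟨B, r, c, -, -, H, -, haff, -⟩ := D.exists_heap hp hm M.affords.isIndex
      obtain ⟨T, hT, hi'⟩ := (haff _).1 M.affords
      obtain ⟨T', hT', hj'⟩ := (haff _).1 (N.affords.of_same h)
      -- Equal diagrams are afforded by the same vectors. Both weights thus come from linear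
      -- extensions of one heap, which are joined by admissible steps.
      obtain ⟨τ, hτ, hTT⟩ := H.exists_relabel hT hT'
      refine M.isD.isomorphic hp hi hj N.isD (hi' ▸ hτ) ?_
      rw [hj', hTT, HeckeClifford.comp_relabel, hi']
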